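/- Let $\Bbbk$ be a field and let $(V,c)$ be a braided vector space over $\Bbbk$, i.e. $V$ is a vector space (of any dimension) and $c: V\otimes V\to V\otimes V$ is a linear isomorphism with $(c\otimes \mathrm{id})(\mathrm{id}\otimes c)(c\otimes \mathrm{id})=(\mathrm{id}\otimes c)(c\otimes \mathrm{id})(\mathrm{id}\otimes c)$. Let $GL(V,c)$ be the group of all $g\in GL(V)$ such that $g\otimes g$ commutes with $c$. A braided Hopf algebra is a vector space $R$ with a braiding $c_R$, an associative unital product $m$ and a coassociative counital coproduct $\Delta$, with unit $1$ and counit $\varepsilon$, such that $m,1,\Delta,\varepsilon$ commute with $c_R$ (that is, $c_R(m\otimes\mathrm{id})=(\mathrm{id}\otimes m)(c_R\otimes\mathrm{id})(\mathrm{id}\otimes c_R)$, $(\mathrm{id}\otimes\Delta)c_R=(c_R\otimes\mathrm{id})(\mathrm{id}\otimes c_R)(\Delta\otimes\mathrm{id})$, $c_R(1\otimes x)=x\otimes 1$, $(\mathrm{id}\otimes\varepsilon)c_R=\varepsilon\otimes\mathrm{id}$, and the mirror images of these identities), such that $\Delta m=(m\otimes m)(\mathrm{id}\otimes c_R\otimes\mathrm{id})(\Delta\otimes\Delta)$,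 $\Delta(1)=1\otimes 1$ and $\varepsilon$ is an algebra map, and such that $\mathrm{id}_R$ has an inverse for the convolution product of $\operatorname{End}R$. Its group of automorphisms $\mathrm{Aut}_{\mathrm{Hopf}}\,R$ consists of the linear automorphisms of $R$ that preserve $m$, $\Delta$ and $c_R$. A Nichols algebra of $(V,c)$ is a braided Hopf algebra $\mathfrak B(V)$ with an $\mathbb N$-grading $\mathfrak B(V)=\bigoplus_{n\ge 0}\mathfrak B^n(V)$ compatible with product, coproduct, counit and braiding, and with an identification of $(V,c)$ with $\mathfrak B^1(V)$ as braided vector spaces, such that $\mathfrak B^0(V)=\Bbbk 1$, the space of primitive elements $\{x : \Delta(x)=x\otimes 1+1\otimes x\}$ equals $\mathfrak B^1(V)$, and $\mathfrak B(V)$ is generated as an algebra by $\mathfrak B^1(V)$. **Theorem.** Every braided vector space $(V,c)$ has a Nichols algebra, and for every Nichols algebra $\mathfrak B(V)$ of $(V,c)$ there is a group isomorphism $$\mathfrak B: GL(V,c)\longrightarrow \mathrm{Aut}_{\mathrm{Hopf}}\,\mathfrak B(V)$$ such that $\mathfrak B(g)$ extends $g$, i.e. $\mathfrak B(g)(v)=g(v)$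 for all $g\in GL(V,c)$ and $v\in V=\mathfrak B^1(V)$. -/

import Mathlib

open scoped TensorProduct

universe u v w

/-- For an endomorphism `c` of `V ⊗ V`, the endomorphism `c ⊗ id` of `V ⊗ V ⊗ V`. -/
def braidLeft {k : Type u} {V : Type v} [Field k] [AddCommGroup V] [Module k V]
    (c : V ⊗[k] V →ₗ[k] V ⊗[k] V) : (V ⊗[k] V) ⊗[k] V →ₗ[k] (V ⊗[k] V) ⊗[k] V :=
  LinearMap.rTensor V c

/-- For an endomorphism `c` of `V ⊗ V`, the endomorphism `id ⊗ c` of `V ⊗ V ⊗ V`. -/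
def braidRight {k : Type u} {V : Type v} [Field k] [AddCommGroup V] [Module k V]
    (c : V ⊗[k] V →ₗ[k] V ⊗[k] V) : (V ⊗[k] V) ⊗[k] V →ₗ[k] (V ⊗[k] V) ⊗[k] V :=
  (TensorProduct.assoc k V V V).symm.toLinearMap ∘ₗ LinearMap.lTensor V c ∘ₗ
    (TensorProduct.assoc k V V V).toLinearMap

/-- For an endomorphism `c` of `V ⊗ V`, the endomorphism `id ⊗ c ⊗ id` of
`(V ⊗ V) ⊗ (V ⊗ V)`. -/
def braidMiddle {k : Type u} {V : Type v} [Field k] [AddCommGroup V] [Module k V]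
    (c : V ⊗[k] V →ₗ[k] V ⊗[k] V) :
    (V ⊗[k] V) ⊗[k] (V ⊗[k] V) →ₗ[k] (V ⊗[k] V) ⊗[k] (V ⊗[k] V) :=
  (TensorProduct.assoc k V V (V ⊗[k] V)).symm.toLinearMap ∘ₗ
    LinearMap.lTensor V ((TensorProduct.assoc k V V V).toLinearMap ∘ₗ
      LinearMap.rTensor V c ∘ₗ (TensorProduct.assoc k V V V).symm.toLinearMap) ∘ₗ
    (TensorProduct.assoc k V V (V ⊗[k] V)).toLinearMap

/-- A braiding on a vector space `V`: a linear automorphism `c` of `V ⊗ V` solving the braid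
equation `(c ⊗ id)(id ⊗ c)(c ⊗ id) = (id ⊗ c)(c ⊗ id)(id ⊗ c)`. A vector space together with a
braiding is a braided vector space. -/
structure Braiding (k : Type u) (V : Type v) [Field k] [AddCommGroup V] [Module k V] where
  /-- The underlying linear automorphism of `V ⊗ V`. -/
  c : V ⊗[k] V ≃ₗ[k] V ⊗[k] V
  braid_eq :
    braidLeft c.toLinearMap ∘ₗ braidRight c.toLinearMap ∘ₗ braidLeft c.toLinearMap =
      braidRight c.toLinearMap ∘ₗ braidLeft c.toLinearMap ∘ₗ braidRight c.toLinearMap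

/-- The group `GL(V, c)` of automorphisms of a braided vector space: all linear automorphisms `g`
of `V` such that `g ⊗ g` commutes with `c`. -/
def Braiding.GL {k : Type u} {V : Type v} [Field k] [AddCommGroup V] [Module k V]
    (B : Braiding k V) : Subgroup (V ≃ₗ[k] V) where
  carrier := {g | ∀ x : V ⊗[k] V,
    TensorProduct.map g.toLinearMap g.toLinearMap (B.c x) =
      B.c (TensorProduct.map g.toLinearMap g.toLinearMap x)}
  one_mem' := by
    intro x
    change TensorProduct.map LinearMap.id LinearMap.id _ =
      B.c (TensorProduct.map LinearMap.id LinearMap.id x)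
    simp
  mul_mem' := by
    intro g h hg hh x
    change TensorProduct.map (g.toLinearMap ∘ₗ h.toLinearMap) (g.toLinearMap ∘ₗ h.toLinearMap) _ =
      B.c (TensorProduct.map (g.toLinearMap ∘ₗ h.toLinearMap) (g.toLinearMap ∘ₗ h.toLinearMap) x)
    simp only [TensorProduct.map_comp, LinearMap.comp_apply]
    rw [hh x, hg]
  inv_mem' := by
    intro g hg x
    change (TensorProduct.congr g g).symm (B.c x) = B.c ((TensorProduct.congr g g).symm x)
    rw [LinearEquiv.symm_apply_eq]
    have h := hg ((TensorProduct.congr g g).symm x)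
    change TensorProduct.congr g g _ = B.c (TensorProduct.congr g g _) at h
    rw [h, LinearEquiv.apply_symm_apply]

/-- A braided Hopf algebra structure on an associative unital algebra `R` that is also a
coassociative counital coalgebra: a braiding `c` of `R` with which product, unit, coproduct and
counit commute, such that coproduct and counit are multiplicative and unital (for the product
of `R ⊗ R` twisted by `c`), and such that the identity is invertible for the convolution
product. -/
structure BraidedHopfAlgebra (k : Type u) (R : Type w) [Field k] [Ring R] [Algebra k R]
    [Coalgebra k R] extends Braiding k R where
  /-- `c (m ⊗ id) = (id ⊗ m)(c ⊗ id)(id ⊗ c)` -/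
  mul_left :
    c.toLinearMap ∘ₗ LinearMap.rTensor R (LinearMap.mul' k R) =
      LinearMap.lTensor R (LinearMap.mul' k R) ∘ₗ (TensorProduct.assoc k R R R).toLinearMap ∘ₗ
        braidLeft c.toLinearMap ∘ₗ braidRight c.toLinearMap
  /-- `c (id ⊗ m) = (m ⊗ id)(id ⊗ c)(c ⊗ id)` -/
  mul_right :
    c.toLinearMap ∘ₗ LinearMap.lTensor R (LinearMap.mul' k R) ∘ₗ
        (TensorProduct.assoc k R R R).toLinearMap =
      LinearMap.rTensor R (LinearMap.mul' k R) ∘ₗ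
        braidRight c.toLinearMap ∘ₗ braidLeft c.toLinearMap
  one_left : ∀ x : R, c (1 ⊗ₜ[k] x) = x ⊗ₜ[k] 1
  one_right : ∀ x : R, c (x ⊗ₜ[k] 1) = 1 ⊗ₜ[k] x
  /-- `(id ⊗ Δ) c = (c ⊗ id)(id ⊗ c)(Δ ⊗ id)` -/
  comul_left :
    (TensorProduct.assoc k R R R).symm.toLinearMap ∘ₗ
        LinearMap.lTensor R (Coalgebra.comul (R := k) (A := R)) ∘ₗ c.toLinearMap =
      braidLeft c.toLinearMap ∘ₗ braidRight c.toLinearMap ∘ₗ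
        LinearMap.rTensor R (Coalgebra.comul (R := k) (A := R))
  /-- `(Δ ⊗ id) c = (id ⊗ c)(c ⊗ id)(id ⊗ Δ)` -/
  comul_right :
    LinearMap.rTensor R (Coalgebra.comul (R := k) (A := R)) ∘ₗ c.toLinearMap =
      braidRight c.toLinearMap ∘ₗ braidLeft c.toLinearMap ∘ₗ
        (TensorProduct.assoc k R R R).symm.toLinearMap ∘ₗ
        LinearMap.lTensor R (Coalgebra.comul (R := k) (A := R))
  /-- `(id ⊗ ε) c = ε ⊗ id` -/
  counit_left :
    (TensorProduct.rid k R).toLinearMap ∘ₗ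
        LinearMap.lTensor R (Coalgebra.counit (R := k) (A := R)) ∘ₗ c.toLinearMap =
      (TensorProduct.lid k R).toLinearMap ∘ₗ
        LinearMap.rTensor R (Coalgebra.counit (R := k) (A := R))
  /-- `(ε ⊗ id) c = id ⊗ ε` -/
  counit_right :
    (TensorProduct.lid k R).toLinearMap ∘ₗ
        LinearMap.rTensor R (Coalgebra.counit (R := k) (A := R)) ∘ₗ c.toLinearMap =
      (TensorProduct.rid k R).toLinearMap ∘ₗ
        LinearMap.lTensor R (Coalgebra.counit (R := k) (A := R))
  /-- `Δ m = (m ⊗ m)(id ⊗ c ⊗ id)(Δ ⊗ Δ)` -/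
  comul_mul :
    Coalgebra.comul (R := k) (A := R) ∘ₗ LinearMap.mul' k R =
      TensorProduct.map (LinearMap.mul' k R) (LinearMap.mul' k R) ∘ₗ
        braidMiddle c.toLinearMap ∘ₗ
        TensorProduct.map (Coalgebra.comul (R := k) (A := R)) (Coalgebra.comul (R := k) (A := R))
  comul_one : Coalgebra.comul (R := k) (1 : R) = 1 ⊗ₜ[k] 1
  counit_mul : ∀ x y : R,
    Coalgebra.counit (R := k) (x * y) = Coalgebra.counit (R := k) x * Coalgebra.counit (R := k) y
  counit_one : Coalgebra.counit (R := k) (1 : R) = 1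
  /-- Existence of an antipode. -/
  exists_antipode : ∃ S : R →ₗ[k] R,
    LinearMap.mul' k R ∘ₗ LinearMap.rTensor R S ∘ₗ Coalgebra.comul =
        Algebra.linearMap k R ∘ₗ Coalgebra.counit ∧
      LinearMap.mul' k R ∘ₗ LinearMap.lTensor R S ∘ₗ Coalgebra.comul =
        Algebra.linearMap k R ∘ₗ Coalgebra.counit

/-- The group of braided Hopf algebra automorphisms of `R`: the linear automorphisms of `R` that
preserve the product, the coproduct and the braiding. -/
def BraidedHopfAlgebra.Aut {k : Type u} {R : Type w} [Field k] [Ring R] [Algebra k R]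
    [Coalgebra k R] (H : BraidedHopfAlgebra k R) : Subgroup (R ≃ₗ[k] R) where
  carrier := {f | (∀ x y : R, f (x * y) = f x * f y) ∧
    (∀ x : R, TensorProduct.map f.toLinearMap f.toLinearMap (Coalgebra.comul (R := k) x) =
      Coalgebra.comul (R := k) (f x)) ∧
    f ∈ H.toBraiding.GL}
  one_mem' := by
    refine ⟨fun _ _ => rfl, fun x => ?_, one_mem _⟩
    change TensorProduct.map LinearMap.id LinearMap.id _ = Coalgebra.comul (R := k) x
    simp
  mul_mem' := by
    rintro f g ⟨hf, hf', hf''⟩ ⟨hg, hg', hg''⟩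
    refine ⟨fun x y => ?_, fun x => ?_, mul_mem hf'' hg''⟩
    · change f (g (x * y)) = f (g x) * f (g y)
      rw [hg, hf]
    · change TensorProduct.map (f.toLinearMap ∘ₗ g.toLinearMap) (f.toLinearMap ∘ₗ g.toLinearMap) _ =
        Coalgebra.comul (R := k) (f (g x))
      rw [TensorProduct.map_comp, LinearMap.comp_apply, hg', hf']
  inv_mem' := by
    rintro f ⟨hf, hf', hf''⟩
    refine ⟨fun x y => ?_, fun x => ?_, inv_mem hf''⟩
    · change f.symm (x * y) = f.symm x * f.symm y
      rw [LinearEquiv.symm_apply_eq, hf, LinearEquiv.apply_symm_apply, LinearEquiv.apply_symm_apply]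
    · change (TensorProduct.congr f f).symm _ = Coalgebra.comul (R := k) (f.symm x)
      rw [LinearEquiv.symm_apply_eq]
      have h := hf' (f.symm x)
      rw [LinearEquiv.apply_symm_apply] at h
      exact h.symm

/-- For subspaces `P`, `Q` of `R`, the subspace `P ⊗ Q` of `R ⊗ R`. -/
def tensorSubmodule {k : Type u} {R : Type w} [Field k] [AddCommGroup R] [Module k R]
    (P Q : Submodule k R) : Submodule k (R ⊗[k] R) :=
  LinearMap.range (TensorProduct.map P.subtype Q.subtype)

/-- The braided Hopf algebra `R` with the `ℕ`-grading `𝒜` is a Nichols algebra of the braided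
vector space `(V, B)`, where `ι` is the identification of `V` with the degree one part of `R`. -/
structure IsNicholsAlgebra {k : Type u} {V : Type v} {R : Type w} [Field k] [AddCommGroup V]
    [Module k V] [Ring R] [Algebra k R] [Coalgebra k R] (B : Braiding k V)
    (H : BraidedHopfAlgebra k R) (𝒜 : ℕ → Submodule k R) (ι : V →ₗ[k] R) : Prop where
  /-- `R` is the direct sum of the `𝒜 n`. -/
  isInternal : DirectSum.IsInternal 𝒜
  mul_mem : ∀ (i j : ℕ) (x y : R), x ∈ 𝒜 i → y ∈ 𝒜 j → x * y ∈ 𝒜 (i + j)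
  comul_mem : ∀ (n : ℕ) (x : R), x ∈ 𝒜 n →
    Coalgebra.comul (R := k) x ∈
      ⨆ (i : ℕ) (j : ℕ) (_ : i + j = n), tensorSubmodule (𝒜 i) (𝒜 j)
  counit_eq_zero : ∀ (n : ℕ) (x : R), n ≠ 0 → x ∈ 𝒜 n → Coalgebra.counit (R := k) x = 0
  braiding_mem : ∀ (i j : ℕ) (t : R ⊗[k] R), t ∈ tensorSubmodule (𝒜 i) (𝒜 j) →
    H.c t ∈ tensorSubmodule (𝒜 j) (𝒜 i)
  /-- The degree zero part consists of the scalars. -/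
  degree_zero : 𝒜 0 = LinearMap.range (Algebra.linearMap k R)
  /-- `ι` is an isomorphism of braided vector spaces from `V` onto the degree one part. -/
  injective : Function.Injective ι
  range_eq : LinearMap.range ι = 𝒜 1
  braiding_eq : ∀ t : V ⊗[k] V,
    H.c (TensorProduct.map ι ι t) = TensorProduct.map ι ι (B.c t)
  /-- The degree one part is the space of primitive elements. -/
  primitive_iff : ∀ x : R,
    Coalgebra.comul (R := k) x = x ⊗ₜ[k] 1 + 1 ⊗ₜ[k] x ↔ x ∈ 𝒜 1
  /-- `R` is generated as an algebra by its degree one part. -/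
  adjoin_eq : Algebra.adjoin k (𝒜 1 : Set R) = ⊤

/-! Existence. The Nichols algebra is realised as the image of the quantum symmetrizer. On `T(V)`
take the deconcatenation coproduct, the braiding that moves one block of letters past another, and
the quantum shuffle product. This is a braided bialgebra whose primitive elements are exactly the
vectors (`deconcat_shuffleMul`, `mem_homog_one_of_primitive`). The symmetrizer `S` maps the
concatenation algebra to this shuffle algebra. Its image is a subalgebra because `S_{m+n} = Sh_{m,n}
(S_m ⊗ S_n)` (`symmetrizer_add'`), a subcoalgebra because `S_{a+b} = (S_a ⊗ S_b) f` for some `f`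
(`symmetrizer_add`), and stable under the braiding because swaps of blocks are natural. As a
quotient of `T(V)` the image is generated by `V`; as a subcoalgebra of the shuffle algebra it has no
primitives outside `V`. The antipode is a geometric series in the convolution algebra, locally
finite by connectedness.

All these identities are identities between sums of braids. They are proved once in an abstract ring
with a shift, and then carried to tensor products by a dictionary between operators on words and
maps of cut words.

Automorphisms. Let `R` be any Nichols algebra, a quotient of `T(V)`. The component `∂ : R → R ⊗ V`
of the coproduct obeys a braided Leibniz rule on products `v x` (`derivation_ι_mul`), which involves
only `c` and therefore lifts to `T(V)` independently of `R`. The kernel of `∂` is the scalars: after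
subtracting a constant, an element killed by `∂` is primitive, hence in `V`, where `∂` is injective.
So a subspace of the augmentation ideal stable under `∂` vanishes. Applied to the image in `R'` of
the kernel of `T(V) → R`, this shows that any two Nichols algebras have the same kernel in `T(V)`
(`ker_lift_le`).

Now let `g` be in `GL(V, c)`. Precomposing the identification of `V` with `g` gives a second Nichols
structure on the same `R`, and comparing the two extends `g` to an automorphism. Conversely an
automorphism preserves primitives, hence restricts to `V`; since `V` generates, it is determined by
the restriction. -/

/-- A ring `E` with a shift endomorphism `σ` and an element `s` satisfying the braid relation and
commuting with everything shifted twice: a home for the braid monoid on infinitely many strands,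
the crossing of strands `i` and `i + 1` being `σ ^ i s`. -/
structure BraidShift (E : Type*) [Ring E] where
  /-- the shift, which adds one strand on the left -/
  σ : E →+* E
  /-- the crossing of the first two strands -/
  s : E
  braid : s * σ s * s = σ s * s * σ s
  comm : ∀ f, s * σ (σ f) = σ (σ f) * s

/-! ### Block crossings, quantum shuffles and symmetrizers in an abstract braid ring -/

namespace BraidShift

variable {E : Type*} [Ring E] (A : BraidShift E)

/-- The first strand crosses the next `n` strands. -/
def cross : ℕ → E
  | 0 => 1
  | n + 1 => A.σ (cross n) * A.s

/-- The first `m` strands cross the next `n` strands. -/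
def swap : ℕ → ℕ → E
  | 0, _ => 1
  | m + 1, n => A.cross n * A.σ (swap m n)

/-- The sum of all braided shuffles of the first `m` with the next `n` strands. -/
def shuffle : ℕ → ℕ → E
  | 0, _ => 1
  | _ + 1, 0 => 1
  | m + 1, n + 1 => A.σ (shuffle m (n + 1)) + A.σ (shuffle (m + 1) n) * A.swap (m + 1) 1

/-- The quantum symmetrizer on the first `n` strands. -/
def symmetrizer : ℕ → E
  | 0 => 1
  | n + 1 => A.shuffle 1 n * A.σ (symmetrizer n)

/-- The operators that only involve the first `n` strands. -/
def strands (n : ℕ) : Subring E :=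
  Subring.closure {x | ∃ i, i + 2 ≤ n ∧ x = (A.σ ^ i) A.s}

lemma pow_succ_apply (i : ℕ) (f : E) : (A.σ ^ (i + 1)) f = A.σ ((A.σ ^ i) f) := by
  rw [pow_succ']; rfl

lemma pow_succ_apply' (i : ℕ) (f : E) : (A.σ ^ (i + 1)) f = (A.σ ^ i) (A.σ f) := by
  rw [pow_succ]; rfl

lemma pow_add_apply (i j : ℕ) (f : E) : (A.σ ^ (i + j)) f = (A.σ ^ i) ((A.σ ^ j) f) := by
  rw [pow_add]; rfl

lemma pow_zero_apply (f : E) : (A.σ ^ 0) f = f := by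
  rw [pow_zero]; rfl

lemma strands_mono {m n : ℕ} (h : m ≤ n) : A.strands m ≤ A.strands n :=
  Subring.closure_mono fun _ ⟨i, hi, hx⟩ => ⟨i, hi.trans h, hx⟩

lemma shift_mem_strands {n : ℕ} {f : E} (hf : f ∈ A.strands n) : A.σ f ∈ A.strands (n + 1) := by
  have : A.strands n ≤ (A.strands (n + 1)).comap A.σ := by
    refine Subring.closure_le.2 ?_
    rintro _ ⟨i, hi, rfl⟩
    exact Subring.subset_closure ⟨i + 1, by omega, by rw [pow_succ_apply]⟩
  exact this hf

lemma pow_mem_strands {n : ℕ} {f : E} (hf : f ∈ A.strands n) (i : ℕ) :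
    (A.σ ^ i) f ∈ A.strands (i + n) := by
  induction i with
  | zero => simpa [pow_zero_apply] using hf
  | succ i ih =>
    rw [pow_succ_apply, show i + 1 + n = i + n + 1 by omega]
    exact A.shift_mem_strands ih

lemma s_mem_strands : A.s ∈ A.strands 2 :=
  Subring.subset_closure ⟨0, le_rfl, (A.pow_zero_apply _).symm⟩

lemma cross_mem_strands (n : ℕ) : A.cross n ∈ A.strands (n + 1) := by
  induction n with
  | zero => exact one_mem _
  | succ n ih =>
    exact mul_mem (A.shift_mem_strands ih) (A.strands_mono (by omega) A.s_mem_strands)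

lemma swap_mem_strands (m n : ℕ) : A.swap m n ∈ A.strands (m + n) := by
  induction m with
  | zero => exact one_mem _
  | succ m ih =>
    refine mul_mem (A.strands_mono (by omega) (A.cross_mem_strands n)) ?_
    rw [show m + 1 + n = m + n + 1 by omega]
    exact A.shift_mem_strands ih

lemma shuffle_mem_strands (m n : ℕ) : A.shuffle m n ∈ A.strands (m + n) := by
  induction m, n using shuffle.induct with
  | case1 => rw [shuffle]; exact one_mem _
  | case2 => rw [shuffle]; exact one_mem _
  | case3 m n ih1 ih2 =>
    rw [shuffle]
    refine add_mem (A.strands_mono (by omega) (A.shift_mem_strands ih1)) (mul_mem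
      (A.strands_mono (by omega) (A.shift_mem_strands ih2))
      (A.strands_mono (by omega) (A.swap_mem_strands _ _)))

lemma symmetrizer_mem_strands (n : ℕ) : A.symmetrizer n ∈ A.strands n := by
  induction n with
  | zero => exact one_mem _
  | succ n ih =>
    refine mul_mem (A.strands_mono (by omega) (A.shuffle_mem_strands 1 n)) ?_
    exact A.shift_mem_strands ih

lemma s_comm_pow (i : ℕ) (f : E) : A.s * (A.σ ^ (i + 2)) f = (A.σ ^ (i + 2)) f * A.s := by
  rw [pow_succ_apply, pow_succ_apply, A.comm]

/-- Operators on the first `n` strands commute with operators that avoid them. -/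
lemma strands_comm {n : ℕ} {f : E} (hf : f ∈ A.strands n) (g : E) :
    f * (A.σ ^ n) g = (A.σ ^ n) g * f := by
  have : A.strands n ≤ Subring.centralizer {(A.σ ^ n) g} := by
    refine Subring.closure_le.2 ?_
    rintro _ ⟨i, hi, rfl⟩
    rw [SetLike.mem_coe, Subring.mem_centralizer_iff]
    rintro _ rfl
    -- With `n = i + 2 + j` both factors are `σ ^ i` of something; once `σ ^ i` is stripped, the
    -- second factor is still shifted at least twice and `comm` applies.
    obtain ⟨j, rfl⟩ := Nat.exists_eq_add_of_le hi
    rw [show i + 2 + j = i + (j + 2) by omega, pow_add_apply, ← map_mul, ← map_mul, s_comm_pow]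
  exact (Subring.mem_centralizer_iff.1 (this hf) _ rfl).symm

@[simp] lemma swap_zero_right (m : ℕ) : A.swap m 0 = 1 := by
  induction m with
  | zero => rfl
  | succ m ih => rw [swap, ih, map_one, cross, mul_one]

@[simp] lemma swap_zero_left (n : ℕ) : A.swap 0 n = 1 := by rw [swap]

@[simp] lemma shuffle_zero_right (m : ℕ) : A.shuffle m 0 = 1 := by cases m <;> rw [shuffle]

@[simp] lemma shuffle_zero_left (n : ℕ) : A.shuffle 0 n = 1 := by rw [shuffle]

lemma swap_add_left (m m' n : ℕ) :
    A.swap (m + m') n = A.swap m n * (A.σ ^ m) (A.swap m' n) := by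
  induction m with
  | zero => simp
  | succ m ih =>
    rw [show m + 1 + m' = m + m' + 1 by omega, swap, ih, map_mul, swap, pow_succ_apply, mul_assoc]

lemma cross_add (n n' : ℕ) : A.cross (n + n') = (A.σ ^ n) (A.cross n') * A.cross n := by
  induction n with
  | zero => simp [cross]
  | succ n ih =>
    rw [show n + 1 + n' = n + n' + 1 by omega, cross, ih, map_mul, cross, pow_succ_apply, mul_assoc]

/-- Peeling off the leading strand leaves its passage through the first `n` strands next to
crossings that avoid the first `n + 1` strands; far commutativity reorders them. -/
lemma swap_add_right (m n n' : ℕ) :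
    A.swap m (n + n') = (A.σ ^ n) (A.swap m n') * A.swap m n := by
  induction m with
  | zero => simp
  | succ m ih =>
    have h := A.strands_comm (A.cross_mem_strands n) (A.swap m n')
    rw [pow_succ_apply'] at h
    rw [swap, ih, cross_add, swap, swap, map_mul, map_mul, ← pow_succ_apply, pow_succ_apply',
      mul_assoc, ← mul_assoc (A.cross n), h]
    simp only [mul_assoc]

lemma swap_one_left (n : ℕ) : A.swap 1 n = A.cross n := by
  rw [swap, swap, map_one, mul_one]

lemma swap_one_one : A.swap 1 1 = A.s := by
  rw [swap_one_left, cross, cross, map_one, one_mul]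

/-- A crossing slides through a strand that passes over all its strands. It is enough to slide a
generator `σ ^ i s`: for `i = 0` this is the braid relation, and for larger `i` the generator
commutes with the outermost `s`, so one strand can be removed. -/
lemma cross_natural {n : ℕ} {f : E} (hf : f ∈ A.strands n) :
    A.cross n * A.σ f = f * A.cross n := by
  have key : ∀ (i r : ℕ),
      A.cross (i + 2 + r) * A.σ ((A.σ ^ i) A.s) = (A.σ ^ i) A.s * A.cross (i + 2 + r) := by
    intro i
    induction i with
    | zero =>
      intro r
      have h1 : A.cross (0 + 2 + r) = (A.σ ^ 2) (A.cross r) * (A.σ A.s * A.s) := by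
        rw [zero_add, cross_add]; simp [cross]
      have h2 := A.s_comm_pow 0 (A.cross r)
      rw [zero_add] at h2
      rw [h1, pow_zero_apply, mul_assoc, ← A.braid, ← mul_assoc A.s, h2]
      simp only [mul_assoc]
    | succ i ih =>
      intro r
      rw [show i + 1 + 2 + r = (i + 2 + r) + 1 by omega, cross, pow_succ_apply, mul_assoc,
        A.comm, ← mul_assoc, ← map_mul, ih, map_mul, mul_assoc]
  induction hf using Subring.closure_induction with
  | mem x hx =>
    obtain ⟨i, hi, rfl⟩ := hx
    obtain ⟨r, rfl⟩ := Nat.exists_eq_add_of_le hi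
    exact key i r
  | zero => simp
  | one => simp
  | add x y _ _ hx hy => rw [map_add, mul_add, add_mul, hx, hy]
  | neg x _ hx => rw [map_neg, mul_neg, neg_mul, hx]
  | mul x y _ _ hx hy => rw [map_mul, ← mul_assoc, hx, mul_assoc, hy, mul_assoc]

lemma swap_natural_right {n : ℕ} {f : E} (hf : f ∈ A.strands n) (p : ℕ) :
    A.swap p n * (A.σ ^ p) f = f * A.swap p n := by
  induction p with
  | zero => simp
  | succ p ih =>
    rw [swap, pow_succ_apply, mul_assoc, ← map_mul, ih, map_mul, ← mul_assoc, A.cross_natural hf,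
      mul_assoc]

/-- For `p = 1` a generator slides through the single crossing strand by the braid relation and far
commutativity; larger `p` is reached one strand at a time. -/
lemma swap_natural_left {n : ℕ} {f : E} (hf : f ∈ A.strands n) (p : ℕ) :
    A.swap n p * f = (A.σ ^ p) f * A.swap n p := by
  have key : ∀ i r : ℕ, A.swap (i + 2 + r) 1 * (A.σ ^ i) A.s =
      A.σ ((A.σ ^ i) A.s) * A.swap (i + 2 + r) 1 := by
    intro i r
    have h1 : A.swap (2 + r) 1 * A.s = A.σ A.s * A.swap (2 + r) 1 := by
      have h2 := A.s_comm_pow 0 (A.swap r 1)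
      have h3 : A.swap 2 1 = A.s * A.σ A.s := by
        rw [swap, swap_one_one]; simp [cross]
      rw [zero_add] at h2
      rw [swap_add_left, h3, mul_assoc, ← h2, ← mul_assoc, A.braid]
      simp only [mul_assoc]
    have h4 := A.strands_comm (A.swap_mem_strands i 1) A.s
    rw [add_assoc, swap_add_left A i, mul_assoc, ← map_mul, h1, map_mul, ← mul_assoc,
      ← pow_succ_apply', h4, pow_succ_apply, mul_assoc]
  have key1 : A.swap n 1 * f = A.σ f * A.swap n 1 := by
    induction hf using Subring.closure_induction with
    | mem x hx =>
      obtain ⟨i, hi, rfl⟩ := hx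
      obtain ⟨r, rfl⟩ := Nat.exists_eq_add_of_le hi
      exact key i r
    | zero => simp
    | one => simp
    | add x y _ _ hx hy => rw [map_add, mul_add, add_mul, hx, hy]
    | neg x _ hx => rw [map_neg, mul_neg, neg_mul, hx]
    | mul x y _ _ hx hy => rw [map_mul, ← mul_assoc, hx, mul_assoc, hy, mul_assoc]
  induction p with
  | zero => simp
  | succ p ih =>
    rw [swap_add_right, mul_assoc, ih, ← mul_assoc, ← map_mul, key1, map_mul, pow_succ_apply',
      mul_assoc]

/-- Both sides are the swap of `m + n` strands with `p`, composed with `swap m n` before or after.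
Naturality applied to `swap m n` itself identifies them. -/
lemma swap_braid (m n p : ℕ) :
    A.swap n p * ((A.σ ^ n) (A.swap m p) * A.swap m n) =
      (A.σ ^ p) (A.swap m n) * (A.swap m p * (A.σ ^ m) (A.swap n p)) := by
  rw [← mul_assoc, ← swap_add_left, ← swap_add_left, add_comm n m,
    A.swap_natural_left (A.swap_mem_strands m n)]

/-- Associativity of the quantum shuffle product. -/
lemma shuffle_assoc (m n p : ℕ) :
    A.shuffle (m + n) p * A.shuffle m n = A.shuffle m (n + p) * (A.σ ^ m) (A.shuffle n p) := by
  -- Both sides are expanded according to which of the three words supplies the first letter of the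
  -- output; the three terms then match by `h1`, `h2`, `h3`.
  induction h : m + n + p using Nat.strong_induction_on generalizing m n p with
  | _ N ih =>
    obtain _ | m := m
    · simp
    obtain _ | n := n
    · simp
    obtain _ | p := p
    · simp
    have h1 := ih _ (by omega) m (n + 1) (p + 1) rfl
    have h2 := ih _ (by omega) (m + 1) n (p + 1) rfl
    have h3 := ih _ (by omega) (m + 1) (n + 1) p rfl
    have e1 : A.shuffle (m + 1 + (n + 1)) (p + 1) = A.σ (A.shuffle (m + (n + 1)) (p + 1)) +
        A.σ (A.shuffle (m + 1 + (n + 1)) p) * A.swap (m + 1 + (n + 1)) 1 := by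
      rw [show m + 1 + (n + 1) = (m + n + 1) + 1 by omega, shuffle]; rfl
    have e2 : A.shuffle (m + 1) (n + 1 + (p + 1)) = A.σ (A.shuffle m (n + 1 + (p + 1))) +
        A.σ (A.shuffle (m + 1) (n + (p + 1))) * A.swap (m + 1) 1 := by
      rw [show n + 1 + (p + 1) = (n + (p + 1)) + 1 by omega, shuffle]
    have n1 := A.swap_natural_left (A.shuffle_mem_strands (m + 1) (n + 1)) 1
    rw [pow_one] at n1
    have c1 := A.strands_comm (A.swap_mem_strands (m + 1) 1) (A.shuffle n (p + 1))
    have c2 := A.strands_comm (A.swap_mem_strands (m + 1) 1) (A.shuffle (n + 1) p)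
    rw [pow_succ_apply'] at c1 c2
    have lhs : A.shuffle (m + 1 + (n + 1)) (p + 1) * A.shuffle (m + 1) (n + 1) =
        A.σ (A.shuffle (m + (n + 1)) (p + 1) * A.shuffle m (n + 1)) +
        A.σ (A.shuffle (m + 1 + n) (p + 1) * A.shuffle (m + 1) n) * A.swap (m + 1) 1 +
        A.σ (A.shuffle (m + 1 + (n + 1)) p * A.shuffle (m + 1) (n + 1)) *
          A.swap (m + 1 + (n + 1)) 1 := by
      rw [e1, add_mul, mul_assoc, n1]
      rw [show A.σ (A.shuffle (m + (n + 1)) (p + 1)) * A.shuffle (m + 1) (n + 1) =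
        A.σ (A.shuffle (m + (n + 1)) (p + 1)) * (A.σ (A.shuffle m (n + 1)) +
          A.σ (A.shuffle (m + 1) n) * A.swap (m + 1) 1) by rw [shuffle]]
      rw [show m + 1 + n = m + (n + 1) by omega]
      simp only [map_mul, mul_add, mul_assoc]
    have rhs : A.shuffle (m + 1) (n + 1 + (p + 1)) * (A.σ ^ (m + 1)) (A.shuffle (n + 1) (p + 1)) =
        A.σ (A.shuffle m (n + 1 + (p + 1)) * (A.σ ^ m) (A.shuffle (n + 1) (p + 1))) +
        A.σ (A.shuffle (m + 1) (n + (p + 1)) * (A.σ ^ (m + 1)) (A.shuffle n (p + 1))) *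
          A.swap (m + 1) 1 +
        A.σ (A.shuffle (m + 1) (n + 1 + p) * (A.σ ^ (m + 1)) (A.shuffle (n + 1) p)) *
          A.swap (m + 1 + (n + 1)) 1 := by
      have e3 : A.swap (m + 1) 1 * (A.σ ^ (m + 1)) (A.shuffle (n + 1) (p + 1)) =
          A.σ ((A.σ ^ (m + 1)) (A.shuffle n (p + 1))) * A.swap (m + 1) 1 +
          A.σ ((A.σ ^ (m + 1)) (A.shuffle (n + 1) p)) * A.swap (m + 1 + (n + 1)) 1 := by
        rw [shuffle, map_add, map_mul, mul_add, c1, ← mul_assoc, c2, mul_assoc, ← swap_add_left,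
          ← pow_succ_apply', ← pow_succ_apply', pow_succ_apply _ (m + 1), pow_succ_apply _ (m + 1)]
      rw [e2, add_mul, mul_assoc, e3, pow_succ_apply, map_mul, map_mul, map_mul, mul_add,
        show n + 1 + p = n + (p + 1) by omega, ← mul_assoc, ← mul_assoc]
      simp only [add_assoc]
    rw [lhs, rhs, h1, h2, h3]

open Finset in
/-- Compatibility of quantum shuffles with cutting the strands after the first `a`. -/
lemma shuffle_eq_sum (a m n : ℕ) (h : a ≤ m + n) :
    A.shuffle m n = ∑ p ∈ antidiagonal a, if p.1 ≤ m ∧ p.2 ≤ n then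
      A.shuffle p.1 p.2 * (A.σ ^ a) (A.shuffle (m - p.1) (n - p.2)) *
        (A.σ ^ p.1) (A.swap (m - p.1) p.2) else 0 := by
  -- The summand at `(i, k)` collects the shuffles whose first `a` output letters are `i` letters of
  -- the first word and `k` of the second; the swap brings these `k` letters past the remaining `m -
  -- i`. The induction peels off the first output letter.
  induction a generalizing m n with
  | zero => simp
  | succ a ih =>
    obtain _ | m := m
    · rw [sum_eq_single (0, a + 1)]
      · simp [show a + 1 ≤ n by omega]
      · rintro ⟨i, k⟩ hp hne
        rw [HasAntidiagonal.mem_antidiagonal] at hp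
        refine if_neg fun hi => hne ?_
        ext <;> simp only <;> simp only at hi hp <;> omega
      · simp
    obtain _ | n := n
    · rw [sum_eq_single (a + 1, 0)]
      · simp [show a ≤ m by omega]
      · rintro ⟨i, k⟩ hp hne
        rw [HasAntidiagonal.mem_antidiagonal] at hp
        refine if_neg fun hi => hne ?_
        ext <;> simp only <;> simp only at hi hp <;> omega
      · simp
    let rest (p : ℕ × ℕ) : E := (A.σ ^ (a + 1)) (A.shuffle (m + 1 - p.1) (n + 1 - p.2)) *
        (A.σ ^ p.1) (A.swap (m + 1 - p.1) p.2)
    -- `x` and `y` are the two halves of the recursion for `shuffle p.1 p.2`. That recursion needs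
    -- both arguments positive; when one is zero, the guard removes one half and the other alone
    -- equals `1`.
    let x (p : ℕ × ℕ) : E := if p.1 ≤ m + 1 ∧ p.2 ≤ n + 1 then
      (if p.1 = 0 then 0 else A.σ (A.shuffle (p.1 - 1) p.2)) * rest p else 0
    let y (p : ℕ × ℕ) : E := if p.1 ≤ m + 1 ∧ p.2 ≤ n + 1 then
      (if p.2 = 0 then 0 else A.σ (A.shuffle p.1 (p.2 - 1)) * A.swap p.1 1) * rest p else 0
    have hxy : ∀ p ∈ antidiagonal (a + 1), (if p.1 ≤ m + 1 ∧ p.2 ≤ n + 1 then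
        A.shuffle p.1 p.2 * (A.σ ^ (a + 1)) (A.shuffle (m + 1 - p.1) (n + 1 - p.2)) *
        (A.σ ^ p.1) (A.swap (m + 1 - p.1) p.2) else 0) = x p + y p := by
      rintro ⟨i, k⟩ hp
      rw [HasAntidiagonal.mem_antidiagonal] at hp
      simp only [x, y]
      split_ifs with h1 h2 h3 h3
      · simp only at hp h2 h3; omega
      · obtain ⟨k, rfl⟩ := Nat.exists_eq_succ_of_ne_zero h3
        obtain rfl : i = 0 := h2
        simp [rest]
      · obtain ⟨i, rfl⟩ := Nat.exists_eq_succ_of_ne_zero h2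
        obtain rfl : k = 0 := h3
        simp [rest]
      · obtain ⟨k, rfl⟩ := Nat.exists_eq_succ_of_ne_zero h3
        obtain ⟨i, rfl⟩ := Nat.exists_eq_succ_of_ne_zero h2
        simp only [rest, Nat.succ_eq_add_one, Nat.add_sub_cancel]
        rw [shuffle, ← add_mul, mul_assoc]
      · simp
    rw [sum_congr rfl hxy, sum_add_distrib, shuffle]
    congr 1
    · rw [Nat.sum_antidiagonal_succ, ih m (n + 1) (by omega), map_sum]
      have : x (0, a + 1) = 0 := by simp [x]
      rw [this, zero_add]
      refine sum_congr rfl fun p _ => ?_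
      simp only [x, rest, Nat.add_le_add_iff_right, Nat.add_sub_add_right]
      split_ifs with h1 h2
      · simp at h2
      · simp only [Nat.add_sub_cancel, map_mul, pow_succ_apply, mul_assoc]
      · simp
    · rw [Nat.sum_antidiagonal_succ', ih (m + 1) n (by omega), map_sum, sum_mul]
      have : y (a + 1, 0) = 0 := by simp [y]
      rw [this, zero_add]
      refine sum_congr rfl fun p hp => ?_
      obtain ⟨i, k⟩ := p
      rw [HasAntidiagonal.mem_antidiagonal] at hp
      simp only [y, rest, Nat.add_le_add_iff_right, Nat.add_sub_add_right]
      split_ifs with h1 h2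
      · simp at h2
      · simp only at h1 hp
        have c1 := A.strands_comm (A.strands_mono (show i + 1 ≤ a + 1 by omega)
          (A.swap_mem_strands i 1)) (A.shuffle (m + 1 - i) (n - k))
        have c2 := A.strands_comm (A.swap_mem_strands i 1) (A.swap (m + 1 - i) k)
        simp only [Nat.add_sub_cancel, map_mul]
        rw [← pow_succ_apply A a, ← pow_succ_apply A i, mul_assoc, mul_assoc (A.σ _),
          mul_assoc (A.σ _), ← mul_assoc (A.swap i 1), c1, mul_assoc, add_comm k 1,
          swap_add_right A _ 1 k, pow_one, map_mul, ← mul_assoc (A.swap i 1), ← pow_succ_apply', c2,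
          mul_assoc, ← swap_add_left, show i + (m + 1 - i) = m + 1 by omega]
      · simp

/-- A single letter inserted into a word either lands among the first `a + 1` positions, or it
crosses `a + 1` letters and is inserted into the remaining `b`. -/
lemma shuffle_one_add (a b : ℕ) : A.shuffle 1 (a + 1 + b) =
    A.shuffle 1 a + (A.σ ^ (a + 1)) (A.shuffle 1 b) * A.cross (a + 1) := by
  have h : ∀ n, A.shuffle 1 (n + 1) = 1 + A.σ (A.shuffle 1 n) * A.s := fun n => by
    rw [shuffle, shuffle, map_one, swap_one_one]
  induction a with
  | zero => rw [zero_add, add_comm, h, pow_one, cross, cross, map_one, one_mul, shuffle_zero_right]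
  | succ a ih =>
    rw [show a + 1 + 1 + b = a + 1 + b + 1 by omega, h, ih, h, map_add, map_mul, add_mul, mul_assoc,
      ← pow_succ_apply, cross.eq_2 A (a + 1)]
    simp only [add_assoc]

/-- This makes the image of the symmetrizer a subcoalgebra: a symmetrized word, cut after `a`
letters, is a sum of tensors of symmetrized words. Only the existence of the right cofactor and its
support on `a + b` strands matter. -/
lemma symmetrizer_add (a b : ℕ) : ∃ f ∈ A.strands (a + b),
    A.symmetrizer (a + b) = A.symmetrizer a * (A.σ ^ a) (A.symmetrizer b) * f := by
  induction h : a + b using Nat.strong_induction_on generalizing a b with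
  | _ N ih =>
    obtain _ | a := a
    · exact ⟨1, one_mem _, by obtain rfl : b = N := by omega
                              simp [symmetrizer]⟩
    obtain _ | b := b
    · exact ⟨1, one_mem _, by obtain rfl : a + 1 = N := by omega
                              simp [symmetrizer]⟩
    obtain ⟨f, hf, hf'⟩ := ih (a + b + 1) (by omega) a (b + 1) (by omega)
    obtain ⟨g, hg, hg'⟩ := ih (a + b + 1) (by omega) (a + 1) b (by omega)
    obtain rfl : N = a + b + 1 + 1 := by omega
    -- Either the first letter ends up in the left block, leaving sizes `(a, b + 1)` for the others,
    -- or it crosses the whole left block, leaving sizes `(a + 1, b)`.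
    refine ⟨A.σ f + A.cross (a + 1) * A.σ g, add_mem (A.shift_mem_strands hf)
      (mul_mem (A.strands_mono (by omega) (A.cross_mem_strands _)) (A.shift_mem_strands hg)), ?_⟩
    have c1 := A.strands_comm (A.symmetrizer_mem_strands (a + 1)) (A.shuffle 1 b)
    have c2 := A.strands_comm (A.cross_mem_strands (a + 1)) (A.symmetrizer b)
    have c3 := A.cross_natural (A.symmetrizer_mem_strands (a + 1))
    calc A.symmetrizer (a + b + 1 + 1)
        = A.shuffle 1 a * A.σ (A.symmetrizer (a + b + 1)) +
          (A.σ ^ (a + 1)) (A.shuffle 1 b) * (A.cross (a + 1) *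
            A.σ (A.symmetrizer (a + b + 1))) := by
          rw [symmetrizer, show a + b + 1 = a + 1 + b by omega, shuffle_one_add, add_mul, mul_assoc]
      _ = A.symmetrizer (a + 1) * (A.σ ^ (a + 1)) (A.symmetrizer (b + 1)) * A.σ f +
          A.symmetrizer (a + 1) * (A.σ ^ (a + 1)) (A.symmetrizer (b + 1)) *
            (A.cross (a + 1) * A.σ g) := by
          congr 1
          · rw [hf', map_mul, map_mul, ← mul_assoc, ← mul_assoc, ← pow_succ_apply,
              symmetrizer.eq_2 A a]
          · rw [hg', map_mul, map_mul, ← pow_succ_apply, ← mul_assoc (A.cross _),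
              ← mul_assoc (A.cross _), c3, mul_assoc (A.symmetrizer _), c2, ← mul_assoc,
              ← mul_assoc, ← c1, symmetrizer.eq_2 A b, map_mul, ← pow_succ_apply']
            simp only [mul_assoc]
      _ = _ := by rw [mul_add]

/-- The symmetrizer turns concatenation into the shuffle product. The recursion adds one letter by
`shuffle 1 _`, and associativity of shuffles moves this letter into the first block. -/
lemma symmetrizer_add' (m n : ℕ) : A.symmetrizer (m + n) =
    A.shuffle m n * (A.symmetrizer m * (A.σ ^ m) (A.symmetrizer n)) := by
  induction m with
  | zero => simp [symmetrizer]
  | succ m ih =>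
    have h := A.shuffle_assoc 1 m n
    rw [pow_one] at h
    rw [show m + 1 + n = m + n + 1 by omega, symmetrizer, ih, map_mul, ← mul_assoc, ← h, map_mul,
      ← pow_succ_apply, symmetrizer, add_comm 1 m]
    simp only [mul_assoc]

lemma swap_symmetrizer (m n : ℕ) :
    A.swap m n * (A.symmetrizer m * (A.σ ^ m) (A.symmetrizer n)) =
      A.symmetrizer n * (A.σ ^ n) (A.symmetrizer m) * A.swap m n := by
  rw [← mul_assoc, A.swap_natural_left (A.symmetrizer_mem_strands m), mul_assoc,
    A.swap_natural_right (A.symmetrizer_mem_strands n), ← mul_assoc,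
    A.strands_comm (A.symmetrizer_mem_strands n)]

end BraidShift

/-! ### The shift and the crossing as operators on the tensor algebra -/

namespace TensorAlgebra

section Cons

variable {k : Type u} {V : Type v} [Field k] [AddCommGroup V] [Module k V]

theorem induction_cons {C : TensorAlgebra k V → Prop} (one : C 1)
    (smul : ∀ (a : k) x, C x → C (a • x)) (add : ∀ x y, C x → C y → C (x + y))
    (cons : ∀ v x, C x → C (ι k v * x)) (x : TensorAlgebra k V) : C x := by
  have : ∀ y, C y → C (x * y) := by
    induction x using TensorAlgebra.induction with
    | algebraMap r => intro y hy; rw [← Algebra.smul_def]; exact smul r y hy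
    | ι v => exact cons v
    | mul a b ha hb => intro y hy; rw [mul_assoc]; exact ha _ (hb _ hy)
    | add a b ha hb => intro y hy; rw [add_mul]; exact add _ _ (ha _ hy) (hb _ hy)
  simpa using this 1 one

theorem linearMap_ext_cons {M : Type*} [AddCommGroup M] [Module k M]
    {f g : TensorAlgebra k V →ₗ[k] M} (one : f 1 = g 1)
    (cons : ∀ v x, f (ι k v * x) = g (ι k v * x)) : f = g := by
  ext x
  induction x using induction_cons with
  | one => exact one
  | smul a x hx => simp [hx]
  | add x y hx hy => simp [hx, hy]
  | cons v x _ => exact cons v x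

variable (k V) in
/-- Multiplication by a vector from the left. -/
def cons : V ⊗[k] TensorAlgebra k V →ₗ[k] TensorAlgebra k V :=
  TensorProduct.lift (LinearMap.mul k (TensorAlgebra k V) ∘ₗ ι k)

@[simp] lemma cons_tmul (v : V) (x : TensorAlgebra k V) : cons k V (v ⊗ₜ x) = ι k v * x := rfl

variable (k V) in
/-- The linear isomorphism from the tensor algebra onto scalars plus `V ⊗ T(V)`. -/
def uncons : TensorAlgebra k V →ₗ[k] k × (V ⊗[k] TensorAlgebra k V) :=
  LinearMap.applyₗ (R := k) ((1, 0) : k × (V ⊗[k] TensorAlgebra k V)) ∘ₗ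
    (lift k ((LinearMap.llcomp k _ _ _ (LinearMap.inr k k (V ⊗[k] TensorAlgebra k V))) ∘ₗ
      (LinearMap.lcomp k (V ⊗[k] TensorAlgebra k V)
        ((Algebra.linearMap k (TensorAlgebra k V)).coprod (cons k V))) ∘ₗ
      TensorProduct.mk k V (TensorAlgebra k V) :
        V →ₗ[k] Module.End k (k × (V ⊗[k] TensorAlgebra k V)))).toLinearMap

lemma uncons_one : uncons k V 1 = (1, 0) := by simp [uncons]

/-- In `uncons` a vector acts on `k × (V ⊗ T(V))` by reassembling a word and prefixing the vector,
and `x` is applied to `(1, 0)`. So `uncons (v x)` is a priori `v ⊗` the reassembly of `uncons x`,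
and this half of the inverse has to precede `uncons_cons`. -/
lemma coprod_uncons (x : TensorAlgebra k V) :
    (Algebra.linearMap k (TensorAlgebra k V)).coprod (cons k V) (uncons k V x) = x := by
  induction x using induction_cons with
  | one => simp [uncons_one]
  | smul a x hx => rw [map_smul, map_smul, hx]
  | add x y hx hy => rw [map_add, map_add, hx, hy]
  | cons v x hx =>
    have : uncons k V (ι k v * x) = (0, v ⊗ₜ (Algebra.linearMap k (TensorAlgebra k V)).coprod
        (cons k V) (uncons k V x)) := by
      simp [uncons]
    rw [this, hx]
    simp

lemma uncons_cons (v : V) (x : TensorAlgebra k V) : uncons k V (ι k v * x) = (0, v ⊗ₜ x) := by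
  conv_rhs => rw [← coprod_uncons x]
  simp [uncons]

variable (k V) in
/-- Splits off the first vector. -/
def tail : TensorAlgebra k V →ₗ[k] V ⊗[k] TensorAlgebra k V :=
  LinearMap.snd k _ _ ∘ₗ uncons k V

@[simp] lemma tail_one : tail k V 1 = 0 := by simp [tail, uncons_one]

@[simp] lemma tail_cons (v : V) (x : TensorAlgebra k V) : tail k V (ι k v * x) = v ⊗ₜ x := by
  simp [tail, uncons_cons]

@[simp] lemma tail_ι (v : V) : tail k V (ι k v) = v ⊗ₜ 1 := by
  rw [← mul_one (ι k v), tail_cons]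

variable (k V) in
/-- The degree zero component. -/
def augmentation : TensorAlgebra k V →ₗ[k] k := LinearMap.fst k _ _ ∘ₗ uncons k V

@[simp] lemma augmentation_one : augmentation k V 1 = 1 := by simp [augmentation, uncons_one]

@[simp] lemma augmentation_cons (v : V) (x : TensorAlgebra k V) :
    augmentation k V (ι k v * x) = 0 := by
  simp [augmentation, uncons_cons]

variable (k V) in
/-- The linear endomorphisms of the tensor algebra that preserve the scalars. -/
def scalarEnd : Subalgebra k (Module.End k (TensorAlgebra k V)) where
  carrier := {f | ∃ a : k, f 1 = a • 1}
  mul_mem' := by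
    rintro f g ⟨a, ha⟩ ⟨b, hb⟩
    exact ⟨b * a, by rw [Module.End.mul_apply, hb, map_smul, ha, smul_smul]⟩
  add_mem' := by
    rintro f g ⟨a, ha⟩ ⟨b, hb⟩
    exact ⟨a + b, by rw [LinearMap.add_apply, ha, hb, add_smul]⟩
  algebraMap_mem' r := ⟨r, rfl⟩

/-- The operator `1 ↦ f 1`, `v x ↦ v f(x)`. -/
def shiftFun (f : Module.End k (TensorAlgebra k V)) : Module.End k (TensorAlgebra k V) :=
  LinearMap.toSpanSingleton k _ (f 1) ∘ₗ augmentation k V +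
    cons k V ∘ₗ LinearMap.lTensor V f ∘ₗ tail k V

@[simp] lemma shiftFun_one (f : Module.End k (TensorAlgebra k V)) : shiftFun f 1 = f 1 := by
  simp [shiftFun]

@[simp] lemma shiftFun_cons (f : Module.End k (TensorAlgebra k V)) (v : V)
    (x : TensorAlgebra k V) : shiftFun f (ι k v * x) = ι k v * f x := by
  simp [shiftFun]

variable (k V) in
/-- The shift of operators on the tensor algebra by one tensor factor. -/
def shift : scalarEnd k V →+* scalarEnd k V where
  toFun f := ⟨shiftFun f.1, f.2.imp fun a ha => by rw [shiftFun_one, ha]⟩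
  map_one' := Subtype.ext <| linearMap_ext_cons (by simp) (by simp)
  map_zero' := Subtype.ext <| linearMap_ext_cons (by simp) (by simp)
  map_add' f g := Subtype.ext <| linearMap_ext_cons (by simp) (by simp [mul_add])
  map_mul' f g := by
    -- The shift of `f` sends `1` to `f 1`, so multiplicativity at `1` requires `g 1` to be a
    -- scalar. This is why operators are restricted to `scalarEnd`.
    obtain ⟨a, ha⟩ := g.2
    exact Subtype.ext <| linearMap_ext_cons (by simp [ha]) (by simp)

@[simp] lemma shift_one (f : scalarEnd k V) : (shift k V f).1 1 = f.1 1 := shiftFun_one _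

@[simp] lemma shift_ι (f : scalarEnd k V) (v : V) : (shift k V f).1 (ι k v) = ι k v * f.1 1 := by
  rw [← mul_one (ι k v)]
  exact (shiftFun_cons _ _ _).trans (by rw [mul_one])

@[simp] lemma shift_cons (f : scalarEnd k V) (v : V) (x : TensorAlgebra k V) :
    (shift k V f).1 (ι k v * x) = ι k v * f.1 x := shiftFun_cons _ _ _

/-- A linear endomorphism of `V ⊗ V` acting on the first two tensor factors. -/
def crossingFun (c : V ⊗[k] V →ₗ[k] V ⊗[k] V) : Module.End k (TensorAlgebra k V) :=
  cons k V ∘ₗ LinearMap.lTensor V (cons k V) ∘ₗ (TensorProduct.assoc k V V _).toLinearMap ∘ₗ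
    LinearMap.rTensor _ c ∘ₗ (TensorProduct.assoc k V V _).symm.toLinearMap ∘ₗ
    LinearMap.lTensor V (tail k V) ∘ₗ tail k V

variable (k V) in
/-- The product of two vectors. -/
def pair : V ⊗[k] V →ₗ[k] TensorAlgebra k V :=
  LinearMap.mul' k _ ∘ₗ TensorProduct.map (ι k) (ι k)

@[simp] lemma pair_tmul (v w : V) : pair k V (v ⊗ₜ w) = ι k v * ι k w := rfl

lemma crossingFun_cons_cons (c : V ⊗[k] V →ₗ[k] V ⊗[k] V) (v w : V) (x : TensorAlgebra k V) :
    crossingFun c (ι k v * (ι k w * x)) = pair k V (c (v ⊗ₜ w)) * x := by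
  have : ∀ t : V ⊗[k] V, cons k V (LinearMap.lTensor V (cons k V)
      (TensorProduct.assoc k V V _ (t ⊗ₜ[k] x))) = pair k V t * x := by
    intro t
    induction t using TensorProduct.induction_on with
    | zero => simp
    | tmul a b => simp [mul_assoc]
    | add a b ha hb => simp only [TensorProduct.add_tmul, map_add, ha, hb, add_mul]
  simp [crossingFun, this]

lemma crossingFun_pair (c : V ⊗[k] V →ₗ[k] V ⊗[k] V) (t : V ⊗[k] V) (x : TensorAlgebra k V) :
    crossingFun c (pair k V t * x) = pair k V (c t) * x := by
  induction t using TensorProduct.induction_on with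
  | zero => simp
  | tmul a b => rw [pair_tmul, mul_assoc, crossingFun_cons_cons]
  | add a b ha hb => simp only [map_add, add_mul, ha, hb]

/-- A linear endomorphism of `V ⊗ V` acting on the first two tensor factors. -/
def crossing (c : V ⊗[k] V →ₗ[k] V ⊗[k] V) : scalarEnd k V :=
  ⟨crossingFun c, 0, by simp [crossingFun]⟩

@[simp] lemma crossing_one (c : V ⊗[k] V →ₗ[k] V ⊗[k] V) : (crossing c).1 1 = 0 := by
  simp [crossing, crossingFun]

@[simp] lemma crossing_ι (c : V ⊗[k] V →ₗ[k] V ⊗[k] V) (v : V) :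
    (crossing c).1 (ι k v) = 0 := by
  simp [crossing, crossingFun]

lemma crossing_pair (c : V ⊗[k] V →ₗ[k] V ⊗[k] V) (t : V ⊗[k] V) (x : TensorAlgebra k V) :
    (crossing c).1 (pair k V t * x) = pair k V (c t) * x := crossingFun_pair c t x

lemma crossing_cons_cons (c : V ⊗[k] V →ₗ[k] V ⊗[k] V) (v w : V) (x : TensorAlgebra k V) :
    (crossing c).1 (ι k v * (ι k w * x)) = pair k V (c (v ⊗ₜ w)) * x :=
  crossingFun_cons_cons c v w x

variable (k V) in
/-- The product of three vectors. -/
def triple : (V ⊗[k] V) ⊗[k] V →ₗ[k] TensorAlgebra k V :=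
  LinearMap.mul' k _ ∘ₗ TensorProduct.map (pair k V) (ι k)

@[simp] lemma triple_tmul (t : V ⊗[k] V) (v : V) :
    triple k V (t ⊗ₜ v) = pair k V t * ι k v := rfl

lemma crossing_triple (c : V ⊗[k] V →ₗ[k] V ⊗[k] V) (t : (V ⊗[k] V) ⊗[k] V)
    (x : TensorAlgebra k V) :
    (crossing c).1 (triple k V t * x) = triple k V (braidLeft c t) * x := by
  induction t using TensorProduct.induction_on with
  | zero => simp
  | tmul a b => rw [triple_tmul, mul_assoc, crossing_pair]; simp [braidLeft, mul_assoc]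
  | add a b ha hb => simp only [map_add, add_mul, ha, hb]

lemma shift_crossing_triple (c : V ⊗[k] V →ₗ[k] V ⊗[k] V) (t : (V ⊗[k] V) ⊗[k] V)
    (x : TensorAlgebra k V) :
    (shift k V (crossing c)).1 (triple k V t * x) = triple k V (braidRight c t) * x := by
  have : ∀ (a : V) (t : V ⊗[k] V), triple k V ((TensorProduct.assoc k V V V).symm (a ⊗ₜ t)) =
      ι k a * pair k V t := by
    intro a t
    induction t using TensorProduct.induction_on with
    | zero => simp
    | tmul a b => simp [mul_assoc]
    | add a b ha hb => simp only [TensorProduct.tmul_add, map_add, ha, hb, mul_add]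
  have : ∀ t : V ⊗[k] (V ⊗[k] V),
      (shift k V (crossing c)).1 (triple k V ((TensorProduct.assoc k V V V).symm t) * x) =
        triple k V ((TensorProduct.assoc k V V V).symm (LinearMap.lTensor V c t)) * x := by
    intro t
    induction t using TensorProduct.induction_on with
    | zero => simp
    | tmul a b => rw [this, LinearMap.lTensor_tmul, this, mul_assoc, shift_cons, crossing_pair,
        mul_assoc]
    | add a b ha hb => simp only [map_add, add_mul, ha, hb]
  simpa [braidRight] using this (TensorProduct.assoc k V V V t)

/-- The operators on the tensor algebra of a braided vector space. -/
def _root_.Braiding.braidShift (B : Braiding k V) : BraidShift (scalarEnd k V) where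
  σ := shift k V
  s := crossing B.c.toLinearMap
  braid := by
    set c := B.c.toLinearMap with hc
    -- Three letters are peeled off. On words with fewer than three letters both sides vanish,
    -- because a crossing kills words shorter than two; on longer words the claim is the braid
    -- equation for `c`.
    refine Subtype.ext <| linearMap_ext_cons (by simp) fun v x => ?_
    refine LinearMap.congr_fun (f := ((crossing c * shift k V (crossing c) *
      crossing c).1 ∘ₗ LinearMap.mulLeft k (ι k v))) (g := ((shift k V (crossing c) * crossing c *
      shift k V (crossing c)).1 ∘ₗ LinearMap.mulLeft k (ι k v))) ?_ x
    refine linearMap_ext_cons (by simp) fun w x => ?_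
    refine LinearMap.congr_fun (f := ((crossing c * shift k V (crossing c) *
      crossing c).1 ∘ₗ LinearMap.mulLeft k (ι k v) ∘ₗ LinearMap.mulLeft k (ι k w)))
      (g := ((shift k V (crossing c) * crossing c *
      shift k V (crossing c)).1 ∘ₗ LinearMap.mulLeft k (ι k v) ∘ₗ LinearMap.mulLeft k (ι k w))) ?_ x
    have h0 : ∀ t : V ⊗[k] V, (shift k V (crossing c)).1 (pair k V t) = 0 := by
      intro t
      induction t using TensorProduct.induction_on with
      | zero => simp
      | tmul a b => simp
      | add a b ha hb => simp [ha, hb]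
    refine linearMap_ext_cons ?_ fun y x => ?_
    · have h1 := crossing_pair c (v ⊗ₜ w) 1
      simp only [pair_tmul, mul_one] at h1
      simp [h1, h0]
    · have h1 : ι k v * (ι k w * (ι k y * x)) = triple k V ((v ⊗ₜ w) ⊗ₜ y) * x := by
        simp [mul_assoc]
      have h2 := LinearMap.congr_fun B.braid_eq ((v ⊗ₜ w) ⊗ₜ y)
      simp only [← hc, LinearMap.comp_apply] at h2
      simp only [LinearMap.comp_apply, LinearMap.mulLeft_apply, h1, MulMemClass.coe_mul,
        Module.End.mul_apply, crossing_triple, shift_crossing_triple, h2]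
  comm f := by
    set c := B.c.toLinearMap with hc
    obtain ⟨a, ha⟩ := f.2
    refine Subtype.ext <| linearMap_ext_cons (by simp [ha]) fun v x => ?_
    refine LinearMap.congr_fun (f := (crossing c * shift k V (shift k V f)).1 ∘ₗ
      LinearMap.mulLeft k (ι k v)) (g := (shift k V (shift k V f) * crossing c).1 ∘ₗ
      LinearMap.mulLeft k (ι k v)) ?_ x
    refine linearMap_ext_cons (by simp [ha]) fun w x => ?_
    have h : ∀ t : V ⊗[k] V, (shift k V (shift k V f)).1 (pair k V t * x) =
        pair k V t * f.1 x := by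
      intro t
      induction t using TensorProduct.induction_on with
      | zero => simp
      | tmul a b => simp [mul_assoc]
      | add a b ha hb => simp [ha, hb, add_mul]
    simp [crossing_cons_cons, h]

end Cons

end TensorAlgebra

/-! ### Homogeneous components and cutting of words -/

namespace TensorAlgebra

section Homogeneous

variable {k : Type u} {V : Type v} [Field k] [AddCommGroup V] [Module k V]

variable (k V) in
/-- The homogeneous elements of degree `n` of the tensor algebra. -/
abbrev homog (n : ℕ) : Submodule k (TensorAlgebra k V) :=
  LinearMap.range (ι k : V →ₗ[k] TensorAlgebra k V) ^ n

lemma one_mem_homog : (1 : TensorAlgebra k V) ∈ homog k V 0 := by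
  rw [homog, pow_zero]
  exact Submodule.one_le.1 le_rfl

lemma ι_mem_homog (v : V) : ι k v ∈ homog k V 1 := by
  rw [homog, pow_one]
  exact ⟨v, rfl⟩

lemma mul_mem_homog {a b : ℕ} {x y : TensorAlgebra k V} (hx : x ∈ homog k V a)
    (hy : y ∈ homog k V b) : x * y ∈ homog k V (a + b) := by
  rw [homog, pow_add]
  exact Submodule.mul_mem_mul hx hy

lemma cons_mem_homog {n : ℕ} {x : TensorAlgebra k V} (v : V) (hx : x ∈ homog k V n) :
    ι k v * x ∈ homog k V (n + 1) := by
  rw [add_comm]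
  exact mul_mem_homog (ι_mem_homog v) hx

lemma homog_zero_eq {x : TensorAlgebra k V} (hx : x ∈ homog k V 0) : ∃ a : k, x = a • 1 := by
  rw [homog, pow_zero, Submodule.mem_one] at hx
  exact hx.imp fun a ha => by rw [← ha, Algebra.algebraMap_eq_smul_one]

lemma homog_add_induction {a b : ℕ} {C : ∀ w : TensorAlgebra k V, w ∈ homog k V (a + b) → Prop}
    (mul : ∀ x (hx : x ∈ homog k V a) y (hy : y ∈ homog k V b), C (x * y) (mul_mem_homog hx hy))
    (add : ∀ x y hx hy, C x hx → C y hy → C (x + y) (add_mem hx hy)) {w : TensorAlgebra k V}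
    (hw : w ∈ homog k V (a + b)) : C w hw := by
  have hw' := hw
  rw [homog, pow_add] at hw'
  obtain ⟨_, h⟩ : ∃ hw, C w hw := Submodule.mul_induction_on hw' (fun x hx y hy => ⟨_, mul x hx y hy⟩)
    fun x y ⟨_, hx⟩ ⟨_, hy⟩ => ⟨_, add x y _ _ hx hy⟩
  exact h

lemma homog_succ_induction {n : ℕ} {C : ∀ w : TensorAlgebra k V, w ∈ homog k V (n + 1) → Prop}
    (cons : ∀ v x (hx : x ∈ homog k V n), C (ι k v * x) (cons_mem_homog v hx))
    (add : ∀ x y hx hy, C x hx → C y hy → C (x + y) (add_mem hx hy)) {w : TensorAlgebra k V}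
    (hw : w ∈ homog k V (n + 1)) : C w hw := by
  have hw' := hw
  rw [homog, pow_succ'] at hw'
  obtain ⟨_, h⟩ : ∃ hw, C w hw := Submodule.mul_induction_on hw' (fun _ ⟨v, hv⟩ x hx =>
    ⟨hv ▸ cons_mem_homog v hx, by subst hv; exact cons v x hx⟩)
    fun x y ⟨_, hx⟩ ⟨_, hy⟩ => ⟨_, add x y _ _ hx hy⟩
  exact h

/-- Combines the linear maps `f n` on the homogeneous components into one linear map. -/
def glue {M : Type*} [AddCommGroup M] [Module k M] (f : ℕ → TensorAlgebra k V →ₗ[k] M) :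
    TensorAlgebra k V →ₗ[k] M :=
  DirectSum.toModule k ℕ M (fun n => f n ∘ₗ (homog k V n).subtype) ∘ₗ
    (DirectSum.decomposeLinearEquiv (homog k V)).toLinearMap

lemma glue_apply {M : Type*} [AddCommGroup M] [Module k M] (f : ℕ → TensorAlgebra k V →ₗ[k] M)
    {n : ℕ} {x : TensorAlgebra k V} (hx : x ∈ homog k V n) : glue f x = f n x := by
  rw [glue, LinearMap.comp_apply, LinearEquiv.coe_coe, DirectSum.decomposeLinearEquiv_apply,
    DirectSum.decompose_of_mem _ hx, ← DirectSum.lof_eq_of k, DirectSum.toModule_lof]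
  rfl

lemma linearMap_ext_homog {M : Type*} [AddCommGroup M] [Module k M]
    {f g : TensorAlgebra k V →ₗ[k] M} (h : ∀ n, ∀ x ∈ homog k V n, f x = g x) : f = g := by
  ext x
  induction x using DirectSum.Decomposition.inductionOn (homog k V) with
  | zero => simp
  | homogeneous x => exact h _ _ x.2
  | add x y hx hy => rw [map_add, map_add, hx, hy]

lemma linearMap_ext_homog₂ {M : Type*} [AddCommGroup M] [Module k M]
    {f g : TensorAlgebra k V ⊗[k] TensorAlgebra k V →ₗ[k] M}
    (h : ∀ m, ∀ x ∈ homog k V m, ∀ n, ∀ y ∈ homog k V n, f (x ⊗ₜ y) = g (x ⊗ₜ y)) : f = g :=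
  TensorProduct.ext <| linearMap_ext_homog fun m x hx =>
    linearMap_ext_homog fun n y hy => h m x hx n y hy

lemma linearMap_ext_homog₃ {M : Type*} [AddCommGroup M] [Module k M]
    {f g : (TensorAlgebra k V ⊗[k] TensorAlgebra k V) ⊗[k] TensorAlgebra k V →ₗ[k] M}
    (h : ∀ m, ∀ x ∈ homog k V m, ∀ n, ∀ y ∈ homog k V n, ∀ p, ∀ z ∈ homog k V p,
      f ((x ⊗ₜ y) ⊗ₜ z) = g ((x ⊗ₜ y) ⊗ₜ z)) : f = g :=
  TensorProduct.ext <| linearMap_ext_homog₂ fun m x hx n y hy =>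
    linearMap_ext_homog fun p z hz => h m x hx n y hy p z hz

/-- Combines the linear maps `f m n` on the bihomogeneous components into one linear map. -/
def glue₂ {M : Type*} [AddCommGroup M] [Module k M]
    (f : ℕ → ℕ → TensorAlgebra k V ⊗[k] TensorAlgebra k V →ₗ[k] M) :
    TensorAlgebra k V ⊗[k] TensorAlgebra k V →ₗ[k] M :=
  TensorProduct.lift <| glue fun m => LinearMap.flip <| glue fun n =>
    LinearMap.flip <| TensorProduct.curry (f m n)

lemma glue₂_tmul {M : Type*} [AddCommGroup M] [Module k M]
    (f : ℕ → ℕ → TensorAlgebra k V ⊗[k] TensorAlgebra k V →ₗ[k] M) {m n : ℕ}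
    {x y : TensorAlgebra k V} (hx : x ∈ homog k V m) (hy : y ∈ homog k V n) :
    glue₂ f (x ⊗ₜ y) = f m n (x ⊗ₜ y) := by
  simp [glue₂, glue_apply _ hx, glue_apply _ hy]

variable (k V) in
/-- Cuts a word after the first `a` letters. -/
def splitAt : ℕ → (TensorAlgebra k V →ₗ[k] TensorAlgebra k V ⊗[k] TensorAlgebra k V)
  | 0 => TensorProduct.mk k _ _ 1
  | a + 1 => LinearMap.rTensor _ (cons k V) ∘ₗ (TensorProduct.assoc k V _ _).symm.toLinearMap ∘ₗ
      LinearMap.lTensor V (splitAt a) ∘ₗ tail k V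

/-- Cutting undoes concatenation. Since words of degree at least `a` are spanned by such products,
this together with `homog_add_induction` determines `splitAt` wherever it is used. -/
lemma splitAt_mul {a : ℕ} {x : TensorAlgebra k V} (hx : x ∈ homog k V a)
    (y : TensorAlgebra k V) : splitAt k V a (x * y) = x ⊗ₜ y := by
  induction a generalizing x with
  | zero =>
    obtain ⟨r, rfl⟩ := homog_zero_eq hx
    simp [splitAt, TensorProduct.smul_tmul]
  | succ a ih =>
    induction hx using homog_succ_induction with
    | cons v x hx => simp [splitAt, mul_assoc, ih hx]
    | add x y _ _ hx hy => rw [add_mul, map_add, hx, hy, TensorProduct.add_tmul]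

lemma splitAt_zero (x : TensorAlgebra k V) : splitAt k V 0 x = 1 ⊗ₜ x := rfl

lemma splitAt_self {a : ℕ} {x : TensorAlgebra k V} (hx : x ∈ homog k V a) :
    splitAt k V a x = x ⊗ₜ 1 := by
  rw [← mul_one x, splitAt_mul hx, mul_one]

lemma mul'_splitAt {a b : ℕ} {w : TensorAlgebra k V} (hw : w ∈ homog k V (a + b)) :
    LinearMap.mul' k _ (splitAt k V a w) = w := by
  induction hw using homog_add_induction with
  | mul x hx y hy => rw [splitAt_mul hx, LinearMap.mul'_apply]
  | add x y _ _ hx hy => rw [map_add, map_add, hx, hy]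

lemma glue₂_splitAt {M : Type*} [AddCommGroup M] [Module k M]
    (f : ℕ → ℕ → TensorAlgebra k V ⊗[k] TensorAlgebra k V →ₗ[k] M) {a b : ℕ}
    {w : TensorAlgebra k V} (hw : w ∈ homog k V (a + b)) :
    glue₂ f (splitAt k V a w) = f a b (splitAt k V a w) := by
  induction hw using homog_add_induction with
  | mul x hx y hy => rw [splitAt_mul hx, glue₂_tmul f hx hy]
  | add x y _ _ hx hy => simp only [map_add, hx, hy]

variable (k V) in
/-- Cuts a word after the first `a` and after the next `b` letters. -/
def splitAt₃ (a b : ℕ) : TensorAlgebra k V →ₗ[k]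
    (TensorAlgebra k V ⊗[k] TensorAlgebra k V) ⊗[k] TensorAlgebra k V :=
  LinearMap.rTensor _ (splitAt k V a) ∘ₗ splitAt k V (a + b)

lemma splitAt₃_mul_right {a b : ℕ} {w : TensorAlgebra k V} (hw : w ∈ homog k V (a + b))
    (z : TensorAlgebra k V) : splitAt₃ k V a b (w * z) = splitAt k V a w ⊗ₜ z := by
  rw [splitAt₃, LinearMap.comp_apply, splitAt_mul hw, LinearMap.rTensor_tmul]

lemma splitAt₃_mul {a b : ℕ} {x y : TensorAlgebra k V} (hx : x ∈ homog k V a)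
    (hy : y ∈ homog k V b) (z : TensorAlgebra k V) :
    splitAt₃ k V a b (x * y * z) = (x ⊗ₜ y) ⊗ₜ z := by
  rw [splitAt₃_mul_right (mul_mem_homog hx hy), splitAt_mul hx]

lemma splitAt₃_mul_left {a b d : ℕ} {x w : TensorAlgebra k V} (hx : x ∈ homog k V a)
    (hw : w ∈ homog k V (b + d)) :
    splitAt₃ k V a b (x * w) = (TensorProduct.assoc k _ _ _).symm (x ⊗ₜ splitAt k V b w) := by
  induction hw using homog_add_induction with
  | mul y hy z hz => rw [← mul_assoc, splitAt₃_mul hx hy, splitAt_mul hy]; rfl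
  | add y z _ _ hy hz => simp only [mul_add, map_add, TensorProduct.tmul_add, hy, hz]

end Homogeneous

end TensorAlgebra

section

open TensorAlgebra

/-! ### Braid operators as maps of words -/

namespace Braiding

variable {k : Type u} {V : Type v} [Field k] [AddCommGroup V] [Module k V] (B : Braiding k V)

lemma shift_apply_cons (f : scalarEnd k V) (v : V) (x : TensorAlgebra k V) :
    (B.braidShift.σ f).1 (ι k v * x) = ι k v * f.1 x := shift_cons f v x

/-- One half of the dictionary: `σ ^ a f` acts as `id ⊗ f` on a word with its first `a` letters
split off. The other half is `strands_apply`, where an operator on the first `n` strands acts as `f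
⊗ id`. -/
lemma shift_pow_apply {a : ℕ} {x : TensorAlgebra k V} (hx : x ∈ homog k V a) (f : scalarEnd k V)
    (y : TensorAlgebra k V) : ((B.braidShift.σ ^ a) f).1 (x * y) = x * f.1 y := by
  induction a generalizing x with
  | zero =>
    obtain ⟨r, rfl⟩ := homog_zero_eq hx
    rw [BraidShift.pow_zero_apply]
    simp
  | succ a ih =>
    rw [BraidShift.pow_succ_apply]
    induction hx using homog_succ_induction with
    | cons v x hx => rw [mul_assoc, shift_apply_cons, ih hx, mul_assoc]
    | add x y _ _ hx hy => simp only [add_mul, map_add, hx, hy]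

/-- For a generator `σ ^ i s` the first `i` letters are untouched, and `s` involves only the next
two. The degree of `x` must be `n`, since crossings vanish on words that are too short. -/
lemma strands_apply {n : ℕ} {f : scalarEnd k V} (hf : f ∈ B.braidShift.strands n) :
    ∀ x ∈ homog k V n, f.1 x ∈ homog k V n ∧ ∀ y, f.1 (x * y) = f.1 x * y := by
  have key : ∀ i r : ℕ, ∀ x ∈ homog k V (i + 2 + r),
      ((B.braidShift.σ ^ i) B.braidShift.s).1 x ∈ homog k V (i + 2 + r) ∧
      ∀ y, ((B.braidShift.σ ^ i) B.braidShift.s).1 (x * y) =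
        ((B.braidShift.σ ^ i) B.braidShift.s).1 x * y := by
    intro i r x hx
    rw [add_assoc] at hx ⊢
    induction hx using homog_add_induction with
    | add x y _ _ hx hy =>
      refine ⟨by rw [map_add]; exact add_mem hx.1 hy.1, fun z => ?_⟩
      simp only [add_mul, map_add, hx.2, hy.2]
    | mul z hz x hx =>
      suffices h : B.braidShift.s.1 x ∈ homog k V (2 + r) ∧
          ∀ y, B.braidShift.s.1 (x * y) = B.braidShift.s.1 x * y by
        rw [B.shift_pow_apply hz]
        refine ⟨mul_mem_homog hz h.1, fun y => ?_⟩
        rw [mul_assoc, B.shift_pow_apply hz, h.2, mul_assoc]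
      change (crossing B.c.toLinearMap).1 x ∈ homog k V (2 + r) ∧
          ∀ y, (crossing B.c.toLinearMap).1 (x * y) = (crossing B.c.toLinearMap).1 x * y
      clear hz z
      rw [show 2 + r = r + 1 + 1 by omega] at hx ⊢
      induction hx using homog_succ_induction with
      | add x y _ _ hx hy =>
        refine ⟨by rw [map_add]; exact add_mem hx.1 hy.1, fun z => ?_⟩
        simp only [add_mul, map_add, hx.2, hy.2]
      | cons v x hx =>
        induction hx using homog_succ_induction with
        | add x y _ _ hx hy =>
          refine ⟨by rw [mul_add, map_add]; exact add_mem hx.1 hy.1, fun z => ?_⟩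
          simp only [add_mul, mul_add, map_add, hx.2, hy.2]
        | cons w x hx =>
          refine ⟨?_, fun y => ?_⟩
          · rw [crossing_cons_cons]
            generalize B.c.toLinearMap (v ⊗ₜ w) = t
            induction t using TensorProduct.induction_on with
            | zero => simp
            | tmul v w =>
              rw [pair_tmul, mul_assoc]
              exact cons_mem_homog _ (cons_mem_homog _ hx)
            | add a b ha hb => rw [map_add, add_mul]; exact add_mem ha hb
          · rw [mul_assoc, mul_assoc, crossing_cons_cons, crossing_cons_cons, mul_assoc]
  induction hf using Subring.closure_induction with
  | mem x hx =>
    obtain ⟨i, hi, rfl⟩ := hx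
    obtain ⟨r, rfl⟩ := Nat.exists_eq_add_of_le hi
    exact key i r
  | zero => simp
  | one => exact fun x hx => ⟨hx, fun y => rfl⟩
  | add f g _ _ hf hg =>
    exact fun x hx => ⟨add_mem (hf x hx).1 (hg x hx).1, fun y => by
      change f.1 _ + g.1 _ = (f.1 _ + g.1 _) * y
      rw [(hf x hx).2, (hg x hx).2, add_mul]⟩
  | neg f _ hf =>
    exact fun x hx => ⟨neg_mem (hf x hx).1, fun y => by
      change - f.1 _ = (- f.1 _) * y
      rw [(hf x hx).2, neg_mul]⟩
  | mul f g _ _ hf hg =>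
    exact fun x hx => ⟨(hf _ (hg x hx).1).1, fun y => by
      change f.1 (g.1 _) = (f.1 (g.1 _)) * y
      rw [(hg x hx).2, (hf _ (hg x hx).1).2]⟩

lemma strands_apply_mul {n : ℕ} {f : scalarEnd k V} (hf : f ∈ B.braidShift.strands n)
    {x : TensorAlgebra k V} (hx : x ∈ homog k V n) (y : TensorAlgebra k V) :
    f.1 (x * y) = f.1 x * y := (B.strands_apply hf x hx).2 y

lemma strands_apply_mem {n N : ℕ} {f : scalarEnd k V} (hf : f ∈ B.braidShift.strands n)
    (h : n ≤ N) {x : TensorAlgebra k V} (hx : x ∈ homog k V N) : f.1 x ∈ homog k V N :=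
  (B.strands_apply (B.braidShift.strands_mono h hf) x hx).1

/-- The braiding of the tensor algebra as a linear map. -/
def tensorSwap : TensorAlgebra k V ⊗[k] TensorAlgebra k V →ₗ[k]
    TensorAlgebra k V ⊗[k] TensorAlgebra k V :=
  glue₂ fun m n => splitAt k V n ∘ₗ (B.braidShift.swap m n).1 ∘ₗ LinearMap.mul' k _

/-- The quantum shuffle product. -/
def shuffleMul : TensorAlgebra k V ⊗[k] TensorAlgebra k V →ₗ[k] TensorAlgebra k V :=
  glue₂ fun m n => (B.braidShift.shuffle m n).1 ∘ₗ LinearMap.mul' k _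

end Braiding

/-! ### Deconcatenation -/

namespace TensorAlgebra

variable {k : Type u} {V : Type v} [Field k] [AddCommGroup V] [Module k V]

variable (k V) in
/-- The deconcatenation coproduct. -/
def deconcat : TensorAlgebra k V →ₗ[k] TensorAlgebra k V ⊗[k] TensorAlgebra k V :=
  glue fun n => ∑ p ∈ Finset.HasAntidiagonal.antidiagonal n, splitAt k V p.1

lemma deconcat_apply {n : ℕ} {x : TensorAlgebra k V} (hx : x ∈ homog k V n) :
    deconcat k V x = ∑ p ∈ Finset.HasAntidiagonal.antidiagonal n, splitAt k V p.1 x := by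
  rw [deconcat, glue_apply _ hx, LinearMap.sum_apply]

end TensorAlgebra

/-! ### The structure maps evaluated on cut words -/

namespace Braiding

variable {k : Type u} {V : Type v} [Field k] [AddCommGroup V] [Module k V] (B : Braiding k V)

/-- Braiding and product both have the form "concatenate, apply a braid operator", with a new cut in
the case of the braiding. Evaluated on a cut word instead of a pure tensor, composites collapse to a
single operator on the word, so tensor identities reduce to identities in `BraidShift`. -/
lemma tensorSwap_splitAt {a b : ℕ} {w : TensorAlgebra k V} (hw : w ∈ homog k V (a + b)) :
    B.tensorSwap (splitAt k V a w) = splitAt k V b ((B.braidShift.swap a b).1 w) := by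
  rw [tensorSwap, glue₂_splitAt _ hw, LinearMap.comp_apply, LinearMap.comp_apply,
    mul'_splitAt hw]

lemma shuffleMul_splitAt {a b : ℕ} {w : TensorAlgebra k V} (hw : w ∈ homog k V (a + b)) :
    B.shuffleMul (splitAt k V a w) = (B.braidShift.shuffle a b).1 w := by
  rw [shuffleMul, glue₂_splitAt _ hw, LinearMap.comp_apply, mul'_splitAt hw]

lemma braidLeft_splitAt₃ {a b d : ℕ} {w : TensorAlgebra k V} (hw : w ∈ homog k V (a + b + d)) :
    braidLeft B.tensorSwap (splitAt₃ k V a b w) =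
      splitAt₃ k V b a ((B.braidShift.swap a b).1 w) := by
  have hs := B.braidShift.swap_mem_strands a b
  induction hw using homog_add_induction with
  | mul x hx y hy =>
    have h := B.strands_apply_mem hs le_rfl hx
    rw [splitAt₃_mul_right hx, B.strands_apply_mul hs hx,
      splitAt₃_mul_right (by rwa [add_comm b a]), braidLeft, LinearMap.rTensor_tmul,
      B.tensorSwap_splitAt hx]
  | add x y _ _ hx hy => simp only [map_add, hx, hy]

lemma braidRight_splitAt₃ {a b d : ℕ} {w : TensorAlgebra k V}
    (hw : w ∈ homog k V (a + (b + d))) :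
    braidRight B.tensorSwap (splitAt₃ k V a b w) =
      splitAt₃ k V a d (((B.braidShift.σ ^ a) (B.braidShift.swap b d)).1 w) := by
  have hs := B.braidShift.swap_mem_strands b d
  induction hw using homog_add_induction with
  | mul x hx y hy =>
    have h := B.strands_apply_mem hs le_rfl hy
    rw [splitAt₃_mul_left hx hy, B.shift_pow_apply hx,
      splitAt₃_mul_left hx (d := b) (by rwa [add_comm d b])]
    simp [braidRight, B.tensorSwap_splitAt hy]
  | add x y _ _ hx hy => simp only [map_add, hx, hy]

lemma rTensor_shuffleMul_splitAt₃ {a b d : ℕ} {w : TensorAlgebra k V}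
    (hw : w ∈ homog k V (a + b + d)) :
    LinearMap.rTensor _ B.shuffleMul (splitAt₃ k V a b w) =
      splitAt k V (a + b) ((B.braidShift.shuffle a b).1 w) := by
  have hs := B.braidShift.shuffle_mem_strands a b
  induction hw using homog_add_induction with
  | mul x hx y hy =>
    rw [splitAt₃_mul_right hx, B.strands_apply_mul hs hx,
      splitAt_mul (B.strands_apply_mem hs le_rfl hx), LinearMap.rTensor_tmul,
      B.shuffleMul_splitAt hx]
  | add x y _ _ hx hy => simp only [map_add, hx, hy]

lemma lTensor_shuffleMul_splitAt₃ {a b d : ℕ} {w : TensorAlgebra k V}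
    (hw : w ∈ homog k V (a + (b + d))) :
    LinearMap.lTensor _ B.shuffleMul (TensorProduct.assoc k _ _ _ (splitAt₃ k V a b w)) =
      splitAt k V a (((B.braidShift.σ ^ a) (B.braidShift.shuffle b d)).1 w) := by
  induction hw using homog_add_induction with
  | mul x hx y hy =>
    rw [splitAt₃_mul_left hx hy, B.shift_pow_apply hx, splitAt_mul hx, LinearEquiv.apply_symm_apply,
      LinearMap.lTensor_tmul, B.shuffleMul_splitAt hy]
  | add x y _ _ hx hy => simp only [map_add, hx, hy]

end Braiding

/-! ### Deconcatenation is coassociative and counital -/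

section Counit

variable {k : Type u} {V : Type v} [Field k] [AddCommGroup V] [Module k V]

namespace TensorAlgebra

lemma augmentation_of_pos {n : ℕ} (hn : n ≠ 0) {x : TensorAlgebra k V} (hx : x ∈ homog k V n) :
    augmentation k V x = 0 := by
  obtain ⟨n, rfl⟩ := Nat.exists_eq_succ_of_ne_zero hn
  induction hx using homog_succ_induction with
  | cons v x hx => exact augmentation_cons v x
  | add x y _ _ hx hy => rw [map_add, hx, hy, add_zero]

lemma rTensor_augmentation_splitAt {a b : ℕ} (ha : a ≠ 0) {w : TensorAlgebra k V}
    (hw : w ∈ homog k V (a + b)) :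
    LinearMap.rTensor _ (augmentation k V) (splitAt k V a w) = 0 := by
  induction hw using homog_add_induction with
  | mul x hx y hy =>
    rw [splitAt_mul hx, LinearMap.rTensor_tmul, augmentation_of_pos ha hx, TensorProduct.zero_tmul]
  | add x y _ _ hx hy => simp only [map_add, hx, hy, add_zero]

lemma lTensor_augmentation_splitAt {a b : ℕ} (hb : b ≠ 0) {w : TensorAlgebra k V}
    (hw : w ∈ homog k V (a + b)) :
    LinearMap.lTensor _ (augmentation k V) (splitAt k V a w) = 0 := by
  induction hw using homog_add_induction with
  | mul x hx y hy =>
    rw [splitAt_mul hx, LinearMap.lTensor_tmul, augmentation_of_pos hb hy, TensorProduct.tmul_zero]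
  | add x y _ _ hx hy => simp only [map_add, hx, hy, add_zero]

lemma rTensor_deconcat_splitAt {a b : ℕ} {w : TensorAlgebra k V} (hw : w ∈ homog k V (a + b)) :
    LinearMap.rTensor _ (deconcat k V) (splitAt k V a w) =
      ∑ p ∈ Finset.HasAntidiagonal.antidiagonal a, splitAt₃ k V p.1 p.2 w := by
  induction hw using homog_add_induction with
  | mul x hx y hy =>
    rw [splitAt_mul hx, LinearMap.rTensor_tmul, deconcat_apply hx, TensorProduct.sum_tmul]
    refine Finset.sum_congr rfl fun p hp => ?_
    rw [Finset.HasAntidiagonal.mem_antidiagonal] at hp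
    rw [splitAt₃_mul_right (by rwa [hp])]
  | add x y _ _ hx hy => simp only [map_add, hx, hy, Finset.sum_add_distrib]

lemma lTensor_deconcat_splitAt {a b : ℕ} {w : TensorAlgebra k V} (hw : w ∈ homog k V (a + b)) :
    LinearMap.lTensor _ (deconcat k V) (splitAt k V a w) =
      ∑ p ∈ Finset.HasAntidiagonal.antidiagonal b,
        TensorProduct.assoc k _ _ _ (splitAt₃ k V a p.1 w) := by
  induction hw using homog_add_induction with
  | mul x hx y hy =>
    rw [splitAt_mul hx, LinearMap.lTensor_tmul, deconcat_apply hy, TensorProduct.tmul_sum]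
    refine Finset.sum_congr rfl fun p hp => ?_
    rw [Finset.HasAntidiagonal.mem_antidiagonal] at hp
    rw [splitAt₃_mul_left hx (d := p.2) (by rwa [hp]), LinearEquiv.apply_symm_apply]
  | add x y _ _ hx hy => simp only [map_add, hx, hy, Finset.sum_add_distrib]

/-- Both sides sum over all ways of cutting a word twice; only the indexing by nested antidiagonals
differs. -/
lemma deconcat_coassoc :
    (TensorProduct.assoc k _ _ _).toLinearMap ∘ₗ LinearMap.rTensor _ (deconcat k V) ∘ₗ
      deconcat k V = LinearMap.lTensor _ (deconcat k V) ∘ₗ deconcat k V := by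
  refine linearMap_ext_homog fun n w hw => ?_
  simp only [LinearMap.comp_apply, LinearEquiv.coe_coe, deconcat_apply hw, map_sum]
  have h1 : ∀ p ∈ Finset.HasAntidiagonal.antidiagonal n, w ∈ homog k V (p.1 + p.2) := fun p hp => by
    rw [Finset.HasAntidiagonal.mem_antidiagonal] at hp
    rwa [hp]
  rw [Finset.sum_congr rfl fun p hp => by rw [rTensor_deconcat_splitAt (h1 p hp), map_sum],
    Finset.sum_congr rfl fun p hp => lTensor_deconcat_splitAt (h1 p hp),
    Finset.sum_sigma', Finset.sum_sigma']
  refine Finset.sum_bij' (fun x _ => ⟨(x.2.1, x.2.2 + x.1.2), (x.2.2, x.1.2)⟩)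
    (fun x _ => ⟨(x.1.1 + x.2.1, x.2.2), (x.1.1, x.2.1)⟩) ?_ ?_ ?_ ?_ ?_
  · rintro ⟨⟨a, b⟩, ⟨c, d⟩⟩ h
    simp only [Finset.mem_sigma, Finset.HasAntidiagonal.mem_antidiagonal] at h ⊢
    exact ⟨by omega, trivial⟩
  · rintro ⟨⟨a, b⟩, ⟨c, d⟩⟩ h
    simp only [Finset.mem_sigma, Finset.HasAntidiagonal.mem_antidiagonal] at h ⊢
    exact ⟨by omega, trivial⟩
  · rintro ⟨⟨a, b⟩, ⟨c, d⟩⟩ h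
    simp only [Finset.mem_sigma, Finset.HasAntidiagonal.mem_antidiagonal] at h
    obtain ⟨h, rfl⟩ := h
    rfl
  · rintro ⟨⟨a, b⟩, ⟨c, d⟩⟩ h
    simp only [Finset.mem_sigma, Finset.HasAntidiagonal.mem_antidiagonal] at h
    obtain ⟨h, rfl⟩ := h
    rfl
  · rintro ⟨⟨a, b⟩, ⟨c, d⟩⟩ h
    rfl

lemma rTensor_augmentation_comp_deconcat :
    LinearMap.rTensor _ (augmentation k V) ∘ₗ deconcat k V = TensorProduct.mk k _ _ 1 := by
  refine linearMap_ext_homog fun n w hw => ?_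
  rw [LinearMap.comp_apply, deconcat_apply hw, map_sum, Finset.sum_eq_single (0, n)]
  · simp [splitAt_zero]
  · rintro ⟨a, b⟩ hp hne
    rw [Finset.HasAntidiagonal.mem_antidiagonal] at hp
    simp only at hp
    refine rTensor_augmentation_splitAt (b := b) ?_ (by rwa [hp])
    rintro rfl
    exact hne (by rw [← hp, zero_add])
  · simp

lemma lTensor_augmentation_comp_deconcat :
    LinearMap.lTensor _ (augmentation k V) ∘ₗ deconcat k V =
      (TensorProduct.mk k _ _).flip 1 := by
  refine linearMap_ext_homog fun n w hw => ?_
  rw [LinearMap.comp_apply, deconcat_apply hw, map_sum, Finset.sum_eq_single (n, 0)]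
  · simp [splitAt_self hw]
  · rintro ⟨a, b⟩ hp hne
    rw [Finset.HasAntidiagonal.mem_antidiagonal] at hp
    simp only at hp
    refine lTensor_augmentation_splitAt (b := b) ?_ (by rwa [hp])
    rintro rfl
    exact hne (by rw [← hp, add_zero])
  · simp

lemma deconcat_one : deconcat k V 1 = 1 ⊗ₜ 1 := by
  rw [deconcat_apply one_mem_homog]
  simp [splitAt_zero]

end TensorAlgebra

end Counit

/-! ### The quantum shuffle algebra is a braided bialgebra -/

namespace Braiding

variable {k : Type u} {V : Type v} [Field k] [AddCommGroup V] [Module k V] (B : Braiding k V)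

/-- `f` restricts to an automorphism of the homogeneous component of degree `n`. -/
def BijectiveOn (n : ℕ) (f : scalarEnd k V) : Prop :=
  (∀ x ∈ homog k V n, f.1 x ∈ homog k V n) ∧ ∃ g : scalarEnd k V,
    ∀ x ∈ homog k V n, g.1 x ∈ homog k V n ∧ g.1 (f.1 x) = x ∧ f.1 (g.1 x) = x

lemma BijectiveOn.mul {n : ℕ} {f g : scalarEnd k V} (hf : BijectiveOn n f) (hg : BijectiveOn n g) :
    BijectiveOn n (f * g) := by
  obtain ⟨hf, f', hf'⟩ := hf
  obtain ⟨hg, g', hg'⟩ := hg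
  refine ⟨fun x hx => hf _ (hg _ hx), g' * f', fun x hx => ⟨(hg' _ (hf' x hx).1).1, ?_, ?_⟩⟩
  · change g'.1 (f'.1 (f.1 (g.1 x))) = x
    rw [(hf' _ (hg x hx)).2.1, (hg' x hx).2.1]
  · change f.1 (g.1 (g'.1 (f'.1 x))) = x
    rw [(hg' _ (hf' x hx).1).2.2, (hf' x hx).2.2]

lemma bijectiveOn_shift {n : ℕ} {f : scalarEnd k V} (hf : BijectiveOn n f) :
    BijectiveOn (n + 1) (B.braidShift.σ f) := by
  obtain ⟨hf, f', hf'⟩ := hf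
  refine ⟨fun x hx => ?_, B.braidShift.σ f', fun x hx => ?_⟩
  · induction hx using homog_succ_induction with
    | cons v x hx => rw [shift_apply_cons]; exact cons_mem_homog _ (hf _ hx)
    | add x y _ _ hx hy => rw [map_add]; exact add_mem hx hy
  · induction hx using homog_succ_induction with
    | cons v x hx =>
      simp only [shift_apply_cons]
      exact ⟨cons_mem_homog _ (hf' x hx).1, by rw [(hf' x hx).2.1], by rw [(hf' x hx).2.2]⟩
    | add x y _ _ hx hy =>
      simp only [map_add, hx.2, hy.2, and_true]
      exact add_mem hx.1 hy.1

lemma bijectiveOn_one (n : ℕ) : BijectiveOn n (1 : scalarEnd k V) :=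
  ⟨fun _ hx => hx, 1, fun _ hx => ⟨hx, rfl, rfl⟩⟩

/-- The inverse is the crossing of `c⁻¹`. Both crossings vanish on words with fewer than two
letters, so invertibility is available only degree by degree. -/
lemma bijectiveOn_s (n : ℕ) : BijectiveOn (n + 2) B.braidShift.s := by
  have h : ∀ c : V ⊗[k] V →ₗ[k] V ⊗[k] V, ∀ x ∈ homog k V (n + 1 + 1),
      (crossing c).1 x ∈ homog k V (n + 1 + 1) := by
    intro c x hx
    induction hx using homog_succ_induction with
    | add x y _ _ hx hy => rw [map_add]; exact add_mem hx hy
    | cons v x hx =>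
      induction hx using homog_succ_induction with
      | add x y _ _ hx hy => rw [mul_add, map_add]; exact add_mem hx hy
      | cons w x hx =>
        rw [crossing_cons_cons]
        generalize c (v ⊗ₜ w) = t
        induction t using TensorProduct.induction_on with
        | zero => simp
        | tmul v w =>
          rw [pair_tmul, mul_assoc]
          exact cons_mem_homog _ (cons_mem_homog _ hx)
        | add a b ha hb => rw [map_add, add_mul]; exact add_mem ha hb
  have h' : ∀ c d : V ⊗[k] V →ₗ[k] V ⊗[k] V, (∀ t, c (d t) = t) → ∀ x ∈ homog k V (n + 1 + 1),
      (crossing c).1 ((crossing d).1 x) = x := by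
    intro c d hcd x hx
    induction hx using homog_succ_induction with
    | add x y _ _ hx hy => simp only [map_add, hx, hy]
    | cons v x hx =>
      induction hx using homog_succ_induction with
      | add x y _ _ hx hy => simp only [mul_add, map_add, hx, hy]
      | cons w x hx =>
        rw [crossing_cons_cons, crossing_pair, hcd, pair_tmul, mul_assoc]
  exact ⟨h _, crossing B.c.symm.toLinearMap, fun x hx => ⟨h _ x hx, h' _ _ (by simp) x hx,
    h' _ _ (by simp) x hx⟩⟩

lemma bijectiveOn_cross (n N : ℕ) : BijectiveOn (n + 1 + N) (B.braidShift.cross n) := by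
  induction n generalizing N with
  | zero => exact bijectiveOn_one _
  | succ n ih =>
    refine BijectiveOn.mul ?_ ?_
    · rw [show n + 1 + 1 + N = n + 1 + N + 1 by omega]
      exact B.bijectiveOn_shift (ih N)
    · rw [show n + 1 + 1 + N = n + N + 2 by omega]
      exact B.bijectiveOn_s _

lemma bijectiveOn_swap (m n : ℕ) : BijectiveOn (m + n) (B.braidShift.swap m n) := by
  induction m with
  | zero => exact bijectiveOn_one _
  | succ m ih =>
    refine BijectiveOn.mul ?_ ?_
    · rw [show m + 1 + n = n + 1 + m by omega]
      exact B.bijectiveOn_cross n m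
    · rw [show m + 1 + n = m + n + 1 by omega]
      exact B.bijectiveOn_shift ih

lemma tensorSwap_bijective : Function.Bijective B.tensorSwap := by
  choose h g hg using fun m n => B.bijectiveOn_swap m n
  -- The inverse on degrees `(n, m)` uses the inverse of `swap m n`, with the two indices exchanged,
  -- and cuts after `m` letters.
  let F : TensorAlgebra k V ⊗[k] TensorAlgebra k V →ₗ[k] TensorAlgebra k V ⊗[k] TensorAlgebra k V :=
    glue₂ fun n m => splitAt k V m ∘ₗ (g m n).1 ∘ₗ LinearMap.mul' k _
  have hF : ∀ {a b : ℕ} {w : TensorAlgebra k V}, w ∈ homog k V (a + b) →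
      F (splitAt k V a w) = splitAt k V b ((g b a).1 w) := by
    intro a b w hw
    rw [glue₂_splitAt _ hw, LinearMap.comp_apply, LinearMap.comp_apply, mul'_splitAt hw]
  have h1 : F ∘ₗ B.tensorSwap = LinearMap.id := by
    refine linearMap_ext_homog₂ fun m x hx n y hy => ?_
    have hw := mul_mem_homog hx hy
    have hw' := h m n _ hw
    rw [add_comm] at hw'
    rw [LinearMap.comp_apply, ← splitAt_mul hx, B.tensorSwap_splitAt hw, hF hw', (hg m n _ hw).2.1]
    rfl
  have h2 : B.tensorSwap ∘ₗ F = LinearMap.id := by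
    refine linearMap_ext_homog₂ fun m x hx n y hy => ?_
    have hw := mul_mem_homog hx hy
    have hw1 := hw
    rw [add_comm] at hw1
    have hw' := (hg n m _ hw1).1
    rw [LinearMap.comp_apply, ← splitAt_mul hx, hF hw, B.tensorSwap_splitAt hw', (hg n m _ hw1).2.2]
    rfl
  exact ⟨Function.LeftInverse.injective (g := F) (LinearMap.congr_fun h1),
    Function.RightInverse.surjective (g := F) (LinearMap.congr_fun h2)⟩

/-- Products in `scalarEnd` unfold definitionally to composites, so through this lemma an identity
of products closes goals stated with operators applied one after another. -/
lemma braidShift_congr {f g : scalarEnd k V} (h : f = g) (x : TensorAlgebra k V) :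
    f.1 x = g.1 x := by rw [h]

lemma tensorSwap_braid :
    braidLeft B.tensorSwap ∘ₗ braidRight B.tensorSwap ∘ₗ braidLeft B.tensorSwap =
      braidRight B.tensorSwap ∘ₗ braidLeft B.tensorSwap ∘ₗ braidRight B.tensorSwap := by
  refine linearMap_ext_homog₃ 
    (M := (TensorAlgebra k V ⊗[k] TensorAlgebra k V) ⊗[k] TensorAlgebra k V) fun m x hx n y hy p z hz => ?_
  have hw := mul_mem_homog (mul_mem_homog hx hy) hz
  have h1 := B.strands_apply_mem (B.braidShift.swap_mem_strands m n) (by omega) hw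
  have h2 := B.strands_apply_mem (B.braidShift.pow_mem_strands
    (B.braidShift.swap_mem_strands m p) n) (by omega) h1
  have h3 := B.strands_apply_mem (B.braidShift.pow_mem_strands
    (B.braidShift.swap_mem_strands n p) m) (by omega) hw
  have h4 := B.strands_apply_mem (B.braidShift.swap_mem_strands m p) (by omega) h3
  rw [← splitAt₃_mul hx hy, LinearMap.comp_apply, LinearMap.comp_apply, LinearMap.comp_apply,
    LinearMap.comp_apply, B.braidLeft_splitAt₃ hw,
    B.braidRight_splitAt₃ (d := p) (by convert h1 using 1; congr 1; omega),
    B.braidLeft_splitAt₃ (d := m) (by convert h2 using 1; congr 1; omega),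
    B.braidRight_splitAt₃ (d := p) (by convert hw using 1; congr 1; omega),
    B.braidLeft_splitAt₃ (d := n) (by convert h3 using 1; congr 1; omega),
    B.braidRight_splitAt₃ (d := n) (by convert h4 using 1; congr 1; omega)]
  exact congrArg _ (braidShift_congr (B.braidShift.swap_braid m n p) _)

/-- The two successive swaps combine to a swap of `m + n` strands with `p`, through which the
shuffle of the `m + n` strands slides by naturality. -/
lemma tensorSwap_mul_left : B.tensorSwap ∘ₗ LinearMap.rTensor _ B.shuffleMul =
    LinearMap.lTensor _ B.shuffleMul ∘ₗ (TensorProduct.assoc k _ _ _).toLinearMap ∘ₗ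
      braidLeft B.tensorSwap ∘ₗ braidRight B.tensorSwap := by
  refine linearMap_ext_homog₃ fun m x hx n y hy p z hz => ?_
  have hw := mul_mem_homog (mul_mem_homog hx hy) hz
  have h1 := B.strands_apply_mem (B.braidShift.shuffle_mem_strands m n) (by omega) hw
  have h3 := B.strands_apply_mem (B.braidShift.pow_mem_strands
    (B.braidShift.swap_mem_strands n p) m) (by omega) hw
  have h4 := B.strands_apply_mem (B.braidShift.swap_mem_strands m p) (by omega) h3
  rw [← splitAt₃_mul hx hy, LinearMap.comp_apply, LinearMap.comp_apply, LinearMap.comp_apply,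
    LinearMap.comp_apply, B.rTensor_shuffleMul_splitAt₃ hw, B.tensorSwap_splitAt h1,
    B.braidRight_splitAt₃ (d := p) (by convert hw using 1; congr 1; omega),
    B.braidLeft_splitAt₃ (d := n) (by convert h3 using 1; congr 1; omega), LinearEquiv.coe_coe,
    B.lTensor_shuffleMul_splitAt₃ (d := n) (by convert h4 using 1; congr 1; omega)]
  refine congrArg _ (braidShift_congr (f := B.braidShift.swap (m + n) p * B.braidShift.shuffle m n)
    (g := (B.braidShift.σ ^ p) (B.braidShift.shuffle m n) * (B.braidShift.swap m p *
      (B.braidShift.σ ^ m) (B.braidShift.swap n p))) ?_ _)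
  rw [← BraidShift.swap_add_left, BraidShift.swap_natural_left _
    (B.braidShift.shuffle_mem_strands m n)]

lemma tensorSwap_mul_right :
    B.tensorSwap ∘ₗ LinearMap.lTensor _ B.shuffleMul ∘ₗ (TensorProduct.assoc k _ _ _).toLinearMap =
    LinearMap.rTensor _ B.shuffleMul ∘ₗ braidRight B.tensorSwap ∘ₗ braidLeft B.tensorSwap := by
  refine linearMap_ext_homog₃ fun m x hx n y hy p z hz => ?_
  have hw := mul_mem_homog (mul_mem_homog hx hy) hz
  have h1 := B.strands_apply_mem (B.braidShift.pow_mem_strands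
    (B.braidShift.shuffle_mem_strands n p) m) (by omega) hw
  have h3 := B.strands_apply_mem (B.braidShift.swap_mem_strands m n) (by omega) hw
  have h4 := B.strands_apply_mem (B.braidShift.pow_mem_strands
    (B.braidShift.swap_mem_strands m p) n) (by omega) h3
  rw [← splitAt₃_mul hx hy, LinearMap.comp_apply, LinearMap.comp_apply, LinearMap.comp_apply,
    LinearMap.comp_apply, LinearEquiv.coe_coe,
    B.lTensor_shuffleMul_splitAt₃ (d := p) (by convert hw using 1; congr 1; omega),
    B.tensorSwap_splitAt (b := n + p) (by convert h1 using 1; congr 1; omega),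
    B.braidLeft_splitAt₃ hw,
    B.braidRight_splitAt₃ (d := p) (by convert h3 using 1; congr 1; omega),
    B.rTensor_shuffleMul_splitAt₃ (d := m) (by convert h4 using 1; congr 1; omega)]
  refine congrArg _ (braidShift_congr (f := B.braidShift.swap m (n + p) *
    (B.braidShift.σ ^ m) (B.braidShift.shuffle n p)) (g := B.braidShift.shuffle n p *
      ((B.braidShift.σ ^ n) (B.braidShift.swap m p) * B.braidShift.swap m n)) ?_ _)
  rw [← BraidShift.swap_add_right, BraidShift.swap_natural_right _
    (B.braidShift.shuffle_mem_strands n p)]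

lemma shuffleMul_assoc : B.shuffleMul ∘ₗ LinearMap.rTensor _ B.shuffleMul =
    B.shuffleMul ∘ₗ LinearMap.lTensor _ B.shuffleMul ∘ₗ
      (TensorProduct.assoc k _ _ _).toLinearMap := by
  refine linearMap_ext_homog₃ fun m x hx n y hy p z hz => ?_
  have hw := mul_mem_homog (mul_mem_homog hx hy) hz
  have h1 := B.strands_apply_mem (B.braidShift.pow_mem_strands
    (B.braidShift.shuffle_mem_strands n p) m) (by omega) hw
  have h3 := B.strands_apply_mem (B.braidShift.shuffle_mem_strands m n) (by omega) hw
  rw [← splitAt₃_mul hx hy, LinearMap.comp_apply, LinearMap.comp_apply, LinearMap.comp_apply,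
    LinearEquiv.coe_coe, B.rTensor_shuffleMul_splitAt₃ hw, B.shuffleMul_splitAt h3,
    B.lTensor_shuffleMul_splitAt₃ (d := p) (by convert hw using 1; congr 1; omega),
    B.shuffleMul_splitAt (b := n + p) (by convert h1 using 1; congr 1; omega)]
  exact braidShift_congr (B.braidShift.shuffle_assoc m n p) _

lemma shuffleMul_one_left (x : TensorAlgebra k V) : B.shuffleMul (1 ⊗ₜ x) = x := by
  refine LinearMap.congr_fun (f := B.shuffleMul ∘ₗ TensorProduct.mk k _ _ 1) (g := LinearMap.id)
    (linearMap_ext_homog fun n x hx => ?_) x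
  change B.shuffleMul (splitAt k V 0 x) = x
  rw [B.shuffleMul_splitAt (b := n) (by rwa [zero_add]), BraidShift.shuffle_zero_left]
  rfl

lemma shuffleMul_one_right (x : TensorAlgebra k V) : B.shuffleMul (x ⊗ₜ 1) = x := by
  refine LinearMap.congr_fun (f := B.shuffleMul ∘ₗ (TensorProduct.mk k _ _).flip 1)
    (g := LinearMap.id) (linearMap_ext_homog fun n x hx => ?_) x
  change B.shuffleMul (x ⊗ₜ 1) = x
  rw [← splitAt_self hx, B.shuffleMul_splitAt (b := 0) hx, BraidShift.shuffle_zero_right]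
  rfl

lemma tensorSwap_one_left (x : TensorAlgebra k V) : B.tensorSwap (1 ⊗ₜ x) = x ⊗ₜ 1 := by
  refine LinearMap.congr_fun (f := B.tensorSwap ∘ₗ TensorProduct.mk k _ _ 1)
    (g := (TensorProduct.mk k _ _).flip 1) (linearMap_ext_homog fun n x hx => ?_) x
  change B.tensorSwap (splitAt k V 0 x) = x ⊗ₜ 1
  rw [B.tensorSwap_splitAt (b := n) (by rwa [zero_add]), BraidShift.swap_zero_left,
    ← splitAt_self hx]
  rfl

lemma tensorSwap_one_right (x : TensorAlgebra k V) : B.tensorSwap (x ⊗ₜ 1) = 1 ⊗ₜ x := by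
  refine LinearMap.congr_fun (f := B.tensorSwap ∘ₗ (TensorProduct.mk k _ _).flip 1)
    (g := TensorProduct.mk k _ _ 1) (linearMap_ext_homog fun n x hx => ?_) x
  change B.tensorSwap (x ⊗ₜ 1) = splitAt k V 0 x
  rw [← splitAt_self hx, B.tensorSwap_splitAt (b := 0) hx, BraidShift.swap_zero_right]
  rfl

/-- The sums agree cut by cut: for `m = a + b` the claim is additivity of `swap` in its first
argument. -/
lemma tensorSwap_comul_left :
    (TensorProduct.assoc k _ _ _).symm.toLinearMap ∘ₗ
        LinearMap.lTensor _ (deconcat k V) ∘ₗ B.tensorSwap =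
      braidLeft B.tensorSwap ∘ₗ braidRight B.tensorSwap ∘ₗ LinearMap.rTensor _ (deconcat k V) := by
  refine linearMap_ext_homog₂ 
    (M := (TensorAlgebra k V ⊗[k] TensorAlgebra k V) ⊗[k] TensorAlgebra k V) fun m x hx n y hy => ?_
  have hw := mul_mem_homog hx hy
  have h1 := B.strands_apply_mem (B.braidShift.swap_mem_strands m n) le_rfl hw
  rw [← splitAt_mul hx, LinearMap.comp_apply, LinearMap.comp_apply, LinearMap.comp_apply,
    LinearMap.comp_apply, B.tensorSwap_splitAt hw, rTensor_deconcat_splitAt hw,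
    lTensor_deconcat_splitAt (b := m) (by rwa [add_comm n m]), map_sum, map_sum, map_sum]
  refine Finset.sum_congr rfl fun ⟨a, b⟩ hp => ?_
  rw [Finset.HasAntidiagonal.mem_antidiagonal] at hp
  obtain rfl : a + b = m := hp
  have h2 := B.strands_apply_mem (B.braidShift.pow_mem_strands
    (B.braidShift.swap_mem_strands b n) a) (by omega) hw
  rw [B.braidRight_splitAt₃ (d := n) (by convert hw using 1; congr 1; omega),
    B.braidLeft_splitAt₃ (d := b) (by convert h2 using 1; congr 1; omega), LinearEquiv.coe_coe,
    LinearEquiv.symm_apply_apply]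
  exact congrArg _ (braidShift_congr (B.braidShift.swap_add_left a b n) _)

lemma tensorSwap_comul_right :
    LinearMap.rTensor _ (deconcat k V) ∘ₗ B.tensorSwap =
      braidRight B.tensorSwap ∘ₗ braidLeft B.tensorSwap ∘ₗ
        (TensorProduct.assoc k _ _ _).symm.toLinearMap ∘ₗ LinearMap.lTensor _ (deconcat k V) := by
  refine linearMap_ext_homog₂ 
    (M := (TensorAlgebra k V ⊗[k] TensorAlgebra k V) ⊗[k] TensorAlgebra k V) fun m x hx n y hy => ?_
  have hw := mul_mem_homog hx hy
  have h1 := B.strands_apply_mem (B.braidShift.swap_mem_strands m n) le_rfl hw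
  rw [← splitAt_mul hx, LinearMap.comp_apply, LinearMap.comp_apply, LinearMap.comp_apply,
    LinearMap.comp_apply, B.tensorSwap_splitAt hw, lTensor_deconcat_splitAt hw,
    rTensor_deconcat_splitAt (b := m) (by rwa [add_comm n m]), map_sum, map_sum, map_sum]
  refine Finset.sum_congr rfl fun ⟨a, b⟩ hp => ?_
  rw [Finset.HasAntidiagonal.mem_antidiagonal] at hp
  obtain rfl : a + b = n := hp
  have h2 := B.strands_apply_mem (B.braidShift.swap_mem_strands m a) (by omega) hw
  rw [LinearEquiv.coe_coe, LinearEquiv.symm_apply_apply,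
    B.braidLeft_splitAt₃ (d := b) (by convert hw using 1; congr 1; omega),
    B.braidRight_splitAt₃ (d := b) (by convert h2 using 1; congr 1; omega)]
  exact congrArg _ (braidShift_congr (B.braidShift.swap_add_right m a b) _)

lemma tensorSwap_counit_left :
    (TensorProduct.rid k _).toLinearMap ∘ₗ LinearMap.lTensor _ (augmentation k V) ∘ₗ B.tensorSwap =
      (TensorProduct.lid k _).toLinearMap ∘ₗ LinearMap.rTensor _ (augmentation k V) := by
  refine linearMap_ext_homog₂ fun m x hx n y hy => ?_
  obtain rfl | hm := eq_or_ne m 0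
  · obtain ⟨r, rfl⟩ := homog_zero_eq hx
    simp [← TensorProduct.smul_tmul', tensorSwap_one_left]
  · have hw := mul_mem_homog hx hy
    have h1 := B.strands_apply_mem (B.braidShift.swap_mem_strands m n) le_rfl hw
    rw [← splitAt_mul hx, LinearMap.comp_apply, LinearMap.comp_apply, LinearMap.comp_apply,
      B.tensorSwap_splitAt hw, lTensor_augmentation_splitAt hm (by rwa [add_comm n m]),
      rTensor_augmentation_splitAt hm hw, map_zero, map_zero]

lemma tensorSwap_counit_right :
    (TensorProduct.lid k _).toLinearMap ∘ₗ LinearMap.rTensor _ (augmentation k V) ∘ₗ B.tensorSwap =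
      (TensorProduct.rid k _).toLinearMap ∘ₗ LinearMap.lTensor _ (augmentation k V) := by
  refine linearMap_ext_homog₂ fun m x hx n y hy => ?_
  obtain rfl | hn := eq_or_ne n 0
  · obtain ⟨r, rfl⟩ := homog_zero_eq hy
    simp [tensorSwap_one_right]
  · have hw := mul_mem_homog hx hy
    have h1 := B.strands_apply_mem (B.braidShift.swap_mem_strands m n) le_rfl hw
    rw [← splitAt_mul hx, LinearMap.comp_apply, LinearMap.comp_apply, LinearMap.comp_apply,
      B.tensorSwap_splitAt hw, rTensor_augmentation_splitAt hn (b := m) (by rwa [add_comm n m]),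
      lTensor_augmentation_splitAt hn hw, map_zero, map_zero]

lemma shuffleMul_mem {m n : ℕ} {x y : TensorAlgebra k V} (hx : x ∈ homog k V m)
    (hy : y ∈ homog k V n) : B.shuffleMul (x ⊗ₜ y) ∈ homog k V (m + n) := by
  rw [← splitAt_mul hx, B.shuffleMul_splitAt (mul_mem_homog hx hy)]
  exact B.strands_apply_mem (B.braidShift.shuffle_mem_strands m n) le_rfl (mul_mem_homog hx hy)

lemma augmentation_shuffleMul (x y : TensorAlgebra k V) :
    augmentation k V (B.shuffleMul (x ⊗ₜ y)) = augmentation k V x * augmentation k V y := by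
  refine LinearMap.congr_fun (f := augmentation k V ∘ₗ B.shuffleMul) (g := LinearMap.mul' k k ∘ₗ
    TensorProduct.map (augmentation k V) (augmentation k V)) ?_ (x ⊗ₜ y)
  refine linearMap_ext_homog₂ fun m x hx n y hy => ?_
  simp only [LinearMap.comp_apply, TensorProduct.map_tmul, LinearMap.mul'_apply]
  obtain rfl | hm := eq_or_ne m 0
  · obtain ⟨r, rfl⟩ := homog_zero_eq hx
    simp [← TensorProduct.smul_tmul', shuffleMul_one_left]
  · rw [augmentation_of_pos hm hx, augmentation_of_pos (by omega) (B.shuffleMul_mem hx hy),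
      zero_mul]

/-- The contribution of one pair of cuts to the product of two coproducts is exactly one summand of
`shuffle_eq_sum`. -/
lemma map_shuffleMul_braidMiddle {a b d e : ℕ} {x y : TensorAlgebra k V}
    (hx : x ∈ homog k V (a + b)) (hy : y ∈ homog k V (d + e)) :
    TensorProduct.map B.shuffleMul B.shuffleMul
      (braidMiddle B.tensorSwap (splitAt k V a x ⊗ₜ splitAt k V d y)) =
    splitAt k V (a + d) ((B.braidShift.shuffle a d *
      (B.braidShift.σ ^ (a + d)) (B.braidShift.shuffle b e) *
      (B.braidShift.σ ^ a) (B.braidShift.swap b d)).1 (x * y)) := by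
  induction hx using homog_add_induction with
  | add x x' _ _ hx hx' => simp only [map_add, add_mul, TensorProduct.add_tmul, hx, hx']
  | mul x₁ hx₁ x₂ hx₂ =>
    induction hy using homog_add_induction with
    | add y y' _ _ hy hy' => simp only [map_add, mul_add, TensorProduct.tmul_add, hy, hy']
    | mul y₁ hy₁ y₂ hy₂ =>
      have hs := B.braidShift.swap_mem_strands b d
      have hw := mul_mem_homog hx₂ hy₁
      have hu := B.strands_apply_mem hs le_rfl hw
      have h1 : braidMiddle B.tensorSwap ((x₁ ⊗ₜ x₂) ⊗ₜ (y₁ ⊗ₜ y₂)) =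
          (TensorProduct.assoc k _ _ _).symm (x₁ ⊗ₜ TensorProduct.assoc k _ _ _
            (splitAt k V d ((B.braidShift.swap b d).1 (x₂ * y₁)) ⊗ₜ y₂)) := by
        rw [← B.tensorSwap_splitAt hw, splitAt_mul hx₂]
        rfl
      have h2 : ((B.braidShift.σ ^ a) (B.braidShift.swap b d)).1 (x₁ * x₂ * (y₁ * y₂)) =
          x₁ * ((B.braidShift.swap b d).1 (x₂ * y₁) * y₂) := by
        rw [mul_assoc, B.shift_pow_apply hx₁, ← mul_assoc x₂, B.strands_apply_mul hs hw]
      rw [splitAt_mul hx₁, splitAt_mul hy₁, h1]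
      change _ = splitAt k V (a + d) ((B.braidShift.shuffle a d *
        (B.braidShift.σ ^ (a + d)) (B.braidShift.shuffle b e)).1 (_))
      rw [h2]
      generalize (B.braidShift.swap b d).1 (x₂ * y₁) = u at hu
      rw [add_comm] at hu
      induction hu using homog_add_induction with
      | add u u' _ _ hu hu' =>
        simp only [map_add, add_mul, mul_add, TensorProduct.add_tmul, TensorProduct.tmul_add,
          hu, hu']
      | mul u₁ hu₁ u₂ hu₂ =>
        have h3 := mul_mem_homog hx₁ hu₁
        have hs' := B.braidShift.shuffle_mem_strands a d
        rw [splitAt_mul hu₁]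
        change B.shuffleMul (x₁ ⊗ₜ u₁) ⊗ₜ B.shuffleMul (u₂ ⊗ₜ y₂) = splitAt k V (a + d)
          ((B.braidShift.shuffle a d).1
          (((B.braidShift.σ ^ (a + d)) (B.braidShift.shuffle b e)).1 (x₁ * (u₁ * u₂ * y₂))))
        rw [mul_assoc u₁, ← mul_assoc, B.shift_pow_apply h3, B.strands_apply_mul hs' h3,
          splitAt_mul (B.strands_apply_mem hs' le_rfl h3), ← B.shuffleMul_splitAt h3,
          splitAt_mul hx₁, ← B.shuffleMul_splitAt (mul_mem_homog hu₂ hy₂), splitAt_mul hu₂]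

open Finset in
lemma deconcat_shuffleMul : deconcat k V ∘ₗ B.shuffleMul =
    TensorProduct.map B.shuffleMul B.shuffleMul ∘ₗ braidMiddle B.tensorSwap ∘ₗ
      TensorProduct.map (deconcat k V) (deconcat k V) := by
  refine linearMap_ext_homog₂ fun m x hx n y hy => ?_
  have hw := mul_mem_homog hx hy
  let G (p : ℕ × ℕ) : TensorAlgebra k V ⊗[k] TensorAlgebra k V := splitAt k V (p.1 + p.2)
    ((B.braidShift.shuffle p.1 p.2 *
      (B.braidShift.σ ^ (p.1 + p.2)) (B.braidShift.shuffle (m - p.1) (n - p.2)) *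
      (B.braidShift.σ ^ p.1) (B.braidShift.swap (m - p.1) p.2)).1 (x * y))
  have hl : deconcat k V (B.shuffleMul (x ⊗ₜ y)) = ∑ a ∈ range (m + n + 1),
      ∑ p ∈ HasAntidiagonal.antidiagonal a, if p.1 ≤ m ∧ p.2 ≤ n then G p else 0 := by
    rw [← splitAt_mul hx, B.shuffleMul_splitAt hw, deconcat_apply (B.strands_apply_mem
      (B.braidShift.shuffle_mem_strands m n) le_rfl hw),
      Nat.sum_antidiagonal_eq_sum_range_succ_mk]
    refine sum_congr rfl fun a ha => ?_
    rw [B.braidShift.shuffle_eq_sum a m n (by rw [mem_range] at ha; omega)]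
    simp only [AddSubmonoidClass.coe_finsetSum, LinearMap.sum_apply, map_sum]
    refine sum_congr rfl fun p hp => ?_
    rw [HasAntidiagonal.mem_antidiagonal] at hp
    split_ifs
    · rw [← hp]
    · exact map_zero _
  have hr : TensorProduct.map B.shuffleMul B.shuffleMul (braidMiddle B.tensorSwap
      (deconcat k V x ⊗ₜ deconcat k V y)) = ∑ p ∈ range (m + 1) ×ˢ range (n + 1), G p := by
    rw [deconcat_apply hx, deconcat_apply hy, TensorProduct.sum_tmul, map_sum, map_sum,
      Nat.sum_antidiagonal_eq_sum_range_succ_mk, sum_product]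
    refine sum_congr rfl fun i hi => ?_
    rw [TensorProduct.tmul_sum, map_sum, map_sum, Nat.sum_antidiagonal_eq_sum_range_succ_mk]
    refine sum_congr rfl fun j hj => ?_
    rw [mem_range] at hi hj
    exact B.map_shuffleMul_braidMiddle (by rwa [show i + (m - i) = m by omega])
      (by rwa [show j + (n - j) = n by omega])
  -- `hl` runs over the cut position `a` and then over pairs of sum `a`; `hr` runs over a rectangle
  -- of pairs. Grouping the rectangle by the sum of the pair matches them.
  rw [LinearMap.comp_apply, hl, LinearMap.comp_apply, LinearMap.comp_apply,
    TensorProduct.map_tmul, hr, ← sum_fiberwise_of_maps_to (g := fun p : ℕ × ℕ => p.1 + p.2)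
      (t := range (m + n + 1)) (by simp only [mem_product, mem_range]; intro p hp; omega)]
  refine sum_congr rfl fun a _ => ?_
  rw [← sum_filter]
  refine sum_congr ?_ fun _ _ => rfl
  ext p
  simp only [mem_filter, HasAntidiagonal.mem_antidiagonal, mem_product, mem_range]
  omega

end Braiding

/-! ### Transport of braiding operators along an intertwining map -/

section Intertwining

variable {k : Type u} {M : Type v} {N : Type w} [Field k] [AddCommGroup M] [Module k M]
  [AddCommGroup N] [Module k N]

lemma TensorProduct.map_injective_of_field {M' : Type*} {N' : Type*} [AddCommGroup M']
    [Module k M'] [AddCommGroup N'] [Module k N'] {f : M →ₗ[k] N} {g : M' →ₗ[k] N'}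
    (hf : Function.Injective f) (hg : Function.Injective g) :
    Function.Injective (TensorProduct.map f g) := by
  have : TensorProduct.map f g = LinearMap.lTensor N g ∘ₗ LinearMap.rTensor M' f := by
    rw [LinearMap.lTensor, LinearMap.rTensor, ← TensorProduct.map_comp, LinearMap.id_comp,
      LinearMap.comp_id]
  rw [this]
  exact (Module.Flat.lTensor_preserves_injective_linearMap g hg).comp
    (Module.Flat.rTensor_preserves_injective_linearMap f hf)

variable {f : M →ₗ[k] N} {c : M ⊗[k] M →ₗ[k] M ⊗[k] M} {d : N ⊗[k] N →ₗ[k] N ⊗[k] N}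

lemma map_braidLeft (h : ∀ t, TensorProduct.map f f (c t) = d (TensorProduct.map f f t))
    (t : (M ⊗[k] M) ⊗[k] M) :
    TensorProduct.map (TensorProduct.map f f) f (braidLeft c t) =
      braidLeft d (TensorProduct.map (TensorProduct.map f f) f t) := by
  induction t using TensorProduct.induction_on with
  | zero => simp
  | tmul x y => simp [braidLeft, h]
  | add x y hx hy => simp only [map_add, hx, hy]

lemma map_braidRight (h : ∀ t, TensorProduct.map f f (c t) = d (TensorProduct.map f f t))
    (t : (M ⊗[k] M) ⊗[k] M) :
    TensorProduct.map (TensorProduct.map f f) f (braidRight c t) =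
      braidRight d (TensorProduct.map (TensorProduct.map f f) f t) := by
  have h1 : ∀ t : M ⊗[k] (M ⊗[k] M), TensorProduct.map f (TensorProduct.map f f)
      (LinearMap.lTensor M c t) =
        LinearMap.lTensor N d (TensorProduct.map f (TensorProduct.map f f) t) := by
    intro t
    induction t using TensorProduct.induction_on with
    | zero => simp
    | tmul x y => simp [h]
    | add x y hx hy => simp only [map_add, hx, hy]
  simp only [braidRight, LinearMap.comp_apply, LinearEquiv.coe_coe,
    TensorProduct.map_map_assoc_symm, h1, TensorProduct.map_map_assoc]

/-- Besides carrying the bialgebra axiom along the inclusion into the shuffle algebra, this compares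
the coproducts of two Nichols algebras in `map_comul`. -/
lemma map_braidMiddle (h : ∀ t, TensorProduct.map f f (c t) = d (TensorProduct.map f f t))
    (t : (M ⊗[k] M) ⊗[k] (M ⊗[k] M)) :
    TensorProduct.map (TensorProduct.map f f) (TensorProduct.map f f) (braidMiddle c t) =
      braidMiddle d (TensorProduct.map (TensorProduct.map f f) (TensorProduct.map f f) t) := by
  have h2 : ∀ t : (M ⊗[k] M) ⊗[k] M, TensorProduct.map (TensorProduct.map f f) f
      (LinearMap.rTensor M c t) =
        LinearMap.rTensor N d (TensorProduct.map (TensorProduct.map f f) f t) :=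
    map_braidLeft h
  have h1 : ∀ t : M ⊗[k] (M ⊗[k] (M ⊗[k] M)),
      TensorProduct.map f (TensorProduct.map f (TensorProduct.map f f))
      (LinearMap.lTensor M ((TensorProduct.assoc k M M M).toLinearMap ∘ₗ LinearMap.rTensor M c ∘ₗ
        (TensorProduct.assoc k M M M).symm.toLinearMap) t) =
      (LinearMap.lTensor N ((TensorProduct.assoc k N N N).toLinearMap ∘ₗ LinearMap.rTensor N d ∘ₗ
        (TensorProduct.assoc k N N N).symm.toLinearMap)
        (TensorProduct.map f (TensorProduct.map f (TensorProduct.map f f)) t)) := by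
    intro t
    induction t using TensorProduct.induction_on with
    | zero => simp
    | tmul x y =>
      simp only [LinearMap.lTensor_tmul, TensorProduct.map_tmul, LinearMap.comp_apply,
        LinearEquiv.coe_coe, TensorProduct.map_map_assoc, h2, TensorProduct.map_map_assoc_symm]
    | add x y hx hy => simp only [map_add, hx, hy]
  simp only [braidMiddle, LinearMap.comp_apply, LinearEquiv.coe_coe,
    TensorProduct.map_map_assoc_symm, h1, TensorProduct.map_map_assoc]

lemma tensorSubmodule_le {P Q : Submodule k M} {S : Submodule k (M ⊗[k] M)} :
    tensorSubmodule P Q ≤ S ↔ ∀ x ∈ P, ∀ y ∈ Q, x ⊗ₜ y ∈ S := by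
  refine ⟨fun h x hx y hy => h ⟨⟨x, hx⟩ ⊗ₜ ⟨y, hy⟩, rfl⟩, fun h => ?_⟩
  rintro _ ⟨t, rfl⟩
  induction t using TensorProduct.induction_on with
  | zero => simp
  | tmul x y => exact h _ x.2 _ y.2
  | add x y hx hy => rw [map_add]; exact add_mem hx hy

lemma tmul_mem_tensorSubmodule {P Q : Submodule k M} {x y : M} (hx : x ∈ P) (hy : y ∈ Q) :
    x ⊗ₜ[k] y ∈ tensorSubmodule P Q := tensorSubmodule_le.1 le_rfl x hx y hy

end Intertwining

/-! ### Linear maps and coproducts on graded spaces -/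

section Graded

variable {k : Type u} {R : Type w} [Field k] [AddCommGroup R] [Module k R]
  {M : Type*} [AddCommGroup M] [Module k M]

lemma exists_linearMap_of_isInternal {𝒜 : ℕ → Submodule k R} (h𝒜 : DirectSum.IsInternal 𝒜)
    (f : ℕ → R →ₗ[k] M) : ∃ F : R →ₗ[k] M, ∀ n, ∀ x ∈ 𝒜 n, F x = f n x := by
  let e := LinearEquiv.ofBijective (DirectSum.coeLinearMap 𝒜) h𝒜
  refine ⟨DirectSum.toModule k ℕ M (fun n => f n ∘ₗ (𝒜 n).subtype) ∘ₗ e.symm.toLinearMap,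
    fun n x hx => ?_⟩
  have : e.symm x = DirectSum.lof k ℕ (fun n => 𝒜 n) n ⟨x, hx⟩ := by
    rw [LinearEquiv.symm_apply_eq]
    exact (DirectSum.coeLinearMap_lof 𝒜 n ⟨x, hx⟩).symm
  rw [LinearMap.comp_apply, LinearEquiv.coe_coe, this, DirectSum.toModule_lof]
  rfl

lemma linearMap_ext_of_isInternal {𝒜 : ℕ → Submodule k R} (h𝒜 : DirectSum.IsInternal 𝒜)
    {f g : R →ₗ[k] M} (h : ∀ n, ∀ x ∈ 𝒜 n, f x = g x) : f = g := by
  have : ⊤ ≤ LinearMap.eqLocus f g := by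
    rw [← h𝒜.submodule_iSup_eq_top]
    exact iSup_le h
  exact LinearMap.ext fun x => this trivial

/-- With `W` a kernel, an equalizer or a preimage, a claim about a coproduct becomes a check on pure
tensors of complementary degrees. -/
lemma comul_induction [Coalgebra k R] {𝒜 : ℕ → Submodule k R}
    (hcomul : ∀ (n : ℕ) (x : R), x ∈ 𝒜 n → Coalgebra.comul (R := k) x ∈
      ⨆ (i : ℕ) (j : ℕ) (_ : i + j = n), tensorSubmodule (𝒜 i) (𝒜 j))
    (n : ℕ) (W : Submodule k (R ⊗[k] R)) (x : R) (hx : x ∈ 𝒜 n)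
    (h : ∀ i j, i + j = n → ∀ a ∈ 𝒜 i, ∀ b ∈ 𝒜 j, a ⊗ₜ b ∈ W) :
    Coalgebra.comul (R := k) x ∈ W := by
  have : ⨆ (i : ℕ) (j : ℕ) (_ : i + j = n), tensorSubmodule (𝒜 i) (𝒜 j) ≤ W :=
    iSup_le fun i => iSup_le fun j => iSup_le fun hij => tensorSubmodule_le.2 (h i j hij)
  exact this (hcomul n x hx)

end Graded

/-! ### The antipode as a geometric series -/

section Antipode

open WithConv

variable {k : Type u} {R : Type w} [Field k] [Ring R] [Algebra k R] [Coalgebra k R]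

/-- A connected graded coalgebra that is an algebra has an antipode. -/
theorem exists_antipode_of_isInternal {𝒜 : ℕ → Submodule k R} (h𝒜 : DirectSum.IsInternal 𝒜)
    (hcomul : ∀ (n : ℕ) (x : R), x ∈ 𝒜 n → Coalgebra.comul (R := k) x ∈
      ⨆ (i : ℕ) (j : ℕ) (_ : i + j = n), tensorSubmodule (𝒜 i) (𝒜 j))
    (hzero : ∀ x ∈ 𝒜 0, algebraMap k R (Coalgebra.counit x) = x) :
    ∃ S : R →ₗ[k] R,
      LinearMap.mul' k R ∘ₗ LinearMap.rTensor R S ∘ₗ Coalgebra.comul =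
          Algebra.linearMap k R ∘ₗ Coalgebra.counit ∧
        LinearMap.mul' k R ∘ₗ LinearMap.lTensor R S ∘ₗ Coalgebra.comul =
          Algebra.linearMap k R ∘ₗ Coalgebra.counit := by
  have comul_induction := comul_induction hcomul
  -- The identity is `1 - u` for convolution, so its inverse should be the sum of all powers of `u`.
  -- As `u` vanishes in degree zero, `u ^ n` vanishes below degree `n`, and the sum is finite on
  -- each component.
  let u : WithConv (R →ₗ[k] R) := 1 - toConv LinearMap.id
  have hu0 : ∀ x ∈ 𝒜 0, u.ofConv x = 0 := by
    intro x hx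
    change algebraMap k R (Coalgebra.counit x) - x = 0
    rw [hzero x hx, sub_self]
  have hu : ∀ n, ∀ i < n, ∀ x ∈ 𝒜 i, (u ^ n).ofConv x = 0 := by
    intro n
    induction n with
    | zero => intro i hi; omega
    | succ n ih =>
      intro i hi x hx
      rw [pow_succ', LinearMap.convMul_apply]
      refine comul_induction i (LinearMap.ker (LinearMap.mul' k R ∘ₗ
        TensorProduct.map u.ofConv (u ^ n).ofConv)) x hx fun a b hab y hy z hz => ?_
      rw [LinearMap.mem_ker, LinearMap.comp_apply, TensorProduct.map_tmul, LinearMap.mul'_apply]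
      obtain rfl | ha := eq_or_ne a 0
      · rw [hu0 y hy, zero_mul]
      · rw [ih b (by omega) z hz, mul_zero]
  let T (n : ℕ) : WithConv (R →ₗ[k] R) := ∑ i ∈ Finset.range n, u ^ i
  have hT : ∀ i m n, i < m → m ≤ n → ∀ x ∈ 𝒜 i, (T m).ofConv x = (T n).ofConv x := by
    intro i m n him hmn x hx
    induction n, hmn using Nat.le_induction with
    | base => rfl
    | succ n hmn ih =>
      have : T (n + 1) = T n + u ^ n := Finset.sum_range_succ _ _
      rw [this]
      change _ = (T n).ofConv x + (u ^ n).ofConv x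
      rw [hu n i (by omega) x hx, add_zero, ih]
  -- In degree `n` the powers `u ^ 0, …, u ^ n` suffice; by `hT` any longer truncation gives the
  -- same value.
  obtain ⟨S, hS'⟩ := exists_linearMap_of_isInternal h𝒜 fun n => (T (n + 1)).ofConv
  have hS : ∀ n, ∀ i < n, ∀ x ∈ 𝒜 i, S x = (T n).ofConv x := by
    intro n i hi x hx
    rw [← hT i (i + 1) n (by omega) hi x hx, hS' i x hx]
  have hid : toConv LinearMap.id = 1 - u := by simp [u]
  refine ⟨S, linearMap_ext_of_isInternal h𝒜 fun n x hx => ?_,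
    linearMap_ext_of_isInternal h𝒜 fun n x hx => ?_⟩
  · have h1 : LinearMap.rTensor R S (Coalgebra.comul (R := k) x) =
        TensorProduct.map (T (n + 1)).ofConv LinearMap.id (Coalgebra.comul (R := k) x) := by
      refine comul_induction n (LinearMap.eqLocus _ _) x hx fun a b hab y hy z hz => ?_
      rw [LinearMap.mem_eqLocus, LinearMap.rTensor_tmul, TensorProduct.map_tmul,
        hS (n + 1) a (by omega) y hy, LinearMap.id_apply]
    have h2 := geom_sum_mul_neg u (n + 1)
    rw [← hid] at h2
    have h3 := LinearMap.convMul_apply (T (n + 1)) (toConv LinearMap.id) x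
    rw [LinearMap.comp_apply, LinearMap.comp_apply, h1]
    refine h3.symm.trans ?_
    simp only [T]
    rw [h2]
    change (1 : WithConv (R →ₗ[k] R)).ofConv x - (u ^ (n + 1)).ofConv x = _
    rw [hu (n + 1) n (by omega) x hx, sub_zero]
    rfl
  · have h1 : LinearMap.lTensor R S (Coalgebra.comul (R := k) x) =
        TensorProduct.map LinearMap.id (T (n + 1)).ofConv (Coalgebra.comul (R := k) x) := by
      refine comul_induction n (LinearMap.eqLocus _ _) x hx fun a b hab y hy z hz => ?_
      rw [LinearMap.mem_eqLocus, LinearMap.lTensor_tmul, TensorProduct.map_tmul,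
        hS (n + 1) b (by omega) z hz, LinearMap.id_apply]
    have h2 := mul_neg_geom_sum u (n + 1)
    rw [← hid] at h2
    have h3 := LinearMap.convMul_apply (toConv LinearMap.id) (T (n + 1)) x
    rw [LinearMap.comp_apply, LinearMap.comp_apply, h1]
    refine h3.symm.trans ?_
    simp only [T]
    rw [h2]
    change (1 : WithConv (R →ₗ[k] R)).ofConv x - (u ^ (n + 1)).ofConv x = _
    rw [hu (n + 1) n (by omega) x hx, sub_zero]
    rfl

end Antipode

/-! ### The quantum symmetrizer and its image -/

namespace Braiding

variable {k : Type u} {V : Type v} [Field k] [AddCommGroup V] [Module k V] (B : Braiding k V)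

/-- The quantum symmetrizer, an algebra homomorphism from the tensor algebra to the quantum
shuffle algebra. -/
noncomputable def symmetrize : TensorAlgebra k V →ₗ[k] TensorAlgebra k V :=
  glue fun n => (B.braidShift.symmetrizer n).1

lemma symmetrize_apply {n : ℕ} {x : TensorAlgebra k V} (hx : x ∈ homog k V n) :
    B.symmetrize x = (B.braidShift.symmetrizer n).1 x := glue_apply _ hx

lemma symmetrize_mem {n : ℕ} {x : TensorAlgebra k V} (hx : x ∈ homog k V n) :
    B.symmetrize x ∈ homog k V n := by
  rw [B.symmetrize_apply hx]
  exact B.strands_apply_mem (B.braidShift.symmetrizer_mem_strands n) le_rfl hx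

lemma map_symmetrize_splitAt {a b : ℕ} {w : TensorAlgebra k V} (hw : w ∈ homog k V (a + b)) :
    TensorProduct.map B.symmetrize B.symmetrize (splitAt k V a w) =
      splitAt k V a ((B.braidShift.symmetrizer a *
        (B.braidShift.σ ^ a) (B.braidShift.symmetrizer b)).1 w) := by
  induction hw using homog_add_induction with
  | add x y _ _ hx hy => simp only [map_add, hx, hy]
  | mul x hx y hy =>
    have hs := B.braidShift.symmetrizer_mem_strands a
    change _ = splitAt k V a ((B.braidShift.symmetrizer a).1
      (((B.braidShift.σ ^ a) (B.braidShift.symmetrizer b)).1 (x * y)))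
    rw [B.shift_pow_apply hx, B.strands_apply_mul hs hx,
      splitAt_mul (B.strands_apply_mem hs le_rfl hx), splitAt_mul hx, TensorProduct.map_tmul,
      B.symmetrize_apply hx, B.symmetrize_apply hy]

/-- This is `symmetrizer_add'` read on cut words, and it closes the image under the shuffle product.
-/
lemma symmetrize_mul (x y : TensorAlgebra k V) :
    B.symmetrize (x * y) = B.shuffleMul (B.symmetrize x ⊗ₜ B.symmetrize y) := by
  refine LinearMap.congr_fun (f := B.symmetrize ∘ₗ LinearMap.mul' k _) (g := B.shuffleMul ∘ₗ
    TensorProduct.map B.symmetrize B.symmetrize) ?_ (x ⊗ₜ y)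
  refine linearMap_ext_homog₂ fun m x hx n y hy => ?_
  have hw := mul_mem_homog hx hy
  have h1 := B.strands_apply_mem (B.braidShift.pow_mem_strands
    (B.braidShift.symmetrizer_mem_strands n) m) (by omega) hw
  have h2 : (B.braidShift.symmetrizer m * (B.braidShift.σ ^ m) (B.braidShift.symmetrizer n)).1
      (x * y) ∈ homog k V (m + n) :=
    B.strands_apply_mem (B.braidShift.symmetrizer_mem_strands m) (by omega) h1
  rw [LinearMap.comp_apply, LinearMap.comp_apply, LinearMap.mul'_apply, ← splitAt_mul hx,
    B.map_symmetrize_splitAt hw, B.shuffleMul_splitAt h2, B.symmetrize_apply hw]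
  exact braidShift_congr (B.braidShift.symmetrizer_add' m n) _

lemma symmetrize_one : B.symmetrize 1 = 1 := by
  rw [B.symmetrize_apply one_mem_homog]
  rfl

lemma symmetrize_ι (v : V) : B.symmetrize (ι k v) = ι k v := by
  rw [B.symmetrize_apply (ι_mem_homog v), BraidShift.symmetrizer, BraidShift.shuffle_zero_right,
    BraidShift.symmetrizer, map_one, mul_one]
  rfl

lemma tensorSwap_map_symmetrize (t : TensorAlgebra k V ⊗[k] TensorAlgebra k V) :
    B.tensorSwap (TensorProduct.map B.symmetrize B.symmetrize t) =
      TensorProduct.map B.symmetrize B.symmetrize (B.tensorSwap t) := by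
  refine LinearMap.congr_fun (f := B.tensorSwap ∘ₗ TensorProduct.map B.symmetrize B.symmetrize)
    (g := TensorProduct.map B.symmetrize B.symmetrize ∘ₗ B.tensorSwap) ?_ t
  refine linearMap_ext_homog₂ fun m x hx n y hy => ?_
  have hw := mul_mem_homog hx hy
  have h1 := B.strands_apply_mem (B.braidShift.pow_mem_strands
    (B.braidShift.symmetrizer_mem_strands n) m) (by omega) hw
  have h2 : (B.braidShift.symmetrizer m * (B.braidShift.σ ^ m) (B.braidShift.symmetrizer n)).1
      (x * y) ∈ homog k V (m + n) :=
    B.strands_apply_mem (B.braidShift.symmetrizer_mem_strands m) (by omega) h1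
  have h3 := B.strands_apply_mem (B.braidShift.swap_mem_strands m n) (by omega) hw
  rw [LinearMap.comp_apply, LinearMap.comp_apply, ← splitAt_mul hx, B.map_symmetrize_splitAt hw,
    B.tensorSwap_splitAt h2, B.tensorSwap_splitAt hw,
    B.map_symmetrize_splitAt (b := m) (by rwa [add_comm n m])]
  exact congrArg _ (braidShift_congr (B.braidShift.swap_symmetrizer m n) _)

/-- The homogeneous components of a coproduct on the tensor algebra for which the quantum
symmetrizer is multiplicative. -/
lemma exists_splitAt_symmetrize {a b : ℕ} {w : TensorAlgebra k V} (hw : w ∈ homog k V (a + b)) :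
    ∃ w' ∈ homog k V (a + b), splitAt k V a (B.symmetrize w) =
      TensorProduct.map B.symmetrize B.symmetrize (splitAt k V a w') := by
  obtain ⟨f, hf, h⟩ := B.braidShift.symmetrizer_add a b
  refine ⟨f.1 w, B.strands_apply_mem hf le_rfl hw, ?_⟩
  rw [B.map_symmetrize_splitAt (B.strands_apply_mem hf le_rfl hw), B.symmetrize_apply hw, h]
  rfl

/-- The Nichols algebra as a vector space: the image of the quantum symmetrizer. -/
def Nichols : Type (max u v) := ↥(LinearMap.range B.symmetrize)

namespace Nichols

noncomputable instance : AddCommGroup B.Nichols :=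
  inferInstanceAs (AddCommGroup (LinearMap.range B.symmetrize))

noncomputable instance : Module k B.Nichols :=
  inferInstanceAs (Module k (LinearMap.range B.symmetrize))

/-- The inclusion of the Nichols algebra into the quantum shuffle algebra. -/
noncomputable def incl : B.Nichols →ₗ[k] TensorAlgebra k V := (LinearMap.range B.symmetrize).subtype

/-- The projection of the tensor algebra onto the Nichols algebra. -/
noncomputable def proj : TensorAlgebra k V →ₗ[k] B.Nichols := B.symmetrize.rangeRestrict

lemma incl_proj (x : TensorAlgebra k V) : incl B (proj B x) = B.symmetrize x := rfl

lemma incl_injective : Function.Injective (incl B) := Subtype.val_injective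

lemma proj_surjective : Function.Surjective (proj B) := LinearMap.surjective_rangeRestrict _

noncomputable instance : Mul B.Nichols where
  mul x y := ⟨B.shuffleMul (incl B x ⊗ₜ incl B y), by
    obtain ⟨x, rfl⟩ := proj_surjective B x
    obtain ⟨y, rfl⟩ := proj_surjective B y
    exact ⟨x * y, B.symmetrize_mul x y⟩⟩

noncomputable instance : One B.Nichols where
  one := proj B 1

lemma incl_mul (x y : B.Nichols) : incl B (x * y) = B.shuffleMul (incl B x ⊗ₜ incl B y) := rfl

lemma incl_one : incl B 1 = 1 := B.symmetrize_one

noncomputable instance : Ring B.Nichols where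
  __ := (inferInstance : AddCommGroup B.Nichols)
  __ := (inferInstance : Mul B.Nichols)
  __ := (inferInstance : One B.Nichols)
  left_distrib x y z := incl_injective B <| by
    simp only [incl_mul, map_add, TensorProduct.tmul_add]
  right_distrib x y z := incl_injective B <| by
    simp only [incl_mul, map_add, TensorProduct.add_tmul]
  zero_mul x := incl_injective B <| by rw [incl_mul]; simp
  mul_zero x := incl_injective B <| by rw [incl_mul]; simp
  mul_assoc x y z := incl_injective B <|
    LinearMap.congr_fun B.shuffleMul_assoc ((incl B x ⊗ₜ incl B y) ⊗ₜ incl B z)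
  one_mul x := incl_injective B <| by rw [incl_mul, incl_one, shuffleMul_one_left]
  mul_one x := incl_injective B <| by rw [incl_mul, incl_one, shuffleMul_one_right]

noncomputable instance : Algebra k B.Nichols := Algebra.ofModule
  (fun r x y => incl_injective B <| by
    rw [incl_mul, map_smul, map_smul, incl_mul, ← TensorProduct.smul_tmul', map_smul])
  (fun r x y => incl_injective B <| by
    rw [incl_mul, map_smul, map_smul, incl_mul, TensorProduct.tmul_smul, map_smul])

lemma proj_mul (x y : TensorAlgebra k V) : proj B (x * y) = proj B x * proj B y :=
  incl_injective B (B.symmetrize_mul x y)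

lemma proj_one : proj B 1 = 1 := rfl

lemma incl_mul' (t : B.Nichols ⊗[k] B.Nichols) :
    incl B (LinearMap.mul' k _ t) = B.shuffleMul (TensorProduct.map (incl B) (incl B) t) := by
  induction t using TensorProduct.induction_on with
  | zero => simp
  | tmul x y => rfl
  | add x y hx hy => simp only [map_add, hx, hy]

/-- The inclusion of the tensor square. -/
noncomputable abbrev incl₂ : B.Nichols ⊗[k] B.Nichols →ₗ[k]
    TensorAlgebra k V ⊗[k] TensorAlgebra k V := TensorProduct.map (incl B) (incl B)

/-- The projection to the tensor square. -/
noncomputable abbrev proj₂ : TensorAlgebra k V ⊗[k] TensorAlgebra k V →ₗ[k]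
    B.Nichols ⊗[k] B.Nichols := TensorProduct.map (proj B) (proj B)

/-- The inclusion of the tensor cube. -/
noncomputable abbrev incl₃ : (B.Nichols ⊗[k] B.Nichols) ⊗[k] B.Nichols →ₗ[k]
    (TensorAlgebra k V ⊗[k] TensorAlgebra k V) ⊗[k] TensorAlgebra k V :=
  TensorProduct.map (incl₂ B) (incl B)

lemma incl₂_injective : Function.Injective (incl₂ B) :=
  TensorProduct.map_injective_of_field (incl_injective B) (incl_injective B)

lemma incl₃_injective : Function.Injective (incl₃ B) :=
  TensorProduct.map_injective_of_field (incl₂_injective B) (incl_injective B)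

lemma proj₂_surjective : Function.Surjective (proj₂ B) :=
  TensorProduct.map_surjective (proj_surjective B) (proj_surjective B)

lemma incl₂_proj₂ (t : TensorAlgebra k V ⊗[k] TensorAlgebra k V) :
    incl₂ B (proj₂ B t) = TensorProduct.map B.symmetrize B.symmetrize t := by
  rw [← LinearMap.comp_apply, ← TensorProduct.map_comp]
  rfl

lemma tensorSwap_mem_range (t : B.Nichols ⊗[k] B.Nichols) :
    B.tensorSwap (incl₂ B t) ∈ LinearMap.range (incl₂ B) := by
  obtain ⟨t, rfl⟩ := proj₂_surjective B t
  exact ⟨proj₂ B (B.tensorSwap t), by rw [incl₂_proj₂, incl₂_proj₂, tensorSwap_map_symmetrize]⟩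

/-- The braiding of the Nichols algebra as a linear map. -/
noncomputable def swap : B.Nichols ⊗[k] B.Nichols →ₗ[k] B.Nichols ⊗[k] B.Nichols :=
  (LinearEquiv.ofInjective (incl₂ B) (incl₂_injective B)).symm.toLinearMap ∘ₗ
    (B.tensorSwap ∘ₗ incl₂ B).codRestrict _ (tensorSwap_mem_range B)

lemma incl₂_swap (t : B.Nichols ⊗[k] B.Nichols) :
    incl₂ B (swap B t) = B.tensorSwap (incl₂ B t) :=
  congrArg Subtype.val ((LinearEquiv.ofInjective (incl₂ B) (incl₂_injective B)).apply_symm_apply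
    ⟨B.tensorSwap (incl₂ B t), tensorSwap_mem_range B t⟩)

lemma swap_proj₂ (t : TensorAlgebra k V ⊗[k] TensorAlgebra k V) :
    swap B (proj₂ B t) = proj₂ B (B.tensorSwap t) :=
  incl₂_injective B <| by
    rw [incl₂_swap, incl₂_proj₂, incl₂_proj₂, tensorSwap_map_symmetrize]

/-- Injectivity is inherited from the shuffle algebra along `incl₂`, surjectivity from the tensor
algebra along `proj₂`. -/
lemma swap_bijective : Function.Bijective (swap B) := by
  refine ⟨fun s t h => incl₂_injective B (B.tensorSwap_bijective.1 ?_), fun t => ?_⟩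
  · rw [← incl₂_swap, ← incl₂_swap, h]
  · obtain ⟨t, rfl⟩ := proj₂_surjective B t
    obtain ⟨s, rfl⟩ := B.tensorSwap_bijective.2 t
    exact ⟨proj₂ B s, swap_proj₂ B s⟩

/-- Each homogeneous cut of a symmetrized word lies in the image of the symmetrizer on both sides,
by the factorisation in `symmetrizer_add`. -/
lemma deconcat_mem_range (x : B.Nichols) : deconcat k V (incl B x) ∈ LinearMap.range (incl₂ B) := by
  obtain ⟨x, rfl⟩ := proj_surjective B x
  rw [incl_proj]
  induction x using DirectSum.Decomposition.inductionOn (homog k V) with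
  | zero => simp
  | add x y hx hy => simp only [map_add]; exact add_mem hx hy
  | @homogeneous n x =>
    rw [deconcat_apply (B.symmetrize_mem x.2)]
    refine sum_mem fun p hp => ?_
    rw [Finset.HasAntidiagonal.mem_antidiagonal] at hp
    obtain ⟨w, -, hw⟩ := B.exists_splitAt_symmetrize (a := p.1) (b := p.2) (w := x)
      (by rw [hp]; exact x.2)
    exact ⟨proj₂ B (splitAt k V p.1 w), by rw [hw, incl₂_proj₂]⟩

/-- The coproduct of the Nichols algebra. -/
noncomputable def comul : B.Nichols →ₗ[k] B.Nichols ⊗[k] B.Nichols :=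
  (LinearEquiv.ofInjective (incl₂ B) (incl₂_injective B)).symm.toLinearMap ∘ₗ
    (deconcat k V ∘ₗ incl B).codRestrict _ (deconcat_mem_range B)

lemma incl₂_comul (x : B.Nichols) : incl₂ B (comul B x) = deconcat k V (incl B x) :=
  congrArg Subtype.val ((LinearEquiv.ofInjective (incl₂ B) (incl₂_injective B)).apply_symm_apply
    ⟨deconcat k V (incl B x), deconcat_mem_range B x⟩)

/-- The counit of the Nichols algebra. -/
noncomputable def counit : B.Nichols →ₗ[k] k := augmentation k V ∘ₗ incl B

lemma map_rTensor_comul (t : B.Nichols ⊗[k] B.Nichols) :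
    incl₃ B (LinearMap.rTensor _ (comul B) t) = LinearMap.rTensor _ (deconcat k V) (incl₂ B t) := by
  induction t using TensorProduct.induction_on with
  | zero => simp
  | tmul x y => simp [← incl₂_comul]
  | add x y hx hy => simp only [map_add, hx, hy]

lemma map_lTensor_comul (t : B.Nichols ⊗[k] B.Nichols) :
    TensorProduct.map (incl B) (incl₂ B) (LinearMap.lTensor _ (comul B) t) =
      LinearMap.lTensor _ (deconcat k V) (incl₂ B t) := by
  induction t using TensorProduct.induction_on with
  | zero => simp
  | tmul x y => simp [← incl₂_comul]
  | add x y hx hy => simp only [map_add, hx, hy]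

lemma map_rTensor_counit (t : B.Nichols ⊗[k] B.Nichols) :
    LinearMap.lTensor k (incl B) (LinearMap.rTensor _ (counit B) t) =
      LinearMap.rTensor _ (augmentation k V) (incl₂ B t) := by
  induction t using TensorProduct.induction_on with
  | zero => simp
  | tmul x y => simp [counit]
  | add x y hx hy => simp only [map_add, hx, hy]

lemma map_lTensor_counit (t : B.Nichols ⊗[k] B.Nichols) :
    LinearMap.rTensor k (incl B) (LinearMap.lTensor _ (counit B) t) =
      LinearMap.lTensor _ (augmentation k V) (incl₂ B t) := by
  induction t using TensorProduct.induction_on with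
  | zero => simp
  | tmul x y => simp [counit]
  | add x y hx hy => simp only [map_add, hx, hy]

lemma map_rTensor_mul' (t : (B.Nichols ⊗[k] B.Nichols) ⊗[k] B.Nichols) :
    incl₂ B (LinearMap.rTensor _ (LinearMap.mul' k _) t) =
      LinearMap.rTensor _ B.shuffleMul (incl₃ B t) := by
  induction t using TensorProduct.induction_on with
  | zero => simp
  | tmul x y =>
    rw [LinearMap.rTensor_tmul, TensorProduct.map_tmul, incl_mul', TensorProduct.map_tmul,
      LinearMap.rTensor_tmul]
  | add x y hx hy => simp only [map_add, hx, hy]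

lemma map_lTensor_mul' (t : B.Nichols ⊗[k] (B.Nichols ⊗[k] B.Nichols)) :
    incl₂ B (LinearMap.lTensor _ (LinearMap.mul' k _) t) =
      LinearMap.lTensor _ B.shuffleMul (TensorProduct.map (incl B) (incl₂ B) t) := by
  induction t using TensorProduct.induction_on with
  | zero => simp
  | tmul x y =>
    rw [LinearMap.lTensor_tmul, TensorProduct.map_tmul, incl_mul', TensorProduct.map_tmul,
      LinearMap.lTensor_tmul]
  | add x y hx hy => simp only [map_add, hx, hy]

lemma map_map_mul' (t : (B.Nichols ⊗[k] B.Nichols) ⊗[k] (B.Nichols ⊗[k] B.Nichols)) :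
    incl₂ B (TensorProduct.map (LinearMap.mul' k _) (LinearMap.mul' k _) t) =
      TensorProduct.map B.shuffleMul B.shuffleMul (TensorProduct.map (incl₂ B) (incl₂ B) t) := by
  induction t using TensorProduct.induction_on with
  | zero => simp
  | tmul x y =>
    rw [TensorProduct.map_tmul, TensorProduct.map_tmul, TensorProduct.map_tmul, incl_mul',
      incl_mul', TensorProduct.map_tmul]
  | add x y hx hy => simp only [map_add, hx, hy]

lemma map_map_comul (t : B.Nichols ⊗[k] B.Nichols) :
    TensorProduct.map (incl₂ B) (incl₂ B) (TensorProduct.map (comul B) (comul B) t) =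
      TensorProduct.map (deconcat k V) (deconcat k V) (incl₂ B t) := by
  induction t using TensorProduct.induction_on with
  | zero => simp
  | tmul x y => simp [← incl₂_comul]
  | add x y hx hy => simp only [map_add, hx, hy]

lemma lid_map (t : k ⊗[k] B.Nichols) : incl B (TensorProduct.lid k _ t) =
    TensorProduct.lid k _ (LinearMap.lTensor k (incl B) t) := by
  induction t using TensorProduct.induction_on with
  | zero => simp
  | tmul x y => simp
  | add x y hx hy => simp only [map_add, hx, hy]

lemma rid_map (t : B.Nichols ⊗[k] k) : incl B (TensorProduct.rid k _ t) =
    TensorProduct.rid k _ (LinearMap.rTensor k (incl B) t) := by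
  induction t using TensorProduct.induction_on with
  | zero => simp
  | tmul x y => simp
  | add x y hx hy => simp only [map_add, hx, hy]

noncomputable instance : Coalgebra k B.Nichols where
  comul := comul B
  counit := counit B
  coassoc := by
    refine LinearMap.ext fun x => (TensorProduct.map_injective_of_field (incl_injective B)
      (incl₂_injective B)) ?_
    have := LinearMap.congr_fun (deconcat_coassoc (k := k) (V := V)) (incl B x)
    simp only [LinearMap.comp_apply, LinearEquiv.coe_coe] at this ⊢
    rw [TensorProduct.map_map_assoc, map_rTensor_comul, incl₂_comul, this, map_lTensor_comul,
      incl₂_comul]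
  rTensor_counit_comp_comul := by
    refine LinearMap.ext fun x =>
      (Module.Flat.lTensor_preserves_injective_linearMap (incl B) (incl_injective B)) ?_
    have := LinearMap.congr_fun (rTensor_augmentation_comp_deconcat (k := k) (V := V)) (incl B x)
    rw [LinearMap.comp_apply] at this ⊢
    rw [map_rTensor_counit, incl₂_comul, this]
    rfl
  lTensor_counit_comp_comul := by
    refine LinearMap.ext fun x =>
      (Module.Flat.rTensor_preserves_injective_linearMap (incl B) (incl_injective B)) ?_
    have := LinearMap.congr_fun (lTensor_augmentation_comp_deconcat (k := k) (V := V)) (incl B x)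
    rw [LinearMap.comp_apply] at this ⊢
    rw [map_lTensor_counit, incl₂_comul, this]
    rfl

end Nichols

end Braiding

/-! ### The image is a Nichols algebra -/

namespace Braiding.Nichols

variable {k : Type u} {V : Type v} [Field k] [AddCommGroup V] [Module k V] (B : Braiding k V)

/-- The homogeneous components of the Nichols algebra. -/
noncomputable def grade (n : ℕ) : Submodule k B.Nichols := (homog k V n).comap (incl B)

lemma mem_grade {n : ℕ} {x : B.Nichols} : x ∈ grade B n ↔ incl B x ∈ homog k V n := Iff.rfl

lemma proj_mem_grade {n : ℕ} {x : TensorAlgebra k V} (hx : x ∈ homog k V n) :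
    proj B x ∈ grade B n := B.symmetrize_mem hx

lemma iSup_homog : ⨆ n, homog k V n = ⊤ :=
  (DirectSum.Decomposition.isInternal (homog k V)).submodule_iSup_eq_top

lemma component_symmetrize (n : ℕ) (x : TensorAlgebra k V) :
    GradedAlgebra.proj (homog k V) n (B.symmetrize x) =
      B.symmetrize (GradedAlgebra.proj (homog k V) n x) := by
  refine LinearMap.congr_fun (f := GradedAlgebra.proj (homog k V) n ∘ₗ B.symmetrize)
    (g := B.symmetrize ∘ₗ GradedAlgebra.proj (homog k V) n) ?_ x
  refine linearMap_ext_homog fun m x hx => ?_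
  simp only [LinearMap.comp_apply, GradedAlgebra.proj_apply]
  obtain rfl | h := eq_or_ne m n
  · rw [DirectSum.decompose_of_mem_same _ hx,
      DirectSum.decompose_of_mem_same _ (B.symmetrize_mem hx)]
  · rw [DirectSum.decompose_of_mem_ne _ hx h,
      DirectSum.decompose_of_mem_ne _ (B.symmetrize_mem hx) h, map_zero]

/-- The symmetrizer preserves degrees, so the degree `n` component of any preimage is again a
preimage. -/
lemma exists_of_mem_grade {n : ℕ} {x : B.Nichols} (hx : x ∈ grade B n) :
    ∃ y ∈ homog k V n, proj B y = x := by
  obtain ⟨y, rfl⟩ := proj_surjective B x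
  refine ⟨GradedAlgebra.proj (homog k V) n y, SetLike.coe_mem _, incl_injective B ?_⟩
  rw [incl_proj, ← component_symmetrize, GradedAlgebra.proj_apply]
  exact DirectSum.decompose_of_mem_same _ hx

/-- Independence is inherited from the ambient tensor algebra, spanning from the homogeneous words
that are projected onto the image. -/
lemma isInternal : DirectSum.IsInternal (grade B) := by
  rw [DirectSum.isInternal_submodule_iff_iSupIndep_and_iSup_eq_top]
  constructor
  · have h := (DirectSum.Decomposition.isInternal (homog k V)).submodule_iSupIndep
    rw [iSupIndep_def] at h ⊢
    intro i
    rw [Submodule.disjoint_def]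
    intro x hx hx'
    refine incl_injective B ?_
    rw [map_zero]
    refine (Submodule.disjoint_def.1 (h i)) _ hx ?_
    have h1 := Submodule.mem_map_of_mem (f := incl B) hx'
    simp only [Submodule.map_iSup] at h1
    exact (iSup₂_mono fun j _ => Submodule.map_comap_le _ _) h1
  · rw [eq_top_iff, ← Submodule.map_top (proj B) |>.trans
      (LinearMap.range_eq_top.2 (proj_surjective B)), ← iSup_homog, Submodule.map_iSup]
    refine iSup_mono fun n => ?_
    rintro _ ⟨x, hx, rfl⟩
    exact proj_mem_grade B hx

lemma proj₂_splitAt_mem {a b : ℕ} {w : TensorAlgebra k V} (hw : w ∈ homog k V (a + b)) :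
    proj₂ B (splitAt k V a w) ∈ tensorSubmodule (grade B a) (grade B b) := by
  induction hw using homog_add_induction with
  | mul x hx y hy =>
    rw [splitAt_mul hx, TensorProduct.map_tmul]
    exact tmul_mem_tensorSubmodule (proj_mem_grade B hx) (proj_mem_grade B hy)
  | add x y _ _ hx hy => rw [map_add, map_add]; exact add_mem hx hy

lemma comul_mem (n : ℕ) (x : B.Nichols) (hx : x ∈ grade B n) : Coalgebra.comul (R := k) x ∈
    ⨆ (i : ℕ) (j : ℕ) (_ : i + j = n), tensorSubmodule (grade B i) (grade B j) := by
  obtain ⟨y, hy, rfl⟩ := exists_of_mem_grade B hx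
  have h : ∀ p : ℕ × ℕ, ∃ w, p.1 + p.2 = n → w ∈ homog k V (p.1 + p.2) ∧
      splitAt k V p.1 (B.symmetrize y) =
        TensorProduct.map B.symmetrize B.symmetrize (splitAt k V p.1 w) := by
    intro p
    by_cases hp : p.1 + p.2 = n
    · obtain ⟨w, hw⟩ := B.exists_splitAt_symmetrize (a := p.1) (b := p.2) (w := y) (by rwa [hp])
      exact ⟨w, fun _ => hw⟩
    -- A default value: only pairs of sum `n` matter, but `choose` needs a witness for every pair.
    · exact ⟨0, fun h => absurd h hp⟩
  choose w hw using h
  have : Coalgebra.comul (R := k) (proj B y) = ∑ p ∈ Finset.HasAntidiagonal.antidiagonal n,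
      proj₂ B (splitAt k V p.1 (w p)) := by
    refine incl₂_injective B ?_
    refine (incl₂_comul B _).trans ?_
    rw [incl_proj, deconcat_apply (B.symmetrize_mem hy), map_sum]
    refine Finset.sum_congr rfl fun p hp => ?_
    rw [Finset.HasAntidiagonal.mem_antidiagonal] at hp
    rw [(hw p hp).2, incl₂_proj₂]
  rw [this]
  refine sum_mem fun p hp => ?_
  rw [Finset.HasAntidiagonal.mem_antidiagonal] at hp
  exact Submodule.mem_iSup_of_mem p.1 (Submodule.mem_iSup_of_mem p.2
    (Submodule.mem_iSup_of_mem hp (proj₂_splitAt_mem B (hw p hp).1)))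

lemma eq_smul_one_of_mem_grade_zero {x : B.Nichols} (hx : x ∈ grade B 0) : ∃ a : k, x = a • 1 := by
  obtain ⟨a, ha⟩ := homog_zero_eq hx
  exact ⟨a, incl_injective B (by rw [ha, map_smul, incl_one])⟩

lemma counit_apply (x : B.Nichols) :
    Coalgebra.counit (R := k) x = augmentation k V (incl B x) := rfl

lemma counit_one : Coalgebra.counit (R := k) (1 : B.Nichols) = 1 := by
  rw [counit_apply, incl_one, augmentation_one]

/-- The Nichols algebra of a braided vector space as a braided Hopf algebra. -/
noncomputable def braidedHopfAlgebra : BraidedHopfAlgebra k B.Nichols where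
  c := LinearEquiv.ofBijective (swap B) (swap_bijective B)
  -- This axiom and those below that equate maps into tensor powers are tested after the injective
  -- inclusion of the relevant tensor power, where they become the identities of the shuffle
  -- algebra.
  braid_eq := by
    refine LinearMap.ext fun t => incl₃_injective B ?_
    have h := LinearMap.congr_fun B.tensorSwap_braid (incl₃ B t)
    change incl₃ B (braidLeft (swap B) (braidRight (swap B) (braidLeft (swap B) t))) =
      incl₃ B (braidRight (swap B) (braidLeft (swap B) (braidRight (swap B) t)))
    simp only [map_braidLeft (incl₂_swap B), map_braidRight (incl₂_swap B)]
    exact h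
  mul_left := by
    refine LinearMap.ext fun t => incl₂_injective B ?_
    have h := LinearMap.congr_fun B.tensorSwap_mul_left (incl₃ B t)
    change incl₂ B (swap B (LinearMap.rTensor _ (LinearMap.mul' k _) t)) =
      incl₂ B (LinearMap.lTensor _ (LinearMap.mul' k _) (TensorProduct.assoc k _ _ _
        (braidLeft (swap B) (braidRight (swap B) t))))
    rw [incl₂_swap, map_rTensor_mul', map_lTensor_mul', TensorProduct.map_map_assoc,
      map_braidLeft (incl₂_swap B), map_braidRight (incl₂_swap B)]
    exact h
  mul_right := by
    refine LinearMap.ext fun t => incl₂_injective B ?_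
    have h := LinearMap.congr_fun B.tensorSwap_mul_right (incl₃ B t)
    change incl₂ B (swap B (LinearMap.lTensor _ (LinearMap.mul' k _)
        (TensorProduct.assoc k _ _ _ t))) =
      incl₂ B (LinearMap.rTensor _ (LinearMap.mul' k _)
        (braidRight (swap B) (braidLeft (swap B) t)))
    rw [incl₂_swap, map_rTensor_mul', map_lTensor_mul', TensorProduct.map_map_assoc,
      map_braidRight (incl₂_swap B), map_braidLeft (incl₂_swap B)]
    exact h
  one_left x := incl₂_injective B <| by
    change incl₂ B (swap B (1 ⊗ₜ x)) = _
    rw [incl₂_swap, TensorProduct.map_tmul, TensorProduct.map_tmul, incl_one, tensorSwap_one_left]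
  one_right x := incl₂_injective B <| by
    change incl₂ B (swap B (x ⊗ₜ 1)) = _
    rw [incl₂_swap, TensorProduct.map_tmul, TensorProduct.map_tmul, incl_one, tensorSwap_one_right]
  comul_left := by
    refine LinearMap.ext fun t => incl₃_injective B ?_
    have h := LinearMap.congr_fun B.tensorSwap_comul_left (incl₂ B t)
    change incl₃ B ((TensorProduct.assoc k _ _ _).symm (LinearMap.lTensor _ (comul B)
      (swap B t))) = incl₃ B (braidLeft (swap B) (braidRight (swap B)
        (LinearMap.rTensor _ (comul B) t)))
    rw [TensorProduct.map_map_assoc_symm, map_lTensor_comul, incl₂_swap,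
      map_braidLeft (incl₂_swap B), map_braidRight (incl₂_swap B), map_rTensor_comul]
    exact h
  comul_right := by
    refine LinearMap.ext fun t => incl₃_injective B ?_
    have h := LinearMap.congr_fun B.tensorSwap_comul_right (incl₂ B t)
    change incl₃ B (LinearMap.rTensor _ (comul B) (swap B t)) =
      incl₃ B (braidRight (swap B) (braidLeft (swap B)
        ((TensorProduct.assoc k _ _ _).symm (LinearMap.lTensor _ (comul B) t))))
    rw [map_rTensor_comul, incl₂_swap, map_braidRight (incl₂_swap B), map_braidLeft (incl₂_swap B),
      TensorProduct.map_map_assoc_symm, map_lTensor_comul]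
    exact h
  counit_left := by
    refine LinearMap.ext fun t => incl_injective B ?_
    have h := LinearMap.congr_fun B.tensorSwap_counit_left (incl₂ B t)
    change incl B (TensorProduct.rid k _ (LinearMap.lTensor _ (counit B) (swap B t))) =
      incl B (TensorProduct.lid k _ (LinearMap.rTensor _ (counit B) t))
    rw [rid_map, map_lTensor_counit, incl₂_swap, lid_map, map_rTensor_counit]
    exact h
  counit_right := by
    refine LinearMap.ext fun t => incl_injective B ?_
    have h := LinearMap.congr_fun B.tensorSwap_counit_right (incl₂ B t)
    change incl B (TensorProduct.lid k _ (LinearMap.rTensor _ (counit B) (swap B t))) =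
      incl B (TensorProduct.rid k _ (LinearMap.lTensor _ (counit B) t))
    rw [rid_map, map_lTensor_counit, lid_map, map_rTensor_counit, incl₂_swap]
    exact h
  comul_mul := by
    refine LinearMap.ext fun t => incl₂_injective B ?_
    have h := LinearMap.congr_fun B.deconcat_shuffleMul (incl₂ B t)
    change incl₂ B (comul B (LinearMap.mul' k _ t)) =
      incl₂ B (TensorProduct.map (LinearMap.mul' k _) (LinearMap.mul' k _)
        (braidMiddle (swap B) (TensorProduct.map (comul B) (comul B) t)))
    rw [incl₂_comul, incl_mul', map_map_mul', map_braidMiddle (incl₂_swap B), map_map_comul]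
    exact h
  comul_one := incl₂_injective B <| by
    refine (incl₂_comul B 1).trans ?_
    rw [TensorProduct.map_tmul, incl_one, deconcat_one]
  counit_mul x y := by
    rw [counit_apply, incl_mul, augmentation_shuffleMul]
    rfl
  counit_one := counit_one B
  exists_antipode := exists_antipode_of_isInternal (isInternal B) (comul_mem B) fun x hx => by
    obtain ⟨a, rfl⟩ := eq_smul_one_of_mem_grade_zero B hx
    rw [map_smul, counit_one, smul_eq_mul, mul_one, Algebra.algebraMap_eq_smul_one]

/-- Concatenating the `(a, b)` component of the deconcatenation restores the whole component of
degree `a + b`, so a single bidegree of the coproduct already detects it. -/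
lemma mul_component_deconcat (a b : ℕ) (x : TensorAlgebra k V) :
    LinearMap.mul' k _ (TensorProduct.map (GradedAlgebra.proj (homog k V) a)
      (GradedAlgebra.proj (homog k V) b) (deconcat k V x)) =
    GradedAlgebra.proj (homog k V) (a + b) x := by
  refine LinearMap.congr_fun (f := LinearMap.mul' k _ ∘ₗ TensorProduct.map
    (GradedAlgebra.proj (homog k V) a) (GradedAlgebra.proj (homog k V) b) ∘ₗ deconcat k V)
    (g := GradedAlgebra.proj (homog k V) (a + b)) ?_ x
  refine linearMap_ext_homog fun n x hx => ?_
  have key : ∀ i j : ℕ, ∀ w ∈ homog k V (i + j), LinearMap.mul' k _ (TensorProduct.map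
      (GradedAlgebra.proj (homog k V) a) (GradedAlgebra.proj (homog k V) b) (splitAt k V i w)) =
        if i = a ∧ j = b then w else 0 := by
    intro i j w hw
    induction hw using homog_add_induction with
    | mul x hx y hy =>
      rw [splitAt_mul hx, TensorProduct.map_tmul, LinearMap.mul'_apply, GradedAlgebra.proj_apply,
        GradedAlgebra.proj_apply]
      split_ifs with h
      · obtain ⟨rfl, rfl⟩ := h
        rw [DirectSum.decompose_of_mem_same _ hx, DirectSum.decompose_of_mem_same _ hy]
      · by_cases h1 : i = a
        · rw [DirectSum.decompose_of_mem_ne _ hy fun h2 => h ⟨h1, h2⟩, mul_zero]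
        · rw [DirectSum.decompose_of_mem_ne _ hx h1, zero_mul]
    | add x y _ _ hx hy =>
      rw [map_add, map_add, map_add, hx, hy]
      split_ifs <;> simp
  rw [LinearMap.comp_apply, LinearMap.comp_apply, deconcat_apply hx, map_sum, map_sum,
    GradedAlgebra.proj_apply]
  have h1 : ∀ p ∈ Finset.HasAntidiagonal.antidiagonal n, LinearMap.mul' k _ (TensorProduct.map
      (GradedAlgebra.proj (homog k V) a) (GradedAlgebra.proj (homog k V) b)
      (splitAt k V p.1 x)) = if p = (a, b) then x else 0 := by
    intro p hp
    rw [Finset.HasAntidiagonal.mem_antidiagonal] at hp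
    rw [key p.1 p.2 x (by rwa [hp])]
    simp only [Prod.ext_iff]
  rw [Finset.sum_congr rfl h1, Finset.sum_ite_eq']
  simp only [Finset.HasAntidiagonal.mem_antidiagonal]
  split_ifs with h
  · subst h
    rw [DirectSum.decompose_of_mem_same _ hx]
  · rw [DirectSum.decompose_of_mem_ne _ hx (Ne.symm h)]

lemma deconcat_ι (v : V) : deconcat k V (ι k v) = ι k v ⊗ₜ 1 + 1 ⊗ₜ ι k v := by
  rw [deconcat_apply (ι_mem_homog v), Finset.Nat.sum_antidiagonal_eq_sum_range_succ_mk,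
    Finset.sum_range_succ, Finset.sum_range_one, splitAt_zero, splitAt_self (ι_mem_homog v),
    add_comm]

/-- For primitive `x` the bidegree `(1, n + 1)` of the coproduct is zero, which kills the component
of degree `n + 2`; bidegree `(0, 0)` says that the degree zero component equals twice itself. -/
lemma mem_homog_one_of_primitive {x : TensorAlgebra k V}
    (hx : deconcat k V x = x ⊗ₜ 1 + 1 ⊗ₜ x) : x ∈ homog k V 1 := by
  classical
  have hne : ∀ n, n ≠ 1 → GradedAlgebra.proj (homog k V) n x = 0 := by
    have h1 : ∀ n, n ≠ 0 → GradedAlgebra.proj (homog k V) n (1 : TensorAlgebra k V) = 0 :=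
      fun n hn => DirectSum.decompose_of_mem_ne _ one_mem_homog hn.symm
    have h0 : GradedAlgebra.proj (homog k V) 0 (1 : TensorAlgebra k V) = 1 :=
      DirectSum.decompose_of_mem_same _ one_mem_homog
    intro n hn
    obtain _ | _ | n := n
    · have h := mul_component_deconcat 0 0 x
      rw [hx, map_add, map_add, TensorProduct.map_tmul, TensorProduct.map_tmul,
        LinearMap.mul'_apply, LinearMap.mul'_apply, h0, one_mul, mul_one] at h
      simpa using h
    · exact absurd rfl hn
    · have h := mul_component_deconcat 1 (n + 1) x
      rw [hx, map_add, map_add, TensorProduct.map_tmul, TensorProduct.map_tmul,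
        LinearMap.mul'_apply, LinearMap.mul'_apply, h1 1 one_ne_zero, h1 (n + 1) (by omega),
        zero_mul, mul_zero, add_zero] at h
      rw [show n + 1 + 1 = 1 + (n + 1) by omega, ← h]
  have : x = GradedAlgebra.proj (homog k V) 1 x := by
    conv_lhs => rw [← DirectSum.sum_support_decompose (homog k V) x]
    rw [Finset.sum_eq_single 1]
    · rfl
    · exact fun n _ hn => hne n hn
    · intro h
      simpa using h
  rw [this]
  exact SetLike.coe_mem _

theorem isNicholsAlgebra : IsNicholsAlgebra B (braidedHopfAlgebra B) (grade B) (proj B ∘ₗ ι k) where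
  isInternal := isInternal B
  mul_mem i j x y hx hy := B.shuffleMul_mem hx hy
  comul_mem := comul_mem B
  counit_eq_zero n x hn hx := augmentation_of_pos hn hx
  braiding_mem i j t ht := by
    have : tensorSubmodule (grade B i) (grade B j) ≤
        (tensorSubmodule (grade B j) (grade B i)).comap (swap B) := by
      refine tensorSubmodule_le.2 fun x hx y hy => ?_
      obtain ⟨x, hx', rfl⟩ := exists_of_mem_grade B hx
      obtain ⟨y, hy', rfl⟩ := exists_of_mem_grade B hy
      have hw := mul_mem_homog hx' hy'
      rw [Submodule.mem_comap, ← TensorProduct.map_tmul, swap_proj₂, ← splitAt_mul hx',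
        B.tensorSwap_splitAt hw]
      refine proj₂_splitAt_mem B ?_
      rw [add_comm]
      exact B.strands_apply_mem (B.braidShift.swap_mem_strands i j) le_rfl hw
    exact this ht
  degree_zero := by
    ext x
    refine ⟨fun hx => ?_, ?_⟩
    · obtain ⟨a, rfl⟩ := eq_smul_one_of_mem_grade_zero B hx
      exact ⟨a, Algebra.algebraMap_eq_smul_one a⟩
    · rintro ⟨a, rfl⟩
      rw [Algebra.linearMap_apply, Algebra.algebraMap_eq_smul_one]
      refine Submodule.smul_mem _ _ ?_
      rw [mem_grade, incl_one]
      exact one_mem_homog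
  injective v w h := by
    have h := congrArg (incl B) h
    simp only [LinearMap.comp_apply, incl_proj, symmetrize_ι] at h
    exact ι_leftInverse.injective h
  range_eq := by
    ext x
    constructor
    · rintro ⟨v, rfl⟩
      exact proj_mem_grade B (ι_mem_homog v)
    · intro hx
      obtain ⟨v, hv⟩ : incl B x ∈ LinearMap.range (ι k : V →ₗ[k] TensorAlgebra k V) := by
        rw [mem_grade, homog, pow_one] at hx
        exact hx
      exact ⟨v, incl_injective B (by rw [← hv, LinearMap.comp_apply, incl_proj, symmetrize_ι])⟩
  braiding_eq t := by
    rw [TensorProduct.map_comp, LinearMap.comp_apply, LinearMap.comp_apply]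
    refine (swap_proj₂ B _).trans (congrArg _ ?_)
    refine LinearMap.congr_fun (f := B.tensorSwap ∘ₗ TensorProduct.map (ι k) (ι k))
      (g := TensorProduct.map (ι k) (ι k) ∘ₗ B.c.toLinearMap) (TensorProduct.ext' fun v w => ?_) t
    have hw := mul_mem_homog (ι_mem_homog (k := k) v) (ι_mem_homog w)
    have h : ∀ t : V ⊗[k] V, splitAt k V 1 (pair k V t) =
        TensorProduct.map (ι k) (ι k) t := by
      intro t
      induction t using TensorProduct.induction_on with
      | zero => simp
      | tmul v w => rw [pair_tmul, splitAt_mul (ι_mem_homog v), TensorProduct.map_tmul]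
      | add x y hx hy => simp only [map_add, hx, hy]
    rw [LinearMap.comp_apply, LinearMap.comp_apply, TensorProduct.map_tmul,
      ← splitAt_mul (ι_mem_homog v), B.tensorSwap_splitAt hw, BraidShift.swap_one_one, ← h]
    have h2 := crossing_pair B.c.toLinearMap (v ⊗ₜ w) 1
    rw [mul_one, mul_one, pair_tmul] at h2
    exact congrArg _ h2
  primitive_iff x := by
    have h : Coalgebra.comul (R := k) x = x ⊗ₜ[k] 1 + 1 ⊗ₜ[k] x ↔
        deconcat k V (incl B x) = incl B x ⊗ₜ 1 + 1 ⊗ₜ incl B x := by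
      rw [← (incl₂_injective B).eq_iff]
      refine Eq.congr (incl₂_comul B x) ?_
      rw [map_add, TensorProduct.map_tmul, TensorProduct.map_tmul, incl_one]
    rw [h]
    refine ⟨mem_homog_one_of_primitive, fun hx => ?_⟩
    rw [mem_grade, homog, pow_one] at hx
    obtain ⟨v, hv⟩ := hx
    rw [← hv, deconcat_ι]
  adjoin_eq := by
    rw [eq_top_iff]
    intro x _
    obtain ⟨x, rfl⟩ := proj_surjective B x
    induction x using induction_cons with
    | one => rw [proj_one]; exact one_mem _
    | smul a x hx => rw [map_smul]; exact Subalgebra.smul_mem _ (hx trivial) a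
    | add x y hx hy => rw [map_add]; exact add_mem (hx trivial) (hy trivial)
    | cons v x hx =>
      rw [proj_mul]
      exact mul_mem (Algebra.subset_adjoin (proj_mem_grade B (ι_mem_homog v))) (hx trivial)

end Braiding.Nichols

/-! ### Contracting tensors with functionals -/

section Functionals

variable {k : Type u} {M : Type v} {N : Type w} [Field k] [AddCommGroup M] [Module k M]
  [AddCommGroup N] [Module k N]

/-- Applies a functional to the left tensor factor. -/
def evalLeft (φ : Module.Dual k M) : M ⊗[k] N →ₗ[k] N :=
  (TensorProduct.lid k N).toLinearMap ∘ₗ LinearMap.rTensor N φ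

/-- Applies a functional to the right tensor factor. -/
def evalRight (ψ : Module.Dual k N) : M ⊗[k] N →ₗ[k] M :=
  (TensorProduct.rid k M).toLinearMap ∘ₗ LinearMap.lTensor M ψ

@[simp] lemma evalLeft_tmul (φ : Module.Dual k M) (x : M) (y : N) :
    evalLeft φ (x ⊗ₜ y) = φ x • y := by simp [evalLeft]

@[simp] lemma evalRight_tmul (ψ : Module.Dual k N) (x : M) (y : N) :
    evalRight ψ (x ⊗ₜ y) = ψ y • x := by simp [evalRight]

lemma eq_zero_of_evalLeft {t : M ⊗[k] N} (h : ∀ φ : Module.Dual k M, evalLeft φ t = 0) :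
    t = 0 := by
  classical
  rw [← (TensorProduct.equivFinsuppOfBasisLeft (Module.Basis.ofVectorSpace k M)).map_eq_zero_iff]
  ext i
  rw [TensorProduct.equivFinsuppOfBasisLeft_apply]
  exact h _

lemma eq_zero_of_evalRight {t : M ⊗[k] N}
    (h : ∀ ψ : Module.Dual k N, evalRight ψ t = 0) : t = 0 := by
  classical
  rw [← (TensorProduct.equivFinsuppOfBasisRight (Module.Basis.ofVectorSpace k N)).map_eq_zero_iff]
  ext i
  rw [TensorProduct.equivFinsuppOfBasisRight_apply]
  exact h _

lemma map_evalRight {M' : Type*} [AddCommGroup M'] [Module k M'] (f : M →ₗ[k] M')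
    (ψ : Module.Dual k N) (t : M ⊗[k] N) :
    evalRight ψ (LinearMap.rTensor N f t) = f (evalRight ψ t) := by
  induction t using TensorProduct.induction_on with
  | zero => simp
  | tmul x y => simp
  | add x y hx hy => simp only [map_add, hx, hy]

end Functionals

/-! ### The braided derivation of a Nichols algebra -/

namespace IsNicholsAlgebra

variable {k : Type u} {V : Type v} {R : Type w} [Field k] [AddCommGroup V]
    [Module k V] [Ring R] [Algebra k R] [Coalgebra k R] {B : Braiding k V}
    {H : BraidedHopfAlgebra k R} {𝒜 : ℕ → Submodule k R} {ι : V →ₗ[k] R}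

section

lemma ι_mem (h : IsNicholsAlgebra B H 𝒜 ι) (v : V) : ι v ∈ 𝒜 1 :=
  h.range_eq ▸ LinearMap.mem_range_self ι v

lemma one_mem (h : IsNicholsAlgebra B H 𝒜 ι) : (1 : R) ∈ 𝒜 0 :=
  h.degree_zero ▸ ⟨1, map_one (algebraMap k R)⟩

lemma exists_smul_one (h : IsNicholsAlgebra B H 𝒜 ι) {x : R} (hx : x ∈ 𝒜 0) :
    ∃ a : k, x = a • 1 := by
  rw [h.degree_zero] at hx
  obtain ⟨a, rfl⟩ := hx
  exact ⟨a, Algebra.algebraMap_eq_smul_one a⟩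

lemma comul_ι (h : IsNicholsAlgebra B H 𝒜 ι) (v : V) :
    Coalgebra.comul (R := k) (ι v) = ι v ⊗ₜ 1 + 1 ⊗ₜ ι v :=
  (h.primitive_iff _).2 (h.ι_mem v)

lemma exists_degreeOne (h : IsNicholsAlgebra B H 𝒜 ι) :
    ∃ p : R →ₗ[k] V, (∀ v, p (ι v) = v) ∧ ∀ n ≠ 1, ∀ x ∈ 𝒜 n, p x = 0 := by
  obtain ⟨g, hg⟩ := LinearMap.exists_leftInverse_of_injective ι (LinearMap.ker_eq_bot.2 h.injective)
  obtain ⟨p, hp⟩ := exists_linearMap_of_isInternal h.isInternal fun n => if n = 1 then g else 0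
  refine ⟨p, fun v => ?_, fun n hn x hx => ?_⟩
  · rw [hp 1 _ (h.ι_mem v), if_pos rfl]
    exact LinearMap.congr_fun hg v
  · rw [hp n x hx, if_neg hn]
    rfl

/-- The braiding exchanges degrees, so the second leg of `c (v ⊗ x)` is a vector; the Leibniz rule
uses this to evaluate `degreeOne` on a product. -/
lemma c_ι_mem (h : IsNicholsAlgebra B H 𝒜 ι) (v : V) (x : R) :
    H.c (ι v ⊗ₜ x) ∈ tensorSubmodule ⊤ (𝒜 1) := by
  have : ⊤ ≤ (tensorSubmodule ⊤ (𝒜 1)).comap (H.c.toLinearMap ∘ₗ TensorProduct.mk k R R (ι v)) := by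
    refine h.isInternal.submodule_iSup_eq_top.ge.trans ?_
    refine iSup_le fun n x hx => ?_
    have hle : tensorSubmodule (𝒜 n) (𝒜 1) ≤ tensorSubmodule ⊤ (𝒜 1) :=
      tensorSubmodule_le.2 fun x _ y hy => tmul_mem_tensorSubmodule trivial hy
    exact hle (h.braiding_mem 1 n _ (tmul_mem_tensorSubmodule (h.ι_mem v) hx))
  exact this trivial

variable (h : IsNicholsAlgebra B H 𝒜 ι)

/-- The projection onto the degree one component. -/
noncomputable def degreeOne : R →ₗ[k] V := Classical.choose h.exists_degreeOne

lemma degreeOne_ι (v : V) : h.degreeOne (ι v) = v :=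
  (Classical.choose_spec h.exists_degreeOne).1 v

lemma degreeOne_of_mem {n : ℕ} (hn : n ≠ 1) {x : R} (hx : x ∈ 𝒜 n) : h.degreeOne x = 0 :=
  (Classical.choose_spec h.exists_degreeOne).2 n hn x hx

/-- The component of the coproduct in `R ⊗ V`, a universal braided derivation. -/
noncomputable def derivation : R →ₗ[k] R ⊗[k] V :=
  LinearMap.lTensor R h.degreeOne ∘ₗ Coalgebra.comul

lemma derivation_one : h.derivation 1 = 0 := by
  rw [derivation, LinearMap.comp_apply, H.comul_one, LinearMap.lTensor_tmul,
    h.degreeOne_of_mem zero_ne_one h.one_mem, TensorProduct.tmul_zero]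

lemma degreeOne_ι_mul (v : V) (x : R) :
    h.degreeOne (ι v * x) = Coalgebra.counit (R := k) x • v := by
  refine LinearMap.congr_fun (f := h.degreeOne ∘ₗ LinearMap.mulLeft k (ι v))
    (g := LinearMap.toSpanSingleton k V v ∘ₗ Coalgebra.counit)
    (linearMap_ext_of_isInternal h.isInternal fun n x hx => ?_) x
  simp only [LinearMap.comp_apply, LinearMap.mulLeft_apply, LinearMap.toSpanSingleton_apply]
  obtain rfl | hn := eq_or_ne n 0
  · obtain ⟨a, rfl⟩ := h.exists_smul_one hx
    rw [mul_smul_comm, mul_one, map_smul, h.degreeOne_ι, map_smul, H.counit_one, smul_eq_mul,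
      mul_one]
  · rw [h.degreeOne_of_mem (by omega) (h.mul_mem 1 n _ _ (h.ι_mem v) hx),
      h.counit_eq_zero n x hn hx, zero_smul]

/-- Expand the coproduct of `v x` with `Δ v = v ⊗ 1 + 1 ⊗ v`. The first term multiplies `∂ x` by
`v`. In the second, `c` puts a vector `w` in front of the second leg of `Δ x`, and `degreeOne (w b)
= ε(b) w` collapses that leg to its counit. -/
lemma derivation_ι_mul (v : V) (x : R) : h.derivation (ι v * x) =
    LinearMap.rTensor V (LinearMap.mulLeft k (ι v)) (h.derivation x) +
      LinearMap.lTensor R h.degreeOne (H.c (ι v ⊗ₜ x)) := by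
  have h1 : ∀ t : R ⊗[k] R, TensorProduct.map (LinearMap.mul' k R) (LinearMap.mul' k R)
      (braidMiddle H.c.toLinearMap ((ι v ⊗ₜ 1) ⊗ₜ t)) =
        LinearMap.rTensor R (LinearMap.mulLeft k (ι v)) t := by
    intro t
    induction t using TensorProduct.induction_on with
    | zero => simp
    | tmul a b => simp [braidMiddle, H.one_left]
    | add x y hx hy => simp only [TensorProduct.tmul_add, map_add, hx, hy]
  have h2 : ∀ t : R ⊗[k] R, LinearMap.lTensor R h.degreeOne
      (TensorProduct.map (LinearMap.mul' k R) (LinearMap.mul' k R)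
        (braidMiddle H.c.toLinearMap ((1 ⊗ₜ ι v) ⊗ₜ t))) =
      LinearMap.lTensor R h.degreeOne (H.c (ι v ⊗ₜ TensorProduct.rid k R
        (LinearMap.lTensor R (Coalgebra.counit (R := k)) t))) := by
    intro t
    induction t using TensorProduct.induction_on with
    | zero => simp
    | add x y hx hy => simp only [TensorProduct.tmul_add, map_add, hx, hy]
    | tmul a b =>
      have h3 : tensorSubmodule ⊤ (𝒜 1) ≤ LinearMap.eqLocus
          (LinearMap.lTensor R h.degreeOne ∘ₗ LinearMap.lTensor R (LinearMap.mul' k R) ∘ₗ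
            (TensorProduct.assoc k R R R).toLinearMap ∘ₗ (TensorProduct.mk k (R ⊗[k] R) R).flip b)
          (Coalgebra.counit (R := k) b • LinearMap.lTensor R h.degreeOne) := by
        refine tensorSubmodule_le.2 fun x _ y hy => ?_
        obtain ⟨w, rfl⟩ : y ∈ LinearMap.range ι := by rwa [h.range_eq]
        simp [LinearMap.mem_eqLocus, h.degreeOne_ι_mul, h.degreeOne_ι]
      have h4 := h3 (h.c_ι_mem v a)
      rw [LinearMap.mem_eqLocus] at h4
      have h5 : ∀ s : R ⊗[k] R, TensorProduct.map (LinearMap.mul' k R) (LinearMap.mul' k R)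
          ((TensorProduct.assoc k R R (R ⊗[k] R)).symm
            (1 ⊗ₜ TensorProduct.assoc k R R R (s ⊗ₜ b))) =
          LinearMap.lTensor R (LinearMap.mul' k R) (TensorProduct.assoc k R R R (s ⊗ₜ b)) := by
        intro s
        induction s using TensorProduct.induction_on with
        | zero => simp
        | tmul x y => simp
        | add x y hx hy => simp only [TensorProduct.tmul_add, TensorProduct.add_tmul, map_add, hx, hy]
      have h6 : braidMiddle H.c.toLinearMap ((1 ⊗ₜ ι v) ⊗ₜ (a ⊗ₜ b)) =
          (TensorProduct.assoc k R R (R ⊗[k] R)).symm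
            (1 ⊗ₜ TensorProduct.assoc k R R R (H.c (ι v ⊗ₜ a) ⊗ₜ b)) := rfl
      rw [h6, h5]
      refine h4.trans ?_
      simp
  have h3 := LinearMap.congr_fun H.comul_mul (ι v ⊗ₜ x)
  simp only [LinearMap.comp_apply, LinearMap.mul'_apply, TensorProduct.map_tmul, h.comul_ι,
    TensorProduct.add_tmul, map_add, h1] at h3
  rw [derivation, LinearMap.comp_apply, h3, map_add, h2, Coalgebra.lTensor_counit_comul,
    TensorProduct.rid_tmul, one_smul]
  congr 1
  rw [← LinearMap.comp_apply, LinearMap.lTensor_comp_rTensor, ← LinearMap.rTensor_comp_lTensor]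
  rfl

/-- Coassociativity, projected to degree one in the last leg. It makes the kernel of the derivation
stable under contracting the left leg of the coproduct. -/
lemma lTensor_derivation_comul (x : R) : LinearMap.lTensor R h.derivation
    (Coalgebra.comul (R := k) x) = TensorProduct.assoc k R R V
      (LinearMap.rTensor V (Coalgebra.comul (R := k)) (h.derivation x)) := by
  rw [derivation, LinearMap.lTensor_comp, LinearMap.comp_apply, ← Coalgebra.coassoc_apply,
    LinearMap.comp_apply]
  generalize Coalgebra.comul (R := k) x = t
  induction t using TensorProduct.induction_on with
  | zero => simp
  | add x y hx hy => simp only [map_add, hx, hy]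
  | tmul a b =>
    rw [LinearMap.rTensor_tmul, LinearMap.lTensor_tmul, LinearMap.rTensor_tmul]
    generalize Coalgebra.comul (R := k) a = s
    induction s using TensorProduct.induction_on with
    | zero => simp
    | add x y hx hy => simp only [TensorProduct.add_tmul, map_add, hx, hy]
    | tmul c d => simp

lemma derivation_evalLeft (φ : Module.Dual k R) {x : R} (hx : h.derivation x = 0) :
    h.derivation (evalLeft φ (Coalgebra.comul (R := k) x)) = 0 := by
  have h1 : ∀ t : R ⊗[k] R, h.derivation (evalLeft φ t) =
      evalLeft φ (LinearMap.lTensor R h.derivation t) := by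
    intro t
    induction t using TensorProduct.induction_on with
    | zero => simp
    | tmul x y => simp
    | add x y hx hy => simp only [map_add, hx, hy]
  rw [h1, h.lTensor_derivation_comul, hx, map_zero, map_zero, map_zero]

end

end IsNicholsAlgebra

/-- The elements of degree less than `n`. -/
def degreeLT {k : Type u} {R : Type w} [Field k] [AddCommGroup R] [Module k R]
    (𝒜 : ℕ → Submodule k R) (n : ℕ) : Submodule k R := ⨆ i, ⨆ (_ : i < n), 𝒜 i

lemma degreeLT_le {k : Type u} {R : Type w} [Field k] [AddCommGroup R] [Module k R]
    {𝒜 : ℕ → Submodule k R} {n : ℕ} {S : Submodule k R} :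
    degreeLT 𝒜 n ≤ S ↔ ∀ i < n, 𝒜 i ≤ S := by
  simp only [degreeLT, iSup_le_iff]

lemma le_degreeLT {k : Type u} {R : Type w} [Field k] [AddCommGroup R] [Module k R]
    {𝒜 : ℕ → Submodule k R} {i n : ℕ} (h : i < n) : 𝒜 i ≤ degreeLT 𝒜 n :=
  degreeLT_le.1 le_rfl i h

lemma exists_mem_degreeLT {k : Type u} {R : Type w} [Field k] [AddCommGroup R] [Module k R]
    {𝒜 : ℕ → Submodule k R} (h : ⨆ i, 𝒜 i = ⊤) (x : R) : ∃ n, x ∈ degreeLT 𝒜 n := by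
  have hmono : Monotone (degreeLT 𝒜) := fun m n hmn =>
    degreeLT_le.2 fun i hi => le_degreeLT (hi.trans_le hmn)
  refine Submodule.iSup_induction 𝒜 (motive := fun x => ∃ n, x ∈ degreeLT 𝒜 n)
    (h ▸ Submodule.mem_top : x ∈ ⨆ i, 𝒜 i) (fun i x hx => ⟨i + 1, le_degreeLT i.lt_succ_self hx⟩)
    ⟨0, zero_mem _⟩ ?_
  rintro x y ⟨m, hm⟩ ⟨n, hn⟩
  exact ⟨max m n, add_mem (hmono (le_max_left m n) hm) (hmono (le_max_right m n) hn)⟩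

/-! ### The kernel of the derivation and subspaces stable under it -/

namespace IsNicholsAlgebra

section

variable {k : Type u} {V : Type v} {R : Type w} [Field k] [AddCommGroup V]
    [Module k V] [Ring R] [Algebra k R] [Coalgebra k R] {B : Braiding k V}
    {H : BraidedHopfAlgebra k R} {𝒜 : ℕ → Submodule k R} {ι : V →ₗ[k] R}

lemma counit_evalLeft_comul (φ : Module.Dual k R) (x : R) :
    Coalgebra.counit (R := k) (evalLeft φ (Coalgebra.comul (R := k) x)) = φ x := by
  have h1 : ∀ t : R ⊗[k] R, Coalgebra.counit (R := k) (evalLeft φ t) =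
      φ (TensorProduct.rid k R (LinearMap.lTensor R (Coalgebra.counit (R := k)) t)) := by
    intro t
    induction t using TensorProduct.induction_on with
    | zero => simp
    | tmul x y => simp [mul_comm]
    | add x y hx hy => simp only [map_add, hx, hy]
  rw [h1, Coalgebra.lTensor_counit_comul, TensorProduct.rid_tmul, one_smul]

/-- The part of the coproduct with left leg of degree zero is `1 ⊗ x`, contributing `φ 1 • x`; in
all other terms the right leg has lost degree. -/
lemma evalLeft_comul_mem (h : IsNicholsAlgebra B H 𝒜 ι) (φ : Module.Dual k R) {n : ℕ} {x : R}
    (hx : x ∈ degreeLT 𝒜 (n + 1)) :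
    evalLeft φ (Coalgebra.comul (R := k) x) - φ 1 • x ∈ degreeLT 𝒜 n := by
  -- By the counit axiom `L` sends the coproduct of `x` to the element in question, and `L` can be
  -- tested on pure tensors.
  let L : R ⊗[k] R →ₗ[k] R := evalLeft φ - φ 1 • evalLeft (Coalgebra.counit (R := k))
  have key : degreeLT 𝒜 (n + 1) ≤ (degreeLT 𝒜 n).comap (L ∘ₗ Coalgebra.comul) := by
    refine degreeLT_le.2 fun i hi x hx => ?_
    refine comul_induction h.comul_mem i ((degreeLT 𝒜 n).comap L) x hx fun p q hpq a ha b hb => ?_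
    rw [Submodule.mem_comap]
    obtain rfl | hp := eq_or_ne p 0
    · obtain ⟨r, rfl⟩ := h.exists_smul_one ha
      convert zero_mem (degreeLT 𝒜 n)
      simp [L, H.counit_one, smul_smul, mul_comm]
    · have : L (a ⊗ₜ b) = φ a • b := by
        simp [L, h.counit_eq_zero p a hp ha]
      rw [this]
      exact Submodule.smul_mem _ _ (le_degreeLT (by omega) hb)
  have := key hx
  rw [Submodule.mem_comap] at this
  simpa [L, evalLeft, Coalgebra.rTensor_counit_comul] using this

variable (h : IsNicholsAlgebra B H 𝒜 ι)

lemma derivation_smul_one (a : k) : h.derivation (a • 1) = 0 := by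
  rw [map_smul, h.derivation_one, smul_zero]

/-- The kernel of the derivation consists of the scalars. -/
theorem eq_counit_of_derivation_eq_zero {x : R} (hx : h.derivation x = 0) :
    x = Coalgebra.counit (R := k) x • 1 := by
  obtain ⟨n, hn⟩ := exists_mem_degreeLT h.isInternal.submodule_iSup_eq_top x
  induction n generalizing x with
  | zero =>
    have : x = 0 := by simpa [degreeLT] using hn
    simp [this]
  | succ n ih =>
    obtain ⟨y, hy⟩ : ∃ y, y = x - Coalgebra.counit (R := k) x • 1 := ⟨_, rfl⟩
    have hyn : y ∈ degreeLT 𝒜 (n + 1) := by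
      rw [hy]
      exact sub_mem hn (Submodule.smul_mem _ _ (le_degreeLT n.succ_pos h.one_mem))
    have hyd : h.derivation y = 0 := by rw [hy, map_sub, hx, derivation_smul_one, sub_zero]
    have hyε : Coalgebra.counit (R := k) y = 0 := by
      rw [hy, map_sub, map_smul, H.counit_one, smul_eq_mul, mul_one, sub_self]
    -- For each `φ`, the contraction of `Δ y` by `φ`, minus `φ 1 • y`, has lower degree and is
    -- killed by the derivation. By induction it is a scalar, and its counit is `φ y`. As `φ` varies
    -- this says that `y` is primitive.
    have hprim : Coalgebra.comul (R := k) y = y ⊗ₜ[k] 1 + 1 ⊗ₜ[k] y := by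
      rw [← sub_eq_zero]
      refine eq_zero_of_evalLeft fun φ => ?_
      have h1 := ih (x := evalLeft φ (Coalgebra.comul (R := k) y) - φ 1 • y) (by
        rw [map_sub, map_smul, hyd, smul_zero, sub_zero, h.derivation_evalLeft φ hyd])
        (h.evalLeft_comul_mem φ hyn)
      rw [map_sub, map_smul, hyε, smul_zero, sub_zero, counit_evalLeft_comul] at h1
      rw [map_sub, map_add, evalLeft_tmul, evalLeft_tmul, ← h1]
      abel
    have hy1 : y ∈ LinearMap.range ι := by
      rw [h.range_eq]
      exact (h.primitive_iff y).1 hprim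
    obtain ⟨v, rfl⟩ := hy1
    -- A primitive element is a vector, and the derivation is injective on vectors, so `y` vanishes.
    have hv : h.derivation (ι v) = 1 ⊗ₜ v := by
      rw [derivation, LinearMap.comp_apply, h.comul_ι, map_add, LinearMap.lTensor_tmul,
        LinearMap.lTensor_tmul, h.degreeOne_of_mem zero_ne_one h.one_mem, h.degreeOne_ι,
        TensorProduct.tmul_zero, zero_add]
    rw [hv] at hyd
    have hv0 : v = 0 := by
      simpa [H.counit_one] using congrArg (evalLeft (Coalgebra.counit (R := k))) hyd
    rw [hv0, map_zero] at hy
    exact (sub_eq_zero.1 hy.symm)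

lemma evalRight_derivation_mem (ψ : Module.Dual k V) {n : ℕ} {x : R}
    (hx : x ∈ degreeLT 𝒜 (n + 1)) : evalRight ψ (h.derivation x) ∈ degreeLT 𝒜 n := by
  have key : degreeLT 𝒜 (n + 1) ≤ (degreeLT 𝒜 n).comap (evalRight ψ ∘ₗ h.derivation) := by
    refine degreeLT_le.2 fun i hi x hx => ?_
    refine comul_induction h.comul_mem i ((degreeLT 𝒜 n).comap (evalRight ψ ∘ₗ
      LinearMap.lTensor R h.degreeOne)) x hx fun p q hpq a ha b hb => ?_
    rw [Submodule.mem_comap, LinearMap.comp_apply, LinearMap.lTensor_tmul, evalRight_tmul]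
    obtain rfl | hq := eq_or_ne q 1
    · exact Submodule.smul_mem _ _ (le_degreeLT (by omega) ha)
    · rw [h.degreeOne_of_mem hq hb, map_zero, zero_smul]
      exact zero_mem _
  exact key hx

/-- A subspace of the augmentation ideal that is stable under the derivation is zero. -/
theorem eq_bot_of_derivation_stable {K : Submodule k R}
    (hε : ∀ x ∈ K, Coalgebra.counit (R := k) x = 0)
    (hK : ∀ x ∈ K, ∀ ψ : Module.Dual k V, evalRight ψ (h.derivation x) ∈ K) : K = ⊥ := by
  have key : ∀ n, ∀ x ∈ K, x ∈ degreeLT 𝒜 n → x = 0 := by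
    intro n
    induction n with
    | zero => intro x _ hx; simpa [degreeLT] using hx
    | succ n ih =>
      intro x hxK hx
      -- All contracted derivatives of `x` lie in `K` in lower degree, hence vanish by induction; so
      -- `x` is the scalar `ε(x)`, which is zero on `K`.
      rw [h.eq_counit_of_derivation_eq_zero (eq_zero_of_evalRight fun ψ =>
        ih _ (hK x hxK ψ) (h.evalRight_derivation_mem ψ hx)), hε x hxK, zero_smul]
  rw [eq_bot_iff]
  intro x hx
  obtain ⟨n, hn⟩ := exists_mem_degreeLT h.isInternal.submodule_iSup_eq_top x
  exact key n x hx hn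

end

end IsNicholsAlgebra

/-! ### Lifting braiding and counit to the tensor algebra -/

namespace IsNicholsAlgebra

section Lift

variable {k : Type u} {V : Type v} {R : Type w} [Field k] [AddCommGroup V]
    [Module k V] [Ring R] [Algebra k R] [Coalgebra k R] {B : Braiding k V}
    {H : BraidedHopfAlgebra k R} {𝒜 : ℕ → Submodule k R} {ι : V →ₗ[k] R}

/-- Given the braiding of vectors with a tensor `t`, the braiding of vectors with `w * t`, as a
function of the braiding of the vector with `w`. -/
def braidCons (U : V →ₗ[k] TensorAlgebra k V ⊗[k] V) : V ⊗[k] V →ₗ[k] TensorAlgebra k V ⊗[k] V :=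
  LinearMap.rTensor V (cons k V) ∘ₗ (TensorProduct.assoc k V (TensorAlgebra k V) V).symm.toLinearMap
    ∘ₗ LinearMap.lTensor V U

lemma map_braidCons (h : IsNicholsAlgebra B H 𝒜 ι) {t : TensorAlgebra k V}
    {U : V →ₗ[k] TensorAlgebra k V ⊗[k] V}
    (hU : ∀ v, TensorProduct.map (lift k ι).toLinearMap ι (U v) = H.c (ι v ⊗ₜ lift k ι t))
    (v w : V) : TensorProduct.map (lift k ι).toLinearMap ι (braidCons U (B.c (v ⊗ₜ w))) =
      H.c (ι v ⊗ₜ lift k ι (TensorAlgebra.ι k w * t)) := by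
  have h1 := LinearMap.congr_fun H.mul_right ((ι v ⊗ₜ ι w) ⊗ₜ lift k ι t)
  have h2 : H.c (ι v ⊗ₜ ι w) = TensorProduct.map ι ι (B.c (v ⊗ₜ w)) := h.braiding_eq (v ⊗ₜ w)
  simp only [LinearMap.comp_apply, LinearEquiv.coe_coe, TensorProduct.assoc_tmul,
    LinearMap.lTensor_tmul, LinearMap.mul'_apply, braidLeft, LinearMap.rTensor_tmul, h2] at h1
  rw [map_mul, lift_ι_apply, h1]
  generalize B.c (v ⊗ₜ w) = s
  induction s using TensorProduct.induction_on with
  | zero => simp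
  | add x y hx hy => simp only [TensorProduct.add_tmul, map_add, hx, hy]
  | tmul a b =>
    simp only [braidCons, braidRight, LinearMap.comp_apply, LinearEquiv.coe_coe,
      TensorProduct.assoc_tmul, TensorProduct.map_tmul, LinearMap.lTensor_tmul, ← hU]
    generalize U b = y
    induction y using TensorProduct.induction_on with
    | zero => simp
    | add x y hx hy => simp only [TensorProduct.tmul_add, map_add, hx, hy]
    | tmul x y => simp

/-- The right side does not depend on the Nichols algebra, so the counits of any two pull back to
the same functional on `T(V)`. -/
lemma counit_lift (h : IsNicholsAlgebra B H 𝒜 ι) (t : TensorAlgebra k V) :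
    Coalgebra.counit (R := k) (lift k ι t) = augmentation k V t := by
  induction t using induction_cons with
  | one => simp [H.counit_one]
  | smul a x hx => rw [map_smul, map_smul, map_smul, hx]
  | add x y hx hy => simp only [map_add, hx, hy]
  | cons v x hx =>
    rw [map_mul, lift_ι_apply, H.counit_mul, h.counit_eq_zero 1 _ one_ne_zero (h.ι_mem v), zero_mul,
      augmentation_cons]

lemma lift_surjective (h : IsNicholsAlgebra B H 𝒜 ι) : Function.Surjective (lift k ι) := by
  rw [← AlgHom.range_eq_top, TensorAlgebra.range_lift, ← LinearMap.coe_range, h.range_eq,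
    h.adjoin_eq]

end Lift

/-! ### Uniqueness: comparing two Nichols algebras -/

section Comparison

variable {k : Type u} {V : Type v} {R : Type w} {R' : Type*} [Field k] [AddCommGroup V]
    [Module k V] [Ring R] [Algebra k R] [Coalgebra k R] {B : Braiding k V}
    {H : BraidedHopfAlgebra k R} {𝒜 : ℕ → Submodule k R} {ι : V →ₗ[k] R}
    [Ring R'] [Algebra k R'] [Coalgebra k R']
    {H' : BraidedHopfAlgebra k R'} {𝒜' : ℕ → Submodule k R'} {ι' : V →ₗ[k] R'}

/-- The braiding of a vector with a tensor lifts to the tensor algebra, in the same way for all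
Nichols algebras. -/
lemma exists_lift_c (h : IsNicholsAlgebra B H 𝒜 ι) (h' : IsNicholsAlgebra B H' 𝒜' ι')
    (t : TensorAlgebra k V) : ∃ U : V →ₗ[k] TensorAlgebra k V ⊗[k] V,
      (∀ v, TensorProduct.map (lift k ι).toLinearMap ι (U v) = H.c (ι v ⊗ₜ lift k ι t)) ∧
      ∀ v, TensorProduct.map (lift k ι').toLinearMap ι' (U v) = H'.c (ι' v ⊗ₜ lift k ι' t) := by
  induction t using induction_cons with
  | one =>
    exact ⟨TensorProduct.mk k _ _ 1, fun v => by simp [H.one_right],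
      fun v => by simp [H'.one_right]⟩
  | smul a x hx =>
    obtain ⟨U, hU, hU'⟩ := hx
    exact ⟨a • U, fun v => by simp [hU], fun v => by simp [hU']⟩
  | add x y hx hy =>
    obtain ⟨U, hU, hU'⟩ := hx
    obtain ⟨W, hW, hW'⟩ := hy
    exact ⟨U + W, fun v => by simp [hU, hW, TensorProduct.tmul_add],
      fun v => by simp [hU', hW', TensorProduct.tmul_add]⟩
  | cons w x hx =>
    obtain ⟨U, hU, hU'⟩ := hx
    exact ⟨braidCons U ∘ₗ B.c.toLinearMap ∘ₗ (TensorProduct.mk k V V).flip w,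
      fun v => h.map_braidCons hU v w, fun v => h'.map_braidCons hU' v w⟩

lemma derivation_lift_cons (h : IsNicholsAlgebra B H 𝒜 ι) {t : TensorAlgebra k V}
    {u y : TensorAlgebra k V ⊗[k] V} {v : V}
    (hu : LinearMap.rTensor V (lift k ι).toLinearMap u = h.derivation (lift k ι t))
    (hy : TensorProduct.map (lift k ι).toLinearMap ι y = H.c (ι v ⊗ₜ lift k ι t)) :
    LinearMap.rTensor V (lift k ι).toLinearMap
        (LinearMap.rTensor V (LinearMap.mulLeft k (TensorAlgebra.ι k v)) u + y) =
      h.derivation (lift k ι (TensorAlgebra.ι k v * t)) := by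
  rw [map_mul, lift_ι_apply, h.derivation_ι_mul, ← hu, ← hy, map_add]
  congr 1
  · rw [← LinearMap.comp_apply, ← LinearMap.comp_apply, ← LinearMap.rTensor_comp,
      ← LinearMap.rTensor_comp]
    congr 2
    ext x
    simp
  · clear hy
    induction y using TensorProduct.induction_on with
    | zero => simp
    | add x y hx hy => simp only [map_add, hx, hy]
    | tmul a b => simp [h.degreeOne_ι]

/-- The Leibniz rule computes the derivation letter by letter from `c` alone. One common lift `u`
for each tensor `t` is enough, so the lifts need not be assembled into a linear map. -/
lemma exists_lift_derivation (h : IsNicholsAlgebra B H 𝒜 ι) (h' : IsNicholsAlgebra B H' 𝒜' ι')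
    (t : TensorAlgebra k V) : ∃ u : TensorAlgebra k V ⊗[k] V,
      LinearMap.rTensor V (lift k ι).toLinearMap u = h.derivation (lift k ι t) ∧
      LinearMap.rTensor V (lift k ι').toLinearMap u = h'.derivation (lift k ι' t) := by
  induction t using induction_cons with
  | one => exact ⟨0, by simp [h.derivation_one], by simp [h'.derivation_one]⟩
  | smul a x hx =>
    obtain ⟨u, hu, hu'⟩ := hx
    exact ⟨a • u, by simp [hu], by simp [hu']⟩
  | add x y hx hy =>
    obtain ⟨u, hu, hu'⟩ := hx
    obtain ⟨w, hw, hw'⟩ := hy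
    exact ⟨u + w, by simp [hu, hw], by simp [hu', hw']⟩
  | cons v x hx =>
    obtain ⟨u, hu, hu'⟩ := hx
    obtain ⟨U, hU, hU'⟩ := exists_lift_c h h' x
    exact ⟨_, h.derivation_lift_cons hu (hU v), h'.derivation_lift_cons hu' (hU' v)⟩

/-- The image in `R'` of the first kernel is killed by the counit and, by the common lift, stable
under the derivation of `R'`; such a subspace is zero. -/
lemma ker_lift_le (h : IsNicholsAlgebra B H 𝒜 ι) (h' : IsNicholsAlgebra B H' 𝒜' ι') :
    LinearMap.ker (lift k ι).toLinearMap ≤ LinearMap.ker (lift k ι').toLinearMap := by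
  rw [LinearMap.le_ker_iff_map]
  refine h'.eq_bot_of_derivation_stable ?_ ?_
  · rintro _ ⟨t, ht, rfl⟩
    change Coalgebra.counit (R := k) (lift k ι' t) = 0
    rw [h'.counit_lift, ← h.counit_lift]
    exact (congrArg _ ht).trans (map_zero _)
  · rintro _ ⟨t, ht, rfl⟩ ψ
    obtain ⟨u, hu, hu'⟩ := exists_lift_derivation h h' t
    have ht' : lift k ι t = 0 := ht
    refine ⟨evalRight ψ u, ?_, ?_⟩
    · rw [SetLike.mem_coe, LinearMap.mem_ker, ← map_evalRight, hu, ht', map_zero, map_zero]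
    · rw [← map_evalRight, hu']
      rfl

/-- Two Nichols algebras of the same braided vector space are isomorphic. -/
lemma exists_linearEquiv (h : IsNicholsAlgebra B H 𝒜 ι) (h' : IsNicholsAlgebra B H' 𝒜' ι') :
    ∃ f : R ≃ₗ[k] R', ∀ t, f (lift k ι t) = lift k ι' t := by
  refine ⟨((lift k ι).toLinearMap.quotKerEquivOfSurjective h.lift_surjective).symm.trans
    ((Submodule.quotEquivOfEq _ _ ((ker_lift_le h h').antisymm (ker_lift_le h' h))).trans
      ((lift k ι').toLinearMap.quotKerEquivOfSurjective h'.lift_surjective)), fun t => ?_⟩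
  have h1 : ((lift k ι).toLinearMap.quotKerEquivOfSurjective h.lift_surjective).symm (lift k ι t) =
      Submodule.Quotient.mk t := by
    rw [LinearEquiv.symm_apply_eq]
    rfl
  rw [LinearEquiv.trans_apply, h1]
  rfl

variable {f : R →ₗ[k] R'}

lemma map_c_mul (hf : ∀ x y, f (x * y) = f x * f y) {x x' : R}
    (hx : ∀ y, TensorProduct.map f f (H.c (x ⊗ₜ y)) = H'.c (f x ⊗ₜ f y))
    (hx' : ∀ y, TensorProduct.map f f (H.c (x' ⊗ₜ y)) = H'.c (f x' ⊗ₜ f y)) (y : R) :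
    TensorProduct.map f f (H.c ((x * x') ⊗ₜ y)) = H'.c (f (x * x') ⊗ₜ f y) := by
  have h1 := LinearMap.congr_fun H.mul_left ((x ⊗ₜ x') ⊗ₜ y)
  have h2 := LinearMap.congr_fun H'.mul_left ((f x ⊗ₜ f x') ⊗ₜ f y)
  simp only [LinearMap.comp_apply, LinearEquiv.coe_coe, TensorProduct.assoc_tmul,
    LinearMap.lTensor_tmul, LinearMap.mul'_apply, braidRight, LinearMap.rTensor_tmul] at h1 h2
  rw [hf, h1, h2, ← hx']
  generalize H.c (x' ⊗ₜ y) = s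
  induction s using TensorProduct.induction_on with
  | zero => simp
  | add x y hx hy => simp only [TensorProduct.tmul_add, map_add, hx, hy]
  | tmul a b =>
    simp only [braidLeft, TensorProduct.assoc_symm_tmul, TensorProduct.map_tmul,
      LinearMap.rTensor_tmul, LinearEquiv.coe_coe, ← hx]
    generalize H.c (x ⊗ₜ a) = z
    induction z using TensorProduct.induction_on with
    | zero => simp
    | add x y hx hy => simp only [TensorProduct.add_tmul, map_add, hx, hy]
    | tmul c d => simp [hf]

/-- With a vector on the left, both braidings are images of one lift to `T(V) ⊗ V`. Arbitrary left
factors follow because braiding commutes with multiplication and vectors generate. -/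
lemma map_c (h : IsNicholsAlgebra B H 𝒜 ι) (h' : IsNicholsAlgebra B H' 𝒜' ι')
    (hf : ∀ x y, f (x * y) = f x * f y) (hfl : ∀ t, f (lift k ι t) = lift k ι' t) (t : R ⊗[k] R) :
    TensorProduct.map f f (H.c t) = H'.c (TensorProduct.map f f t) := by
  have hf1 : f 1 = 1 := by simpa using hfl 1
  have hι : ∀ v y, TensorProduct.map f f (H.c (ι v ⊗ₜ y)) = H'.c (f (ι v) ⊗ₜ f y) := by
    intro v y
    obtain ⟨s, rfl⟩ := h.lift_surjective y
    obtain ⟨U, hU, hU'⟩ := exists_lift_c h h' s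
    have h1 : f ∘ₗ (lift k ι).toLinearMap = (lift k ι').toLinearMap := LinearMap.ext hfl
    have h2 : f ∘ₗ ι = ι' := LinearMap.ext fun v => by simpa using hfl (TensorAlgebra.ι k v)
    rw [← hU, hfl, show f (ι v) = ι' v from LinearMap.congr_fun h2 v, ← hU', ← h1, ← h2,
      TensorProduct.map_comp]
    rfl
  have key : ∀ s y, TensorProduct.map f f (H.c (lift k ι s ⊗ₜ y)) =
      H'.c (f (lift k ι s) ⊗ₜ f y) := by
    intro s
    induction s using induction_cons with
    | one => intro y; simp [H.one_left, H'.one_left, hf1]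
    | smul a x hx => intro y; simp only [map_smul, ← TensorProduct.smul_tmul', hx]
    | add x y hx hy => intro z; simp only [map_add, TensorProduct.add_tmul, hx, hy]
    | cons v x hx =>
      rw [map_mul, lift_ι_apply]
      exact map_c_mul hf (hι v) hx
  induction t using TensorProduct.induction_on with
  | zero => simp
  | add x y hx hy => simp only [map_add, hx, hy]
  | tmul x y =>
    obtain ⟨s, rfl⟩ := h.lift_surjective x
    exact key s y

/-- Both coproducts are multiplicative for the braided product of the tensor square, which `f ⊗ f`
respects by `map_c`, and they agree on vectors because these are primitive. -/
lemma map_comul (h : IsNicholsAlgebra B H 𝒜 ι) (h' : IsNicholsAlgebra B H' 𝒜' ι')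
    (hf : ∀ x y, f (x * y) = f x * f y) (hfl : ∀ t, f (lift k ι t) = lift k ι' t) (x : R) :
    TensorProduct.map f f (Coalgebra.comul (R := k) x) = Coalgebra.comul (R := k) (f x) := by
  have hf1 : f 1 = 1 := by simpa using hfl 1
  have hmul : ∀ t : (R ⊗[k] R) ⊗[k] (R ⊗[k] R), TensorProduct.map f f
      (TensorProduct.map (LinearMap.mul' k R) (LinearMap.mul' k R) t) =
      TensorProduct.map (LinearMap.mul' k R') (LinearMap.mul' k R')
        (TensorProduct.map (TensorProduct.map f f) (TensorProduct.map f f) t) := by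
    intro t
    rw [← LinearMap.comp_apply, ← LinearMap.comp_apply, ← TensorProduct.map_comp,
      ← TensorProduct.map_comp]
    congr 2 <;> exact TensorProduct.ext' fun x y => by simp [hf]
  obtain ⟨s, rfl⟩ := h.lift_surjective x
  induction s using induction_cons with
  | one => simp [H.comul_one, H'.comul_one, hf1]
  | smul a x hx => simp only [map_smul, hx]
  | add x y hx hy => simp only [map_add, hx, hy]
  | cons v x hx =>
    have hι : f (ι v) = ι' v := by simpa using hfl (TensorAlgebra.ι k v)
    have h1 := LinearMap.congr_fun H.comul_mul (ι v ⊗ₜ lift k ι x)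
    have h2 := LinearMap.congr_fun H'.comul_mul (ι' v ⊗ₜ f (lift k ι x))
    simp only [LinearMap.comp_apply, LinearMap.mul'_apply, TensorProduct.map_tmul] at h1 h2
    rw [map_mul, lift_ι_apply, hf, hι, h1, h2, hmul,
      map_braidMiddle (c := H.c.toLinearMap) (d := H'.c.toLinearMap) (h.map_c h' hf hfl),
      TensorProduct.map_tmul, hx, h.comul_ι, h'.comul_ι, map_add, TensorProduct.map_tmul,
      TensorProduct.map_tmul, hf1, hι]

end Comparison

/-! ### The automorphism group -/

section Automorphisms

variable {k : Type u} {V : Type v} {R : Type w} [Field k] [AddCommGroup V]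
    [Module k V] [Ring R] [Algebra k R] [Coalgebra k R] {B : Braiding k V}
    {H : BraidedHopfAlgebra k R} {𝒜 : ℕ → Submodule k R} {ι : V →ₗ[k] R}

/-- Changing the identification of `V` with the degree one part by an element of `GL(V, c)`. -/
lemma comp_mem_GL (h : IsNicholsAlgebra B H 𝒜 ι) {g : V ≃ₗ[k] V} (hg : g ∈ B.GL) :
    IsNicholsAlgebra B H 𝒜 (ι ∘ₗ g.toLinearMap) where
  isInternal := h.isInternal
  mul_mem := h.mul_mem
  comul_mem := h.comul_mem
  counit_eq_zero := h.counit_eq_zero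
  braiding_mem := h.braiding_mem
  degree_zero := h.degree_zero
  injective := h.injective.comp g.injective
  range_eq := by rw [LinearMap.range_comp_of_range_eq_top _ g.range, h.range_eq]
  braiding_eq t := by
    rw [TensorProduct.map_comp, LinearMap.comp_apply, LinearMap.comp_apply, h.braiding_eq, hg]
  primitive_iff := h.primitive_iff
  adjoin_eq := h.adjoin_eq

/-- Every element of `GL(V, c)` extends to an automorphism of the Nichols algebra. -/
lemma exists_aut (h : IsNicholsAlgebra B H 𝒜 ι) (g : B.GL) :
    ∃ f : H.Aut, ∀ v, (f : R ≃ₗ[k] R) (ι v) = ι ((g : V ≃ₗ[k] V) v) := by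
  -- `R` is compared with itself, the second time with `V` embedded through `g`; the comparison
  -- isomorphism extends `g`.
  have h' := h.comp_mem_GL g.2
  obtain ⟨f, hf⟩ := exists_linearEquiv h h'
  have hmul : ∀ x y, f (x * y) = f x * f y := by
    intro x y
    obtain ⟨s, rfl⟩ := h.lift_surjective x
    obtain ⟨t, rfl⟩ := h.lift_surjective y
    rw [← map_mul, hf, hf, hf, map_mul]
  exact ⟨⟨f, hmul, h.map_comul h' (f := f.toLinearMap) hmul hf,
    h.map_c h' (f := f.toLinearMap) hmul hf⟩, fun v => by simpa using hf (TensorAlgebra.ι k v)⟩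

/-- Preservation of the unit is not part of `Aut`; it follows from surjectivity, since `f 1` is a
right unit for a preimage of `1` after applying `f`. -/
lemma aut_one (f : H.Aut) : (f : R ≃ₗ[k] R) 1 = 1 := by
  obtain ⟨x, hx⟩ := (f : R ≃ₗ[k] R).surjective 1
  have := f.2.1 x 1
  rwa [mul_one, hx, one_mul, eq_comm] at this

/-- An automorphism is not assumed to preserve the grading, but it maps primitives to primitives,
and these form the degree one part. -/
lemma exists_aut_ι (h : IsNicholsAlgebra B H 𝒜 ι) (f : H.Aut) :
    ∃ g : V →ₗ[k] V, ∀ v, (f : R ≃ₗ[k] R) (ι v) = ι (g v) := by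
  have key : ∀ v, (f : R ≃ₗ[k] R) (ι v) ∈ LinearMap.range ι := by
    intro v
    rw [h.range_eq, ← h.primitive_iff, ← f.2.2.1, h.comul_ι, map_add, TensorProduct.map_tmul,
      TensorProduct.map_tmul, LinearEquiv.coe_coe, aut_one]
  refine ⟨(LinearEquiv.ofInjective ι h.injective).symm.toLinearMap ∘ₗ
    ((f : R ≃ₗ[k] R).toLinearMap ∘ₗ ι).codRestrict (LinearMap.range ι) key, fun v => ?_⟩
  exact (congrArg Subtype.val ((LinearEquiv.ofInjective ι h.injective).apply_symm_apply
    ⟨(f : R ≃ₗ[k] R) (ι v), key v⟩)).symm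

/-- Every automorphism of the Nichols algebra restricts to an element of `GL(V, c)`. -/
lemma exists_restrict (h : IsNicholsAlgebra B H 𝒜 ι) (f : H.Aut) :
    ∃ g : B.GL, ∀ v, (f : R ≃ₗ[k] R) (ι v) = ι ((g : V ≃ₗ[k] V) v) := by
  obtain ⟨g, hg⟩ := h.exists_aut_ι f
  obtain ⟨g', hg'⟩ := h.exists_aut_ι f⁻¹
  let e : V ≃ₗ[k] V := LinearEquiv.ofLinearMap g g'
    (LinearMap.ext fun v => h.injective <| by
      change ι (g (g' v)) = ι v
      rw [← hg, ← hg']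
      exact (f : R ≃ₗ[k] R).apply_symm_apply _)
    (LinearMap.ext fun v => h.injective <| by
      change ι (g' (g v)) = ι v
      rw [← hg', ← hg]
      exact (f : R ≃ₗ[k] R).symm_apply_apply _)
  -- Compatibility of the restriction with `c` is tested in `R ⊗ R`, where `f` commutes with the
  -- braiding.
  refine ⟨⟨e, fun t => TensorProduct.map_injective_of_field h.injective h.injective ?_⟩, hg⟩
  have hι : ∀ t, TensorProduct.map ι ι (TensorProduct.map e.toLinearMap e.toLinearMap t) =
      TensorProduct.map (f : R ≃ₗ[k] R).toLinearMap (f : R ≃ₗ[k] R).toLinearMap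
        (TensorProduct.map ι ι t) := by
    intro t
    rw [← LinearMap.comp_apply, ← LinearMap.comp_apply, ← TensorProduct.map_comp,
      ← TensorProduct.map_comp, show ι ∘ₗ e.toLinearMap = (f : R ≃ₗ[k] R).toLinearMap ∘ₗ ι from
        LinearMap.ext fun v => (hg v).symm]
  rw [hι, ← h.braiding_eq, ← h.braiding_eq, hι, f.2.2.2]

lemma aut_ext (h : IsNicholsAlgebra B H 𝒜 ι) {f f' : H.Aut}
    (hff : ∀ v, (f : R ≃ₗ[k] R) (ι v) = (f' : R ≃ₗ[k] R) (ι v)) : f = f' := by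
  refine Subtype.ext (LinearEquiv.ext fun x => ?_)
  obtain ⟨t, rfl⟩ := h.lift_surjective x
  induction t using induction_cons with
  | one => rw [map_one, aut_one, aut_one]
  | smul a x hx => rw [map_smul, map_smul, map_smul, hx]
  | add x y hx hy => rw [map_add, map_add, map_add, hx, hy]
  | cons v x hx => rw [map_mul, lift_ι_apply, f.2.1, f'.2.1, hx, hff]

theorem exists_mulEquiv (h : IsNicholsAlgebra B H 𝒜 ι) :
    ∃ Φ : B.GL ≃* H.Aut, ∀ (g : B.GL) (v : V),
      (Φ g : R ≃ₗ[k] R) (ι v) = ι ((g : V ≃ₗ[k] V) v) := by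
  choose Φ hΦ using h.exists_aut
  choose Ψ hΨ using h.exists_restrict
  refine ⟨
    { toFun := Φ
      invFun := Ψ
      left_inv := fun g => Subtype.ext <| LinearEquiv.ext fun v => h.injective <| by
        rw [← hΨ, hΦ]
      right_inv := fun f => h.aut_ext fun v => by rw [hΦ, hΨ]
      map_mul' := fun g g' => h.aut_ext fun v => ?_ }, hΦ⟩
  rw [hΦ]
  change ι ((g : V ≃ₗ[k] V) ((g' : V ≃ₗ[k] V) v)) =
    (Φ g : R ≃ₗ[k] R) ((Φ g' : R ≃ₗ[k] R) (ι v))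
  rw [hΦ, hΦ]

end Automorphisms

end IsNicholsAlgebra

end

theorem theorem1p2 {k : Type u} {V : Type v} [Field k] [AddCommGroup V] [Module k V]
    (B : Braiding k V) :
    (∃ (R : Type (max u v)) (_ : Ring R) (_ : Algebra k R) (_ : Coalgebra k R)
      (H : BraidedHopfAlgebra k R) (𝒜 : ℕ → Submodule k R) (ι : V →ₗ[k] R),
      IsNicholsAlgebra B H 𝒜 ι) ∧
    ∀ (R : Type w) [Ring R] [Algebra k R] [Coalgebra k R]
      (H : BraidedHopfAlgebra k R) (𝒜 : ℕ → Submodule k R) (ι : V →ₗ[k] R),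
      IsNicholsAlgebra B H 𝒜 ι →
        ∃ Φ : B.GL ≃* H.Aut, ∀ (g : B.GL) (v : V),
          (Φ g : R ≃ₗ[k] R) (ι v) = ι ((g : V ≃ₗ[k] V) v) := by
  refine ⟨⟨B.Nichols, inferInstance, inferInstance, inferInstance,
    Braiding.Nichols.braidedHopfAlgebra B, Braiding.Nichols.grade B,
    Braiding.Nichols.proj B ∘ₗ TensorAlgebra.ι k, Braiding.Nichols.isNicholsAlgebra B⟩, ?_⟩
  intro R _ _ _ H 𝒜 ι h
  exact h.exists_mulEquiv
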